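/- Let $n\ge 2$. Let $G'_n$ be the random graph consisting of two balanced binary trees of height $n$ (left and right) whose leaves are joined by a uniformly random cycle alternating between left and right leaves: with $l_0,\dots,l_{2^n-1}$ and $r_0,\dots,r_{2^n-1}$ independent uniformly random orderings of the left and of the right leaves, the cycle is $l_0r_0l_1r_1\cdots l_{2^n-1}r_{2^n-1}l_0$. The root of the left tree is the ENTRANCE and the root of the right tree is the EXIT. A vertex at depth $d$ of the left tree is in column $d$, a vertex at depth $d$ of the right tree is in column $2n+1-d$. The edges of $G'_n$ are coloured at random with nine colours: every vertex in an even column gives its incident edges distinct letters from $\{A,B,C\}$, and every vertex in an odd column gives its incident edges distinct digits from $\{1,2,3\}$, uniformly at random and independently for different vertices; the colour of an edge is the letter and the digit it has received. The vertices are given pairwise distinct names in $\{0,1\}^{2n}$, the ENTRANCE being named $0\cdots0$; the naming is uniformly random among all such namings and, given the graph, independent of the colouring. A classical algorithm is a randomized adaptive procedure that at each step either stops or sends a string $a\in\{0,1\}^{2n}$ to the oracle, depending on its own random coins and on the previous queries and answers. If $a$ is the name of a vertex, the oracle returns the names of the neighbours of that vertex together with the colours of the edges joining them to it; otherwise it reports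 that $a$ is not a name. The algorithm finds the EXIT if it ever sends the name of the EXIT to the oracle. Then every classical algorithm that makes at most $2^{n/6}$ queries (for all outcomes of its coins and of the oracle) finds the EXIT with probability at most $4\cdot 2^{-n/6}$, the probability being taken over the graph, the colouring, the names and the coins of the algorithm. -/

import Mathlib

open scoped BigOperators

namespace GluedTrees

/-- Vertices of the balanced binary tree of height `n`: binary words of length at most `n`.
The root is the empty word and the children of `w` are `false :: w` and `true :: w`. -/
abbrev TreeNode (n : ℕ) : Type := {w : List Bool // w.length ≤ n}

/-- Leaves of the balanced binary tree of height `n`: binary words of length exactly `n`. -/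
abbrev Leaf (n : ℕ) : Type := {w : List Bool // w.length = n}

/-- Vertices of the graph: the left tree (`Sum.inl`) and the right tree (`Sum.inr`). -/
abbrev Vertex (n : ℕ) : Type := TreeNode n ⊕ TreeNode n

/-- The ENTRANCE: the root of the left tree. -/
def entrance (n : ℕ) : Vertex n := Sum.inl ⟨[], Nat.zero_le n⟩

/-- The EXIT: the root of the right tree. -/
def exit (n : ℕ) : Vertex n := Sum.inr ⟨[], Nat.zero_le n⟩

/-- The column of a vertex: the ENTRANCE is in column `0`, the EXIT in column `2 * n + 1`. -/
def column {n : ℕ} : Vertex n → ℕ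
  | Sum.inl u => u.1.length
  | Sum.inr u => 2 * n + 1 - u.1.length

/-- The successive choices that build the alternating cycle: an ordering `l₀, l₁, …` of the left
leaves and an ordering `r₀, r₁, …` of the right leaves.  The cycle is `l₀ r₀ l₁ r₁ l₂ …`, closed
up at the end.  Drawing each leaf uniformly among the remaining ones of its side makes the pair
of orderings uniform. -/
abbrev LeafCycle (n : ℕ) : Type := (Fin (2 ^ n) ≃ Leaf n) × (Fin (2 ^ n) ≃ Leaf n)

/-- `Linked Z x y`: `y` is a child of `x` in one of the trees, or `x` is a left leaf, `y` a right
leaf, and they are consecutive on the cycle (`i + 1` is cyclic in `Fin (2 ^ n)`). -/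
def Linked {n : ℕ} (Z : LeafCycle n) : Vertex n → Vertex n → Prop
  | Sum.inl u, Sum.inl v => ∃ b : Bool, v.1 = b :: u.1
  | Sum.inr u, Sum.inr v => ∃ b : Bool, v.1 = b :: u.1
  | Sum.inl u, Sum.inr v =>
      ∃ i : Fin (2 ^ n), (u.1 = (Z.1 i).1 ∨ u.1 = (Z.1 (i + 1)).1) ∧ v.1 = (Z.2 i).1
  | Sum.inr _, Sum.inl _ => False

/-- The graph: two balanced binary trees of height `n` whose leaves are joined by the cycle. -/
def graph {n : ℕ} (Z : LeafCycle n) : SimpleGraph (Vertex n) := SimpleGraph.fromRel (Linked Z)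

/-- The choices that build the edge colouring: every vertex gives distinct labels out of three to
its incident edges (equivalently, to its neighbours). -/
abbrev Coloring {n : ℕ} (Z : LeafCycle n) : Type :=
  (v : Vertex n) → ((graph Z).neighborSet v ↪ Fin 3)

/-- The nine colours: a letter `A, B, C` and a digit `1, 2, 3`. -/
abbrev Color : Type := Fin 3 × Fin 3

/-- The colour of an edge: its letter is the label given by the endpoint in the even column, its
digit the label given by the endpoint in the odd column. -/
def edgeColor {n : ℕ} {Z : LeafCycle n} (C : Coloring Z) {v u : Vertex n}
    (h : (graph Z).Adj v u) : Color :=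
  if Even (column v) then (C v ⟨u, h⟩, C u ⟨v, h.symm⟩) else (C u ⟨v, h.symm⟩, C v ⟨u, h⟩)

/-- Names are `2n`-bit strings. -/
abbrev Name (n : ℕ) : Type := Fin (2 * n) → Bool

/-- Distinct names for the vertices, the ENTRANCE having the all-zero string as its name. -/
abbrev Naming (n : ℕ) : Type := {f : Vertex n ↪ Name n // f (entrance n) = fun _ => false}

/-- What the oracle returns: the names of the neighbours, with the colours of the joining edges. -/
abbrev Answer (n : ℕ) : Type := Set (Name n × Color)

/-- The answer of the oracle to the query `a`.  It is the empty set exactly if `a` is not the name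
of a vertex, because every vertex has neighbours (for `n ≥ 1`). -/
def oracle {n : ℕ} {Z : LeafCycle n} (C : Coloring Z) (f : Naming n) (a : Name n) : Answer n :=
  {p | ∃ (v u : Vertex n) (h : (graph Z).Adj v u), f.1 v = a ∧ p = (f.1 u, edgeColor C h)}

/-- A deterministic query algorithm: given the queries made so far and their answers, it either
stops (`none`) or sends its next query. -/
abbrev Algorithm (n : ℕ) : Type := List (Name n × Answer n) → Option (Name n)

/-- The queries and answers of the first `k` steps of the algorithm `A` against the oracle `O`
(fewer than `k` of them if `A` stops earlier). -/
def transcript {n : ℕ} (A : Algorithm n) (O : Name n → Answer n) : ℕ → List (Name n × Answer n)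
  | 0 => []
  | k + 1 =>
    match A (transcript A O k) with
    | none => transcript A O k
    | some a => transcript A O k ++ [(a, O a)]

/-- The algorithm wins if it ever sends the name of the EXIT to the oracle. -/
def Wins {n : ℕ} (A : Algorithm n) {Z : LeafCycle n} (C : Coloring Z) (f : Naming n) : Prop :=
  ∃ k : ℕ, ∃ q ∈ transcript A (oracle C f) k, q.1 = f.1 (exit n)

noncomputable instance (n : ℕ) : Fintype (TreeNode n) :=
  (List.finite_length_le Bool n).fintype

instance (n : ℕ) : Fintype (Leaf n) := inferInstanceAs (Fintype (List.Vector Bool n))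

noncomputable instance {n : ℕ} (Z : LeafCycle n) : Fintype (Coloring Z) := Fintype.ofFinite _

noncomputable instance (n : ℕ) : Fintype (Naming n) := Fintype.ofFinite _

/-- The probability that the randomized algorithm `A` (with random coins `ω` distributed according
to `μ`) wins, over uniform and independent choices of the cycle, of the labels of the edges at
each vertex, of the names, and over the coins. -/
noncomputable def successProb {n : ℕ} {Ω : Type*} [MeasurableSpace Ω]
    (μ : MeasureTheory.Measure Ω) (A : Ω → Algorithm n) : ℝ :=
  𝔼 Z : LeafCycle n, 𝔼 C : Coloring Z, 𝔼 f : Naming n, μ.real {ω | Wins (A ω) C f}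

/-! The three averages are over nonempty sets. -/

instance (n : ℕ) : Nonempty (LeafCycle n) := by
  have h : Fintype.card (Fin (2 ^ n)) = Fintype.card (Leaf n) := by
    rw [Fintype.card_fin]
    exact (card_vector (α := Bool) n).symm
  exact ⟨(Fintype.equivOfCardEq h, Fintype.equivOfCardEq h)⟩

theorem exists_three {n : ℕ} (Z : LeafCycle n) (v : Vertex n) :
    ∃ a b c : Vertex n, (graph Z).neighborSet v ⊆ {a, b, c} := by
  let emb : Leaf n → TreeNode n := fun l => ⟨l.1, l.2.le⟩
  have par : ∀ w : TreeNode n, w.1.tail.length ≤ n := fun w => by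
    have := w.2
    simp only [List.length_tail]
    omega
  rcases v with ⟨w, hw⟩ | ⟨w, hw⟩
  · by_cases hl : w.length = n
    · refine ⟨Sum.inl ⟨w.tail, par ⟨w, hw⟩⟩, Sum.inr (emb (Z.2 (Z.1.symm ⟨w, hl⟩))),
        Sum.inr (emb (Z.2 (Z.1.symm ⟨w, hl⟩ - 1))), ?_⟩
      rintro (⟨y, hy⟩ | ⟨y, hy⟩) ⟨-, h | h⟩
      · obtain ⟨b, rfl⟩ := h
        simp only [List.length_cons] at hy
        omega
      · obtain ⟨b, rfl⟩ := h
        simp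
      · obtain ⟨i, h1 | h1, h2⟩ := h
        · have : Z.1.symm ⟨w, hl⟩ = i := by
            rw [Equiv.symm_apply_eq]
            exact Subtype.ext h1
          simp only at h2
          simp [this, emb, h2]
        · have : Z.1.symm ⟨w, hl⟩ = i + 1 := by
            rw [Equiv.symm_apply_eq]
            exact Subtype.ext h1
          simp only at h2
          simp [this, emb, h2]
      · exact h.elim
    · refine ⟨Sum.inl ⟨w.tail, par ⟨w, hw⟩⟩, Sum.inl ⟨false :: w, by simp; omega⟩,
        Sum.inl ⟨true :: w, by simp; omega⟩, ?_⟩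
      rintro (⟨y, hy⟩ | ⟨y, hy⟩) ⟨-, h | h⟩
      · obtain ⟨b, rfl⟩ := h
        cases b <;> simp
      · obtain ⟨b, rfl⟩ := h
        simp
      · obtain ⟨i, h1 | h1, h2⟩ := h
        · exact absurd (by rw [show w = _ from h1]; exact (Z.1 i).2) hl
        · exact absurd (by rw [show w = _ from h1]; exact (Z.1 (i + 1)).2) hl
      · exact h.elim
  · by_cases hl : w.length = n
    · refine ⟨Sum.inr ⟨w.tail, par ⟨w, hw⟩⟩, Sum.inl (emb (Z.1 (Z.2.symm ⟨w, hl⟩))),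
        Sum.inl (emb (Z.1 (Z.2.symm ⟨w, hl⟩ + 1))), ?_⟩
      rintro (⟨y, hy⟩ | ⟨y, hy⟩) ⟨-, h | h⟩
      · exact h.elim
      · obtain ⟨i, h1, h2⟩ := h
        have : Z.2.symm ⟨w, hl⟩ = i := by
          rw [Equiv.symm_apply_eq]
          exact Subtype.ext h2
        simp only at h1
        rcases h1 with h1 | h1 <;> simp [this, emb, h1]
      · obtain ⟨b, rfl⟩ := h
        simp only [List.length_cons] at hy
        omega
      · obtain ⟨b, rfl⟩ := h
        simp
    · refine ⟨Sum.inr ⟨w.tail, par ⟨w, hw⟩⟩, Sum.inr ⟨false :: w, by simp; omega⟩,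
        Sum.inr ⟨true :: w, by simp; omega⟩, ?_⟩
      rintro (⟨y, hy⟩ | ⟨y, hy⟩) ⟨-, h | h⟩
      · exact h.elim
      · obtain ⟨i, h1, h2⟩ := h
        exact absurd (by rw [show w = _ from h2]; exact (Z.2 i).2) hl
      · obtain ⟨b, rfl⟩ := h
        cases b <;> simp
      · obtain ⟨b, rfl⟩ := h
        simp

instance {n : ℕ} (Z : LeafCycle n) : Nonempty (Coloring Z) := by
  refine ⟨fun v => Classical.choice ?_⟩
  obtain ⟨a, b, c, h⟩ := exists_three Z v
  have := Fintype.ofFinite ((graph Z).neighborSet v)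
  refine Function.Embedding.nonempty_of_card_le ?_
  rw [← Nat.card_eq_fintype_card, Fintype.card_fin]
  have h1 := Set.ncard_insert_le a {b, c}
  have h2 := Set.ncard_insert_le b {c}
  have h3 := Set.ncard_singleton c
  have h4 := Set.ncard_le_ncard h
  change ((graph Z).neighborSet v).ncard ≤ 3
  omega

theorem card_treeNode (n : ℕ) : Fintype.card (TreeNode n) + 1 = 2 ^ (n + 1) := by
  let e : TreeNode n ≃ Σ d : Fin (n + 1), List.Vector Bool d :=
    { toFun := fun w => ⟨⟨w.1.length, by have := w.2; omega⟩, ⟨w.1, rfl⟩⟩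
      invFun := fun x => ⟨x.2.1, by have := x.2.2; have := x.1.2; omega⟩
      left_inv := fun w => rfl
      right_inv := by
        rintro ⟨⟨d, hd⟩, ⟨w, hw⟩⟩
        simp only at hw
        subst hw
        rfl }
  rw [Fintype.card_congr e, Fintype.card_sigma]
  simp only [card_vector, Fintype.card_bool]
  rw [Fin.sum_univ_eq_sum_range (fun d => 2 ^ d), Nat.geomSum_eq le_rfl]
  have := Nat.one_le_two_pow (n := n + 1)
  simp; omega

theorem nonempty_naming {n : ℕ} (hn : 2 ≤ n) : Nonempty (Naming n) := by
  have hc : Fintype.card (Vertex n) ≤ Fintype.card (Name n) := by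
    have := card_treeNode n
    have h2 : 2 ^ (n + 2) ≤ 2 ^ (2 * n) := Nat.pow_le_pow_right (by norm_num) (by omega)
    rw [Fintype.card_sum]
    simp only [Fintype.card_pi, Fintype.card_bool, Finset.prod_const, Finset.card_univ,
      Fintype.card_fin]
    rw [pow_succ] at this h2
    omega
  obtain ⟨g⟩ := Function.Embedding.nonempty_of_card_le hc
  exact ⟨⟨g.trans (Equiv.swap (g (entrance n)) fun _ => false).toEmbedding, by simp⟩⟩

end GluedTrees

/-! The proof compares the oracle with a simulation that contains no graph. To the algorithm the
graph looks like an infinite binary tree in which it queries words, so its run can be generated from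
independent uniform labels `d` and names `x` indexed by words (`idealRun`). Two further families
decide afterwards where the tree lies in the graph. The coin `ε w` decides which of the two
continuations at `w` is which, and `e w` supplies, at a leaf, the missing half of a pair (leaf,
cycle position): the position if the leaf was entered from its parent, the leaf if it was entered
along the cycle. Each word thus becomes a non-backtracking walk (`place`).

A seed is good if the run is `Fresh` (known names are distinct and were never guessed) and the known
walks are `Tame`. Tameness forbids `h + 1` consecutive steps towards the root, leaves drawn inside
the height-`h` neighbourhood of other walks, and excursions along the cycle that could run into each
other. Then the walks embed the known tree injectively and miss the EXIT: the right root lies at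
distance `n > h` from every leaf. A union bound shows that bad seeds are rare (`card_not_good`).

The simulation is transferred to the true oracle by double counting pairs of a good seed and a
compatible world (cycle, colouring, naming). Let the weight of a seed be the number of values its
used coordinates could have taken. A good seed fits at least the fraction `(1 - δ) / weight` of all
worlds, because sampling without replacement hits prescribed distinct values at least as often as
independent sampling does; `δ` pays for guesses that happen to be names (`le_weight_mul_expect`).
Conversely a world determines every coordinate used by a good compatible seed, since the algorithm's
view can be decoded step by step (`agree_of_compat`). The weights of the good seeds compatible with
one world therefore sum to at most the number of seeds (`sum_weight_le`). A world with a good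
compatible seed is not won (`GoodWalk.not_wins`). Averaging over worlds, `(1 - δ) (1 - B) ≤ 1 - p`,
where `p` is the winning probability and `B` bounds the share of bad seeds; hence `p ≤ δ + B`
(`expect_wins_le`).

With `u = 2 ^ (n / 6)`, at most `u` queries and `2 ^ h` about `u ^ 2`, the long climbs cost at most
`2 / u` and all other terms together at most `2 / u` once `13 ≤ n`; for smaller `n` the claimed
bound is at least `1`. The coins of the algorithm are integrated out at the end (`successProb_le`).
-/

namespace GluedTrees

/-! ### Counting tools: resampling a coordinate, and injections with prescribed values. -/

section Counting

open Finset Classical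

/-- Resampling: if the condition `P`, the inspected coordinate `idx g` and the target set `H g` do
not change when the inspected coordinate is resampled, then it lies in the target set with
conditional probability at most `r / |α|`. -/
theorem card_resample {I α : Type*} [Fintype I] [DecidableEq I] [Fintype α]
    (P : (I → α) → Prop) (idx : (I → α) → I) (H : (I → α) → Finset α) (r : ℕ)
    (hH : ∀ g, P g → (H g).card ≤ r)
    (hinv : ∀ g, P g → ∀ y, P (Function.update g (idx g) y) ∧
      idx (Function.update g (idx g) y) = idx g ∧ H (Function.update g (idx g) y) = H g) :
    (univ.filter fun g => P g ∧ g (idx g) ∈ H g).card * Fintype.card α ≤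
      r * (univ.filter fun g => P g).card := by
  set X := univ.filter fun g : I → α => P g ∧ g (idx g) ∈ H g with hX
  have h1 : X.card * Fintype.card α = (X ×ˢ (univ : Finset α)).card := by
    rw [card_product, card_univ]
  rw [h1]
  -- Overwrite the inspected coordinate. A result `g'` has at most `r` preimages: it still reveals
  -- which coordinate was overwritten, and the lost value lies in `H g'`.
  refine card_le_mul_card_image_of_maps_to
    (f := fun p : (I → α) × α => Function.update p.1 (idx p.1) p.2) ?_ r ?_
  · rintro ⟨g, y⟩ hg
    simp only [hX, mem_product, mem_filter, mem_univ, true_and, and_true] at hg ⊢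
    exact (hinv g hg.1 y).1
  · intro g' hg'
    simp only [mem_filter, mem_univ, true_and] at hg'
    refine le_trans ?_ (hH g' hg')
    refine card_le_card_of_injOn (fun p => p.1 (idx p.1)) ?_ ?_
    · rintro ⟨g, y⟩ hg
      simp only [hX, coe_filter, mem_product, mem_filter, mem_univ, true_and, and_true,
        Set.mem_ofPred_eq] at hg
      obtain ⟨⟨hP, hm⟩, rfl⟩ := hg
      simpa [(hinv g hP y).2.2] using hm
    · rintro ⟨g, y⟩ hg ⟨g₂, y₂⟩ hg₂ h
      simp only [hX, coe_filter, mem_product, mem_filter, mem_univ, true_and, and_true,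
        Set.mem_ofPred_eq] at hg hg₂ h
      obtain ⟨⟨hP, -⟩, e1⟩ := hg
      obtain ⟨⟨hP₂, -⟩, e2⟩ := hg₂
      have i1 := (hinv g hP y).2.1
      have i2 := (hinv g₂ hP₂ y₂).2.1
      rw [e1] at i1
      rw [e2] at i2
      have e := e1.trans e2.symm
      have hi : idx g = idx g₂ := i1.symm.trans i2
      have hy : y = y₂ := by
        have := congrFun e (idx g)
        rw [Function.update_self, hi, Function.update_self] at this
        exact this
      have hg : g = g₂ := by
        funext i
        by_cases hi' : i = idx g
        · rw [hi', h, ← hi]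
        · have := congrFun e i
          rwa [Function.update_of_ne hi', Function.update_of_ne (hi ▸ hi')] at this
      rw [hg, hy]

/-- Resampling at a fixed coordinate. -/
theorem card_resample_const {I α : Type*} [Fintype I] [DecidableEq I] [Fintype α] (i : I)
    (H : (I → α) → Finset α) (r : ℕ) (hH : ∀ g, (H g).card ≤ r)
    (hinv : ∀ g y, H (Function.update g i y) = H g) :
    (univ.filter fun g : I → α => g i ∈ H g).card * Fintype.card α ≤
      r * Fintype.card (I → α) := by
  have := card_resample (fun _ : I → α => True) (fun _ => i) H r (fun g _ => hH g)
    (fun g _ y => ⟨trivial, rfl, hinv g y⟩)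
  simpa only [true_and, filter_true, card_univ] using this

/-- The functions agreeing with a given one on `U` are a fraction `|α| ^ (-|U|)` of all. -/
theorem card_agree {I α : Type*} [Fintype I] [DecidableEq I] [Fintype α] (U : Finset I) (g₀ : I → α) :
    (univ.filter fun g : I → α => ∀ i ∈ U, g i = g₀ i).card * Fintype.card α ^ U.card =
      Fintype.card (I → α) := by
  have : (univ.filter fun g : I → α => ∀ i ∈ U, g i = g₀ i) =
      Fintype.piFinset fun i => if i ∈ U then {g₀ i} else univ := by
    ext g
    simp only [mem_filter, mem_univ, true_and, Fintype.mem_piFinset]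
    refine forall_congr' fun i => ?_
    by_cases h : i ∈ U <;> simp [h]
  rw [this, Fintype.card_piFinset, Fintype.card_fun]
  have h2 : ∀ i, (if i ∈ U then {g₀ i} else (univ : Finset α)).card =
      if i ∈ U then 1 else Fintype.card α := fun i => by
    by_cases h : i ∈ U <;> simp [h]
  simp_rw [h2]
  rw [prod_ite, prod_const_one, one_mul, prod_const, ← pow_add]
  congr 1
  have := card_filter_add_card_filter_not (s := (univ : Finset I)) (fun i => i ∈ U)
  rw [filter_mem_eq_inter, univ_inter, card_univ] at this
  omega

/-- A bound on the sections of a relation over the first factor bounds the relation. -/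
theorem card_filter_prod_le {α β : Type*} [Fintype α] [Fintype β] (R : α → β → Prop)
    [∀ a, DecidablePred (R a)] [DecidablePred fun p : α × β => R p.1 p.2] (r : ℝ)
    (hR : ∀ a, ((univ.filter fun b => R a b).card : ℝ) ≤ r * Fintype.card β) :
    ((univ.filter fun p : α × β => R p.1 p.2).card : ℝ) ≤
      r * (Fintype.card α * Fintype.card β) := by
  have : (univ.filter fun p : α × β => R p.1 p.2).card =
      ∑ a, (univ.filter fun b => R a b).card := by
    simp_rw [card_filter]
    rw [← univ_product_univ, sum_product]
    exact sum_congr rfl fun a _ => sum_congr rfl fun b _ => by congr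
  rw [this]
  push_cast
  refine (sum_le_card_nsmul _ _ _ fun a _ => hR a).trans (le_of_eq ?_)
  rw [card_univ, nsmul_eq_mul]
  ring

/-- A bound on the sections of a relation over the second factor bounds the relation. -/
theorem card_filter_prod_le_right {α β : Type*} [Fintype α] [Fintype β] (R : α → β → Prop)
    [∀ b, DecidablePred fun a => R a b] [DecidablePred fun p : α × β => R p.1 p.2] (r : ℝ)
    (hR : ∀ b, ((univ.filter fun a => R a b).card : ℝ) ≤ r * Fintype.card α) :
    ((univ.filter fun p : α × β => R p.1 p.2).card : ℝ) ≤
      r * (Fintype.card α * Fintype.card β) := by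
  have : (univ.filter fun p : α × β => R p.1 p.2).card =
      ∑ b, (univ.filter fun a => R a b).card := by
    simp_rw [card_filter]
    rw [← univ_product_univ, sum_product_right]
    exact sum_congr rfl fun b _ => sum_congr rfl fun a _ => by congr
  rw [this]
  push_cast
  refine (sum_le_card_nsmul _ _ _ fun b _ => hR b).trans (le_of_eq ?_)
  rw [card_univ, nsmul_eq_mul]
  ring

section Pin

variable {E α β ι : Type*} [Fintype E] [DecidableEq β]
  (ev : E → α → β) (act : β → β → E → E)

/-- The maps in a family `ev : E → α → β` with prescribed values `b j` at `a j`, for `j ∈ J`. -/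
noncomputable def pinned (a : ι → α) (b : ι → β) (J : Finset ι) : Finset E :=
  univ.filter fun e => ∀ j ∈ J, ev e (a j) = b j

/-- Exchanging the values `y` and `y'` is an injection between the two sets: it disturbs no pinned
value, because `y'` is not pinned and `y` is already taken at the unpinned place `i`. One abstract
family `E` covers bijections, embeddings and labellings alike. -/
theorem card_pinned_swap (hext : Function.Injective ev) (hinj : ∀ e, Function.Injective (ev e))
    (hact : ∀ y y' e i, ev (act y y' e) i = Equiv.swap y y' (ev e i))
    (a : ι → α) (b : ι → β) (J : Finset ι) (i : α) (hi : ∀ j ∈ J, a j ≠ i) (y y' : β)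
    (hy' : ∀ j ∈ J, b j ≠ y') :
    ((pinned ev a b J).filter fun e => ev e i = y).card ≤
      ((pinned ev a b J).filter fun e => ev e i = y').card := by
  refine card_le_card_of_injOn (act y y') ?_ ?_
  · intro e he
    simp only [pinned, coe_filter, mem_filter, mem_univ, true_and, Set.mem_ofPred_eq] at he ⊢
    refine ⟨fun j hj => ?_, ?_⟩
    · rw [hact, he.1 j hj, Equiv.swap_apply_of_ne_of_ne _ (hy' j hj)]
      rw [← he.1 j hj, ← he.2]
      exact fun h => hi j hj (hinj e h)
    · rw [hact, he.2, Equiv.swap_apply_left]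
  · intro e _ e' _ h
    apply hext
    funext k
    have := congrFun (congrArg ev h) k
    rw [hact, hact] at this
    exact (Equiv.swap y y').injective this

variable [Fintype β]

/-- Among all values at a new place, one that is not yet pinned is at least as frequent as any
other, so its share is at least `1 / |β|`. -/
theorem card_pinned_insert [DecidableEq ι] (hext : Function.Injective ev)
    (hinj : ∀ e, Function.Injective (ev e))
    (hact : ∀ y y' e i, ev (act y y' e) i = Equiv.swap y y' (ev e i))
    (a : ι → α) (b : ι → β) (J : Finset ι) (i : ι) (hi : ∀ j ∈ J, a j ≠ a i)
    (hb : ∀ j ∈ J, b j ≠ b i) :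
    (pinned ev a b J).card ≤ Fintype.card β * (pinned ev a b (insert i J)).card := by
  have h1 : (pinned ev a b J).card =
      ∑ y : β, ((pinned ev a b J).filter fun e => ev e (a i) = y).card :=
    card_eq_sum_card_fiberwise fun _ _ => mem_univ _
  have h2 : (pinned ev a b (insert i J)) = (pinned ev a b J).filter fun e => ev e (a i) = b i := by
    ext e
    simp [pinned, and_comm]
  rw [h1, h2, ← card_univ, ← smul_eq_mul]
  exact sum_le_card_nsmul _ _ _ fun y _ =>
    card_pinned_swap ev act hext hinj hact a b J (a i) hi y (b i) hb

/-- Injective maps take prescribed distinct values at least as often as independent uniform choices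
would. The conditions `J₀` hold beforehand; this accommodates the fixed name of the ENTRANCE. -/
theorem card_pinned [DecidableEq ι] (hext : Function.Injective ev) (hinj : ∀ e, Function.Injective (ev e))
    (hact : ∀ y y' e i, ev (act y y' e) i = Equiv.swap y y' (ev e i))
    (a : ι → α) (b : ι → β) (J₀ J : Finset ι) (hd : Disjoint J₀ J)
    (ha : Set.InjOn a ↑(J₀ ∪ J)) (hb : Set.InjOn b ↑(J₀ ∪ J)) :
    (pinned ev a b J₀).card ≤ Fintype.card β ^ J.card * (pinned ev a b (J₀ ∪ J)).card := by
  induction J using Finset.induction_on with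
  | empty => simp
  | insert i J hi ih =>
    have hd' : Disjoint J₀ J := hd.mono_right (subset_insert _ _)
    have hs : J₀ ∪ J ⊆ J₀ ∪ insert i J := union_subset_union_right (subset_insert _ _)
    have hmem : i ∈ J₀ ∪ insert i J := by simp
    have hnot : i ∉ J₀ ∪ J := by
      rw [mem_union, not_or]
      exact ⟨fun h => disjoint_left.mp hd h (mem_insert_self _ _), hi⟩
    refine (ih hd' (ha.mono (by exact_mod_cast hs)) (hb.mono (by exact_mod_cast hs))).trans ?_
    rw [card_insert_of_notMem hi, pow_succ, mul_assoc, union_insert]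
    refine Nat.mul_le_mul_left _ (card_pinned_insert ev act hext hinj hact a b _ i ?_ ?_)
    · exact fun j hj h => hnot (ha (hs hj) hmem h ▸ hj)
    · exact fun j hj h => hnot (hb (hs hj) hmem h ▸ hj)

/-- Few of the pinned maps hit a small set of forbidden values. -/
theorem card_pinned_hit [Fintype α] (hext : Function.Injective ev)
    (hinj : ∀ e, Function.Injective (ev e))
    (hact : ∀ y y' e i, ev (act y y' e) i = Equiv.swap y y' (ev e i))
    (a : ι → α) (b : ι → β) (J : Finset ι) (G : Finset β) (hG : ∀ j ∈ J, b j ∉ G) :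
    ((pinned ev a b J).filter fun e => ∃ i, ev e i ∈ G).card * (Fintype.card β - J.card) ≤
      G.card * Fintype.card α * (pinned ev a b J).card := by
  have h1 : ((pinned ev a b J).filter fun e => ∃ i, ev e i ∈ G) ⊆
      (G ×ˢ (univ : Finset α)).biUnion fun p =>
        if ∀ j ∈ J, a j ≠ p.2 then (pinned ev a b J).filter fun e => ev e p.2 = p.1 else ∅ := by
    intro e he
    obtain ⟨he, i, hi⟩ := mem_filter.mp he
    refine mem_biUnion.mpr ⟨(ev e i, i), by simpa using hi, ?_⟩
    rw [if_pos]
    · simpa using he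
    · rintro j hj rfl
      simp only [pinned, mem_filter, mem_univ, true_and] at he
      exact hG j hj (he j hj ▸ hi)
  have h2 : ∀ p ∈ G ×ˢ (univ : Finset α),
      (if ∀ j ∈ J, a j ≠ p.2 then (pinned ev a b J).filter fun e => ev e p.2 = p.1 else ∅).card *
        (Fintype.card β - J.card) ≤ (pinned ev a b J).card := by
    rintro ⟨γ, i⟩ hp
    simp only [mem_product, mem_univ, and_true] at hp
    split_ifs with hi
    -- Every value `y` outside the pinned ones is at least as frequent at `i` as the forbidden `γ`,
    -- and there are at least `|β| - |J|` such `y`.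
    · have e1 : (pinned ev a b J).card =
          ∑ y : β, ((pinned ev a b J).filter fun e => ev e i = y).card :=
        card_eq_sum_card_fiberwise fun _ _ => mem_univ _
      have e2 : Fintype.card β - J.card ≤ (univ \ J.image b).card := by
        have := le_card_sdiff (J.image b) (univ : Finset β)
        have h3 : (J.image b).card ≤ J.card := card_image_le
        rw [card_univ] at this
        omega
      rw [e1, mul_comm]
      refine (Nat.mul_le_mul_right _ e2).trans ?_
      refine le_trans ?_ (sum_le_sum_of_subset (subset_univ (univ \ J.image b)))
      rw [← smul_eq_mul]
      refine card_nsmul_le_sum _ _ _ fun y hy => ?_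
      refine card_pinned_swap ev act hext hinj hact a b J i hi γ y ?_
      rintro j hj rfl
      simp only [mem_sdiff, mem_univ, true_and, mem_image, not_exists] at hy
      exact hy j ⟨hj, rfl⟩
    · simp
  calc _ ≤ (∑ p ∈ G ×ˢ (univ : Finset α), (if ∀ j ∈ J, a j ≠ p.2 then
          (pinned ev a b J).filter fun e => ev e p.2 = p.1 else ∅).card) *
            (Fintype.card β - J.card) :=
        Nat.mul_le_mul_right _ ((card_le_card h1).trans card_biUnion_le)
    _ ≤ _ := by
        rw [sum_mul, ← card_univ (α := α), ← card_product, ← smul_eq_mul (b := (pinned ev a b J).card)]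
        exact sum_le_card_nsmul _ _ _ h2

end Pin

end Counting

/-! ### Non-backtracking walks in the glued trees, and why tame walks do not collide. -/

section Walk

/-- The port (and label offset) belonging to a child: `1` or `2`. -/
def slot (c : Bool) : Fin 3 := if c then 2 else 1

theorem slot_ne_zero (c : Bool) : slot c ≠ 0 := by cases c <;> decide

theorem slot_injective : Function.Injective slot := by decide

/-- Where an exploration stands: a side, a word of the tree on that side, the port through which
the vertex was entered (`0` towards the parent, `1` and `2` towards the children or along the
cycle), and for leaves the position on the cycle, unrolled to `ℤ`. -/
structure Place where
  side : Bool
  word : List Bool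
  port : Fin 3
  cyc : ℤ

/-- The direction on the cycle in which a leaf is left through the port `out`. -/
def dir (side : Bool) (out : Fin 3) : ℤ := if (side = false ↔ out = 1) then 1 else -1

/-- The parity of the cycle positions of the leaves on a side. -/
def sideNum (side : Bool) : ℤ := if side then 1 else 0

/-- An arbitrary numbering of the leaves. -/
noncomputable def leafEquiv (n : ℕ) : Fin (2 ^ n) ≃ Leaf n :=
  (Classical.choice (inferInstance : Nonempty (LeafCycle n))).1

/-- Leave a place through the port `out`; `e` supplies the cycle position of a leaf reached from
its parent, and the leaf reached along the cycle. -/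
noncomputable def Place.move (n : ℕ) (P : Place) (out : Fin 3) (e : Fin (2 ^ n)) : Place :=
  if out = 0 then ⟨P.side, P.word.tail, P.word.head?.elim 0 slot, P.cyc⟩
  else if P.word.length < n then
    ⟨P.side, decide (out = 2) :: P.word, 0, 2 * (e : ℤ) + sideNum P.side⟩
  else ⟨!P.side, (leafEquiv n e).1, out, P.cyc + dir P.side out⟩

variable (n : ℕ) (ε : List Bool → Bool) (e : List Bool → Fin (2 ^ n))

/-- The non-backtracking walk along a word, driven by the coins `ε` and the leaves `e`. -/
noncomputable def place : List Bool → Place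
  | [] => ⟨false, [], 0, 0⟩
  | c :: w => (place w).move n ((place w).port + slot (xor (ε w) c)) (e (c :: w))

/-- The port through which the walk leaves `w` towards `c :: w`. -/
noncomputable def outPort (c : Bool) (w : List Bool) : Fin 3 :=
  (place n ε e w).port + slot (xor (ε w) c)

/-- The last step of the walk is along the cycle. -/
def Crossing : List Bool → Prop
  | [] => False
  | c :: w => outPort n ε e c w ≠ 0 ∧ ¬ (place n ε e w).word.length < n

/-- The last `k` steps of the walk are towards the root. -/
def Climbed : ℕ → List Bool → Prop
  | 0, _ => True
  | _ + 1, [] => False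
  | k + 1, c :: w => outPort n ε e c w = 0 ∧ Climbed k w

variable {n ε e}

theorem outPort_ne_port (c : Bool) (w : List Bool) :
    outPort n ε e c w ≠ (place n ε e w).port := by
  unfold outPort
  intro h
  exact slot_ne_zero _ (by simpa using h)

theorem outPort_injective {c c' : Bool} {w : List Bool}
    (h : outPort n ε e c w = outPort n ε e c' w) : c = c' := by
  unfold outPort at h
  have := slot_injective (add_left_cancel h)
  cases c <;> cases c' <;> cases h : ε w <;> simp_all

theorem place_climb {c : Bool} {w : List Bool} (h : outPort n ε e c w = 0) :
    place n ε e (c :: w) = ⟨(place n ε e w).side, (place n ε e w).word.tail,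
      (place n ε e w).word.head?.elim 0 slot, (place n ε e w).cyc⟩ := by
  unfold outPort at h
  rw [place, Place.move, if_pos h]

theorem place_down {c : Bool} {w : List Bool} (h : outPort n ε e c w ≠ 0)
    (hl : (place n ε e w).word.length < n) :
    place n ε e (c :: w) = ⟨(place n ε e w).side,
      decide (outPort n ε e c w = 2) :: (place n ε e w).word, 0,
      2 * (e (c :: w) : ℤ) + sideNum (place n ε e w).side⟩ := by
  unfold outPort at h ⊢
  rw [place, Place.move, if_neg h, if_pos hl]

theorem place_cross {c : Bool} {w : List Bool} (h : Crossing n ε e (c :: w)) :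
    place n ε e (c :: w) = ⟨!(place n ε e w).side, (leafEquiv n (e (c :: w))).1,
      outPort n ε e c w, (place n ε e w).cyc + dir (place n ε e w).side (outPort n ε e c w)⟩ := by
  obtain ⟨h, hl⟩ := h
  unfold outPort at h ⊢
  rw [place, Place.move, if_neg h, if_neg hl]

theorem word_length_le (w : List Bool) : (place n ε e w).word.length ≤ n := by
  induction w with
  | nil => simp [place]
  | cons c w ih =>
    by_cases h : outPort n ε e c w = 0
    · rw [place_climb h]
      simp only [List.length_tail]
      omega
    · by_cases hl : (place n ε e w).word.length < n
      · rw [place_down h hl]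
        simpa using hl
      · rw [place_cross ⟨h, hl⟩]
        exact (leafEquiv n _).2.le

theorem slot_decide {p : Fin 3} (hp : p ≠ 0) : slot (decide (p = 2)) = p := by
  revert p; decide

theorem Climbed.mono {k l : ℕ} (hkl : k ≤ l) {w : List Bool} (h : Climbed n ε e l w) :
    Climbed n ε e k w := by
  induction l generalizing k w with
  | zero =>
    obtain rfl : k = 0 := by omega
    trivial
  | succ l ih =>
    cases k with
    | zero => trivial
    | succ k =>
      cases w with
      | nil => exact h.elim
      | cons c w => exact ⟨h.1, ih (by omega) h.2⟩

open Classical in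
variable (n ε e) in
/-- The longest suffix of a word at which the walk has crossed, or the empty word. -/
noncomputable def base : List Bool → List Bool
  | [] => []
  | c :: w => if Crossing n ε e (c :: w) then c :: w else base w

theorem base_suffix (w : List Bool) : base n ε e w <:+ w := by
  induction w with
  | nil => exact List.suffix_rfl
  | cons c w ih =>
    rw [base]
    split_ifs
    · exact List.suffix_rfl
    · exact ih.trans (List.suffix_cons _ _)

theorem base_crossing (w : List Bool) : base n ε e w = [] ∨ Crossing n ε e (base n ε e w) := by
  induction w with
  | nil => exact Or.inl rfl
  | cons c w ih =>
    rw [base]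
    split_ifs with h
    · exact Or.inr h
    · exact ih

theorem suffix_base {i w : List Bool} (hi : Crossing n ε e i) (h : i <:+ w) :
    i <:+ base n ε e w := by
  induction w with
  | nil =>
    rw [List.suffix_nil.mp h] at hi
    exact hi.elim
  | cons c w ih =>
    rw [base]
    split_ifs with hc
    · exact h
    · rcases List.suffix_cons_iff.mp h with rfl | h
      · exact absurd hi hc
      · exact ih h

/-- Where a walk that has left its base without crossing can be: it has only climbed, or its
current vertex is not an ancestor of the base. -/
theorem base_cases {h : ℕ} (hh : h ≤ n) {w : List Bool}
    (hc : ∀ u, u <:+ w → ¬ Climbed n ε e h u) :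
    (place n ε e w).side = (place n ε e (base n ε e w)).side ∧
    (w = base n ε e w ∨
      ((place n ε e w).port = 0 ∧
        ¬ (place n ε e w).word <:+ (place n ε e (base n ε e w)).word) ∨
      ∃ k t, base n ε e w ≠ [] ∧
        (place n ε e (base n ε e w)).word.drop k = t :: (place n ε e w).word ∧
        (place n ε e w).port = slot t ∧ Climbed n ε e (k + 1) w) := by
  induction w with
  | nil => exact ⟨rfl, Or.inl rfl⟩
  | cons c w ih =>
    obtain ⟨hs, ih⟩ := ih fun u hu => hc u (hu.trans (List.suffix_cons _ _))
    by_cases hcr : Crossing n ε e (c :: w)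
    · have hb : base n ε e (c :: w) = c :: w := by rw [base, if_pos hcr]
      rw [hb]
      exact ⟨rfl, Or.inl rfl⟩
    have hb : base n ε e (c :: w) = base n ε e w := by rw [base, if_neg hcr]
    rw [hb]
    have hleaf : base n ε e w ≠ [] → (place n ε e (base n ε e w)).word.length = n ∧
        (place n ε e (base n ε e w)).port ≠ 0 := by
      intro hne
      have h2 := (base_crossing (n := n) (ε := ε) (e := e) w).resolve_left hne
      obtain ⟨c', w', he⟩ := List.exists_cons_of_ne_nil hne
      rw [he] at h2 ⊢
      rw [place_cross h2]
      exact ⟨(leafEquiv n _).2, h2.1⟩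
    have hnp := outPort_ne_port (n := n) (ε := ε) (e := e) c w
    by_cases h0 : outPort n ε e c w = 0
    · rw [place_climb h0]
      -- Only the base itself and its ancestors can be left upwards, since a vertex entered from its
      -- parent may not return. The bound on climbs keeps the height below `n`, so there is a parent
      -- to climb to.
      refine ⟨hs, Or.inr (Or.inr ?_)⟩
      have key : ∀ k, base n ε e w ≠ [] → Climbed n ε e k w →
          (place n ε e (base n ε e w)).word.drop k = (place n ε e w).word →
          ∃ k t, base n ε e w ≠ [] ∧
            (place n ε e (base n ε e w)).word.drop k = t :: (place n ε e w).word.tail ∧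
            (place n ε e w).word.head?.elim 0 slot = slot t ∧ Climbed n ε e (k + 1) (c :: w) := by
        intro k hne hk hd
        have hkh : k < h := by
          by_contra hlt
          exact hc w (List.suffix_cons _ _) (hk.mono (not_lt.mp hlt))
        have hlen : (place n ε e w).word ≠ [] := by
          intro h1
          have := congrArg List.length hd
          rw [List.length_drop, (hleaf hne).1, h1, List.length_nil] at this
          omega
        obtain ⟨t, v, hv⟩ := List.exists_cons_of_ne_nil hlen
        exact ⟨k, t, hne, by rw [hd, hv]; rfl, by rw [hv]; rfl, h0, hk⟩
      rcases ih with hw | ⟨hp, -⟩ | ⟨k, t, hne, hd, hp, hk⟩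
      · have hne : base n ε e w ≠ [] := by
          intro h1
          rw [h1] at hw
          rw [h0, hw] at hnp
          exact hnp rfl
        exact key 0 hne trivial (by rw [← hw]; rfl)
      · exact absurd (h0.trans hp.symm) hnp
      · refine key (k + 1) hne hk ?_
        rw [← List.drop_drop, hd]
        rfl
    · have hl : (place n ε e w).word.length < n := by
        by_contra hl
        exact hcr ⟨h0, hl⟩
      rw [place_down h0 hl]
      refine ⟨hs, Or.inr (Or.inl ⟨rfl, ?_⟩)⟩
      intro hsuf
      rcases ih with hw | ⟨hp, hns⟩ | ⟨k, t, hne, hd, hp, hk⟩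
      · by_cases hne : base n ε e w = []
        · rw [hne] at hsuf
          simp [place] at hsuf
        · rw [hw, (hleaf hne).1] at hl
          omega
      · exact hns ((List.suffix_cons _ _).trans hsuf)
      -- Descending from an ancestor of the base back onto the path to the base would use the port
      -- through which this ancestor was entered.
      · have h2 : t :: (place n ε e w).word <:+ (place n ε e (base n ε e w)).word :=
          hd ▸ List.drop_suffix _ _
        have h3 := (List.suffix_of_suffix_length_le hsuf h2 (by simp)).eq_of_length (by simp)
        have h4 : decide (outPort n ε e c w = 2) = t := (List.cons.inj h3).1
        rw [hp, ← h4, slot_decide h0] at hnp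
        exact hnp rfl

/-- Without long climbs, a walk stays in the subtree of height `h` around its base. -/
theorem base_block {h : ℕ} (hh : h + 1 ≤ n) {w : List Bool}
    (hc : ∀ u, u <:+ w → ¬ Climbed n ε e (h + 1) u) (hne : base n ε e w ≠ []) :
    (place n ε e (base n ε e w)).word.drop h <:+ (place n ε e w).word := by
  induction w with
  | nil => exact absurd rfl hne
  | cons c w ih =>
    by_cases hcr : Crossing n ε e (c :: w)
    · have hb : base n ε e (c :: w) = c :: w := by rw [base, if_pos hcr]
      rw [hb]
      exact List.drop_suffix _ _
    have hb : base n ε e (c :: w) = base n ε e w := by rw [base, if_neg hcr]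
    have hcs := (base_cases hh hc).2
    rw [hb] at hne hcs ⊢
    have ih := ih (fun u hu => hc u (hu.trans (List.suffix_cons _ _))) hne
    by_cases h0 : outPort n ε e c w = 0
    · rcases hcs with hw | ⟨hp, hns⟩ | ⟨k, t, hne, hd, hp, hk⟩
      · have := (base_suffix (n := n) (ε := ε) (e := e) w).length_le
        rw [← hw] at this
        simp at this
      · rw [place_climb h0] at hp hns ⊢
        have hw : (place n ε e w).word = [] := by
          cases hw : (place n ε e w).word with
          | nil => rfl
          | cons t v =>
            rw [hw] at hp
            exact absurd hp (slot_ne_zero t)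
        rw [hw] at hns
        exact absurd (List.nil_suffix) hns
      · have hkh : k + 1 ≤ h := by
          by_contra hlt
          exact hc _ List.suffix_rfl (hk.mono (by omega))
        have : (place n ε e (c :: w)).word = (place n ε e (base n ε e w)).word.drop (k + 1) := by
          rw [← List.drop_drop, hd]
          rfl
        rw [this]
        obtain ⟨m, rfl⟩ := Nat.exists_eq_add_of_le hkh
        rw [← List.drop_drop]
        exact List.drop_suffix _ _
    · have hl : (place n ε e w).word.length < n := by
        by_contra hl
        exact hcr ⟨h0, hl⟩
      rw [place_down h0 hl]
      exact ih.trans (List.suffix_cons _ _)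

/-- Two walks with the same base do not meet. -/
theorem eq_of_base_eq {h : ℕ} (hh : h ≤ n) {w w' : List Bool}
    (hc : ∀ u, u <:+ w → ¬ Climbed n ε e h u) (hc' : ∀ u, u <:+ w' → ¬ Climbed n ε e h u)
    (hb : base n ε e w = base n ε e w') (hv : (place n ε e w).word = (place n ε e w').word) :
    w = w' := by
  have notbase : ∀ {w w' : List Bool}, (∀ u, u <:+ w' → ¬ Climbed n ε e h u) →
      base n ε e w = base n ε e w' → (place n ε e w).word = (place n ε e w').word →
      w = base n ε e w → w = w' := by
    intro w w' hc' hb hv hw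
    rcases (base_cases hh hc').2 with hw' | ⟨-, hns⟩ | ⟨k, t, -, hd, -⟩
    · rw [hw, hb, ← hw']
    · rw [← hv, ← hb, ← hw] at hns
      exact absurd List.suffix_rfl hns
    · rw [← hv, ← hb, ← hw] at hd
      have := congrArg List.length hd
      rw [List.length_drop, List.length_cons] at this
      omega
  induction w generalizing w' with
  | nil => exact notbase hc' hb hv rfl
  | cons c w ih =>
    rcases (base_cases hh hc).2 with hw | H
    · exact notbase hc' hb hv hw
    rcases (base_cases hh hc').2 with hw' | H'
    · exact (notbase hc hb.symm hv.symm hw').symm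
    cases w' with
    | nil => exact (notbase hc hb.symm hv.symm rfl).symm
    | cons c' w' =>
    have hcs : ∀ u, u <:+ w → ¬ Climbed n ε e h u :=
      fun u hu => hc u (hu.trans (List.suffix_cons _ _))
    have hcs' : ∀ u, u <:+ w' → ¬ Climbed n ε e h u :=
      fun u hu => hc' u (hu.trans (List.suffix_cons _ _))
    have hnc : ∀ {c : Bool} {w : List Bool}, ((place n ε e (c :: w)).port = 0 ∧
        ¬ (place n ε e (c :: w)).word <:+ (place n ε e (base n ε e (c :: w))).word ∨
      ∃ k t, base n ε e (c :: w) ≠ [] ∧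
        (place n ε e (base n ε e (c :: w))).word.drop k = t :: (place n ε e (c :: w)).word ∧
        (place n ε e (c :: w)).port = slot t ∧ Climbed n ε e (k + 1) (c :: w)) →
        ¬ Crossing n ε e (c :: w) := by
      intro c w H hcr
      have hb : base n ε e (c :: w) = c :: w := by rw [base, if_pos hcr]
      rw [hb] at H
      rcases H with ⟨-, H⟩ | ⟨k, t, -, hd, -⟩
      · exact H List.suffix_rfl
      · have := congrArg List.length hd
        rw [List.length_drop, List.length_cons] at this
        omega
    have n1 := hnc H
    have n2 := hnc H'
    have b1 : base n ε e (c :: w) = base n ε e w := by rw [base, if_neg n1]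
    have b2 : base n ε e (c' :: w') = base n ε e w' := by rw [base, if_neg n2]
    have hbw : base n ε e w = base n ε e w' := by rw [← b1, hb, b2]
    -- Compare the last steps. Off the path to the base both were downwards, on that path both were
    -- upwards from the same child; either way the predecessors meet too. The mixed cases contradict
    -- the position of the common vertex.
    rcases H with ⟨hp, hns⟩ | ⟨k, t, hne, hd, hp, hk⟩
    · rcases H' with ⟨hp', hns'⟩ | ⟨k', t', hne', hd', hp', hk'⟩
      · have down : ∀ {c : Bool} {w : List Bool}, ¬ Crossing n ε e (c :: w) →
            (place n ε e (c :: w)).port = 0 →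
            ¬ (place n ε e (c :: w)).word <:+ (place n ε e (base n ε e (c :: w))).word →
            outPort n ε e c w ≠ 0 ∧ (place n ε e w).word.length < n := by
          intro c w hcr hp hns
          have h0 : outPort n ε e c w ≠ 0 := by
            intro h0
            rw [place_climb h0] at hp hns
            cases hw : (place n ε e w).word with
            | nil => exact hns (by rw [hw]; exact List.nil_suffix)
            | cons t v =>
              rw [hw] at hp
              exact slot_ne_zero t hp
          refine ⟨h0, ?_⟩
          by_contra hl
          exact hcr ⟨h0, hl⟩
        obtain ⟨o1, l1⟩ := down n1 hp hns
        obtain ⟨o2, l2⟩ := down n2 hp' hns'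
        rw [place_down o1 l1, place_down o2 l2] at hv
        obtain ⟨hv1, hv2⟩ := List.cons.inj hv
        obtain rfl := ih hcs hcs' hbw hv2
        have ho := congrArg slot hv1
        rw [slot_decide o1, slot_decide o2] at ho
        rw [outPort_injective ho]
      · rw [hv, hb] at hns
        exact absurd (((List.suffix_cons _ _).trans (hd' ▸ List.drop_suffix _ _))) hns
    · rcases H' with ⟨hp', hns'⟩ | ⟨k', t', hne', hd', hp', hk'⟩
      · rw [← hv, ← hb] at hns'
        exact absurd (((List.suffix_cons _ _).trans (hd ▸ List.drop_suffix _ _))) hns'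
      · have up : ∀ {c : Bool} {w : List Bool} {k : ℕ} {t : Bool},
            Climbed n ε e (k + 1) (c :: w) →
            (place n ε e (c :: w)).port = slot t →
            (place n ε e w).word = t :: (place n ε e (c :: w)).word := by
          intro c w k t hk hp
          rw [place_climb hk.1] at hp ⊢
          cases hw : (place n ε e w).word with
          | nil =>
            rw [hw] at hp
            exact absurd hp.symm (slot_ne_zero t)
          | cons t' v =>
            rw [hw] at hp
            rw [slot_injective (show slot t' = slot t from hp)]
            rfl
        have hkk : k = k' := by
          have l1 := congrArg List.length hd
          have l2 := congrArg List.length hd'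
          rw [List.length_drop, List.length_cons] at l1 l2
          rw [hb, hv] at l1
          omega
        subst hkk
        have htt : t = t' := by
          rw [hb, hd', hv] at hd
          exact (List.cons.inj hd).1.symm
        subst htt
        have u1 := up hk hp
        have u2 := up hk' hp'
        obtain rfl := ih hcs hcs' hbw (by rw [u1, u2, hv])
        rw [outPort_injective (hk.1.trans hk'.1.symm)]

open Classical in
variable (n ε e) in
/-- The leaf at which the current excursion along the cycle has started. -/
noncomputable def arc : List Bool → List Bool
  | [] => []
  | c :: w => if Crossing n ε e (c :: w) then arc w else c :: w

open Classical in
variable (n ε e) in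
/-- The signed number of steps made in the current excursion along the cycle. -/
noncomputable def arcOffset : List Bool → ℤ
  | [] => 0
  | c :: w => if Crossing n ε e (c :: w) then
      arcOffset w + dir (place n ε e w).side (outPort n ε e c w) else 0

theorem arc_suffix (w : List Bool) : arc n ε e w <:+ w := by
  induction w with
  | nil => exact List.suffix_rfl
  | cons c w ih =>
    rw [arc]
    split_ifs
    · exact ih.trans (List.suffix_cons _ _)
    · exact List.suffix_rfl

theorem Crossing.tail_leaf {c : Bool} {w : List Bool} (h : Crossing n ε e (c :: w)) :
    (place n ε e w).word.length = n :=
  le_antisymm (word_length_le w) (not_lt.mp h.2)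

theorem dir_eq_or (s : Bool) (p : Fin 3) : dir s p = 1 ∨ dir s p = -1 := by
  unfold dir; split_ifs <;> simp

theorem abs_arcOffset_le (w : List Bool) : |arcOffset n ε e w| ≤ w.length := by
  induction w with
  | nil => simp [arcOffset]
  | cons c w ih =>
    rw [arcOffset]
    split_ifs
    · rw [List.length_cons]
      rcases dir_eq_or (place n ε e w).side (outPort n ε e c w) with h | h <;>
        rw [h, abs_le] <;> rw [abs_le] at ih <;> constructor <;> push_cast <;> linarith
    · simp; omega

/-- At a leaf that was not reached along the cycle, the walk has just come from the parent. -/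
theorem place_leaf_of_not_crossing (hn : 0 < n) {c : Bool} {w : List Bool}
    (hl : (place n ε e (c :: w)).word.length = n) (h : ¬ Crossing n ε e (c :: w)) :
    (place n ε e (c :: w)).port = 0 ∧ (place n ε e (c :: w)).cyc =
      2 * (e (c :: w) : ℤ) + sideNum (place n ε e (c :: w)).side := by
  by_cases h0 : outPort n ε e c w = 0
  · rw [place_climb h0] at hl
    simp only [List.length_tail] at hl
    have := word_length_le (n := n) (ε := ε) (e := e) w
    omega
  · have hl' : (place n ε e w).word.length < n := by
      by_contra hl'
      exact h ⟨h0, hl'⟩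
    rw [place_down h0 hl']
    exact ⟨rfl, rfl⟩

theorem place_cyc (hn : 0 < n) {w : List Bool} (hl : (place n ε e w).word.length = n) :
    (place n ε e w).cyc = 2 * (e (arc n ε e w) : ℤ) + sideNum (place n ε e (arc n ε e w)).side +
      arcOffset n ε e w := by
  induction w with
  | nil => simp [place] at hl; omega
  | cons c w ih =>
    rw [arc, arcOffset]
    split_ifs with hcr
    · rw [place_cross hcr, ih hcr.tail_leaf]
      simp only
      ring
    · rw [(place_leaf_of_not_crossing hn hl hcr).2, add_zero]

theorem place_cyc_parity (hn : 0 < n) {w : List Bool} (hl : (place n ε e w).word.length = n) :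
    ∃ a : ℤ, (place n ε e w).cyc = 2 * a + sideNum (place n ε e w).side := by
  induction w with
  | nil => simp [place] at hl; omega
  | cons c w ih =>
    by_cases hcr : Crossing n ε e (c :: w)
    · obtain ⟨a, ha⟩ := ih hcr.tail_leaf
      rw [place_cross hcr, ha]
      simp only
      rcases dir_eq_or (place n ε e w).side (outPort n ε e c w) with h | h <;> rw [h] <;>
        cases (place n ε e w).side
      · exact ⟨a, by simp [sideNum]⟩
      · exact ⟨a + 1, by simp [sideNum]; ring⟩
      · exact ⟨a - 1, by simp [sideNum]; ring⟩
      · exact ⟨a, by simp [sideNum]⟩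
    · exact ⟨_, (place_leaf_of_not_crossing hn hl hcr).2⟩

theorem dir_not (s : Bool) {p q : Fin 3} (hp : p ≠ 0) (hq : q ≠ 0) (h : q ≠ p) :
    dir (!s) q = dir s p := by
  revert hp hq h
  revert s p q
  decide

theorem dir_injective {s : Bool} {p q : Fin 3} (hp : p ≠ 0) (hq : q ≠ 0)
    (h : dir s p = dir s q) : p = q := by
  revert hp hq h
  revert s p q
  decide

/-- An excursion along the cycle keeps its direction. -/
theorem arcOffset_sign {c : Bool} {w : List Bool} (hn : 0 < n) (hcr : Crossing n ε e (c :: w)) :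
    0 < arcOffset n ε e (c :: w) * dir (place n ε e w).side (outPort n ε e c w) := by
  induction w generalizing c with
  | nil =>
    have := hcr.tail_leaf
    simp [place] at this
    omega
  | cons c' w ih =>
    rw [arcOffset, if_pos hcr]
    by_cases hcr' : Crossing n ε e (c' :: w)
    · have h1 := ih hcr'
      have hp := outPort_ne_port (n := n) (ε := ε) (e := e) c (c' :: w)
      have hs : (place n ε e (c' :: w)).side = !(place n ε e w).side := by rw [place_cross hcr']
      have hq : (place n ε e (c' :: w)).port = outPort n ε e c' w := by rw [place_cross hcr']
      rw [hq] at hp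
      -- The leaf is left through the other of its two cycle ports, and this port points in the same
      -- direction because the orientation of the ports alternates between the sides.
      rw [hs, dir_not _ hcr'.1 hcr.1 hp]
      rcases dir_eq_or (place n ε e w).side (outPort n ε e c' w) with h | h <;> rw [h] at h1 ⊢ <;>
        linarith
    · rw [arcOffset, if_neg hcr']
      rcases dir_eq_or (place n ε e (c' :: w)).side (outPort n ε e c (c' :: w)) with h | h <;>
        rw [h] <;> norm_num

/-- From its starting leaf an excursion can only run straight in one of two directions, and the sign
of the offset tells which. Start and offset therefore determine the word. -/
theorem eq_of_arc_eq (hn : 0 < n) {w w' : List Bool}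
    (ha : arc n ε e w = arc n ε e w') (ho : arcOffset n ε e w = arcOffset n ε e w') : w = w' := by
  have nz : ∀ {c w}, Crossing n ε e (c :: w) → arcOffset n ε e (c :: w) ≠ 0 := by
    intro c w h h0
    have := arcOffset_sign hn h
    rw [h0] at this
    simp at this
  have start : ∀ {w}, ¬ Crossing n ε e w → arc n ε e w = w ∧ arcOffset n ε e w = 0 := by
    intro w h
    cases w with
    | nil => exact ⟨rfl, rfl⟩
    | cons c w => rw [arc, arcOffset, if_neg h, if_neg h]; exact ⟨rfl, rfl⟩
  have cross : ∀ {w}, arcOffset n ε e w ≠ 0 → Crossing n ε e w := by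
    intro w h
    by_contra hc
    exact h (start hc).2
  induction w generalizing w' with
  | nil =>
    have : ¬ Crossing n ε e w' := by
      intro hc
      cases w' with
      | nil => exact hc
      | cons c w' => exact nz hc ho.symm
    rw [(start this).1] at ha
    exact ha
  | cons c w ih =>
    by_cases hc : Crossing n ε e (c :: w)
    · have hc' := cross (ho ▸ nz hc)
      cases w' with
      | nil => exact hc'.elim
      | cons c' w' =>
        have s1 := arcOffset_sign hn hc
        have s2 := arcOffset_sign hn hc'
        have hd : dir (place n ε e w).side (outPort n ε e c w) =
            dir (place n ε e w').side (outPort n ε e c' w') := by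
          rw [← ho] at s2
          rcases dir_eq_or (place n ε e w).side (outPort n ε e c w) with h | h <;>
          rcases dir_eq_or (place n ε e w').side (outPort n ε e c' w') with h' | h' <;>
          rw [h] at s1 ⊢ <;> rw [h'] at s2 ⊢ <;> linarith
        rw [arc, if_pos hc, arc, if_pos hc'] at ha
        rw [arcOffset, if_pos hc, arcOffset, if_pos hc', hd] at ho
        obtain rfl := ih ha (by linarith)
        rw [outPort_injective (dir_injective hc.1 hc'.1 hd)]
    · have hc' : ¬ Crossing n ε e w' := by
        intro hc'
        cases w' with
        | nil => exact hc'
        | cons c' w' => exact nz hc' (ho ▸ (start hc).2)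
      rw [(start hc).1, (start hc').1] at ha
      exact ha

/-- The walks along the words in `K` behave: no long climbs, no leaf reached along the cycle in
the height-`h` neighbourhood of another walk, and no two cycle positions within distance `T`. -/
structure Tame (n : ℕ) (ε : List Bool → Bool) (e : List Bool → Fin (2 ^ n)) (h T : ℕ)
    (K : Finset (List Bool)) : Prop where
  climb : ∀ w ∈ K, ¬ Climbed n ε e (h + 1) w
  meet : ∀ i ∈ K, ∀ j ∈ K, ¬ i <:+ j →
    ¬ (leafEquiv n (e i)).1.drop h <:+ (place n ε e j).word
  near : ∀ i ∈ K, ∀ j ∈ K, i ≠ j → ∀ t : ℤ, |t| ≤ T → ¬ (e i : ℤ) ≡ e j + t [ZMOD 2 ^ n]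

theorem Crossing.word {i : List Bool} (h : Crossing n ε e i) :
    (place n ε e i).word = (leafEquiv n (e i)).1 := by
  cases i with
  | nil => exact h.elim
  | cons c w => rw [place_cross h]

section Tame

variable {h T : ℕ} {K : Finset (List Bool)}

/-- Two walks that meet have the same last crossing: otherwise one of them enters the height-`h`
block around a random leaf that it did not pass through. Within one block the tree has no cycles.
The words differ even across the two sides, which is more than distinctness of vertices. -/
theorem Tame.injOn (H : Tame n ε e h T K) (hh : h + 1 ≤ n)
    (hK : ∀ w ∈ K, ∀ u, u <:+ w → u ∈ K) {w w' : List Bool} (hw : w ∈ K) (hw' : w' ∈ K)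
    (hv : (place n ε e w).word = (place n ε e w').word) : w = w' := by
  have hc : ∀ w ∈ K, ∀ u, u <:+ w → ¬ Climbed n ε e (h + 1) u :=
    fun w hw u hu => H.climb u (hK w hw u hu)
  have key : ∀ {w w' : List Bool}, w ∈ K → w' ∈ K →
      (place n ε e w).word = (place n ε e w').word → base n ε e w' <:+ w := by
    intro w w' hw hw' hv
    by_contra hs
    have hne : base n ε e w' ≠ [] := fun h0 => hs (h0 ▸ List.nil_suffix)
    have hcr := (base_crossing (n := n) (ε := ε) (e := e) w').resolve_left hne
    have hb := base_block hh (hc w' hw') hne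
    rw [hcr.word, ← hv] at hb
    exact H.meet _ (hK w' hw' _ (base_suffix w')) _ hw hs hb
  refine eq_of_base_eq (h := h + 1) hh (hc w hw) (hc w' hw') ?_ hv
  have le : ∀ {w w' : List Bool}, base n ε e w' <:+ w → base n ε e w' <:+ base n ε e w := by
    intro w w' hs
    rcases base_crossing (n := n) (ε := ε) (e := e) w' with h0 | hcr
    · rw [h0]; exact List.nil_suffix
    · exact suffix_base hcr hs
  have s1 := le (key hw hw' hv)
  have s2 := le (key hw' hw hv.symm)
  exact s2.eq_of_length (le_antisymm s2.length_le s1.length_le)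

/-- To be on the right the walk must have crossed, and afterwards it stays below the height-`h`
ancestor of a leaf, at depth at least `n - h > 0`. -/
theorem Tame.ne_exit (H : Tame n ε e h T K) (hh : h + 1 ≤ n)
    (hK : ∀ w ∈ K, ∀ u, u <:+ w → u ∈ K) {w : List Bool} (hw : w ∈ K)
    (hs : (place n ε e w).side = true) : (place n ε e w).word ≠ [] := by
  have hc : ∀ u, u <:+ w → ¬ Climbed n ε e (h + 1) u := fun u hu => H.climb u (hK w hw u hu)
  have hne : base n ε e w ≠ [] := by
    intro h0
    rw [(base_cases hh hc).1, h0] at hs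
    simp [place] at hs
  have hb := base_block hh hc hne
  intro h0
  have hcr := (base_crossing (n := n) (ε := ε) (e := e) w).resolve_left hne
  have := hb.length_le
  rw [h0, hcr.word, List.length_drop, (leafEquiv n _).2, List.length_nil] at this
  omega

/-- The start of the walk already occupies the empty word, and `Tame.injOn` disregards sides. This
rules out the meaningless move from a root to its parent. -/
theorem Tame.ne_root (H : Tame n ε e h T K) (hh : h + 1 ≤ n)
    (hK : ∀ w ∈ K, ∀ u, u <:+ w → u ∈ K) {w : List Bool} (hw : w ∈ K)
    (h0 : w ≠ []) : (place n ε e w).word ≠ [] := by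
  intro h1
  exact h0 (H.injOn hh hK hw (hK w hw _ List.nil_suffix) (by rw [h1]; simp [place]))

/-- A cycle position is the random start of an excursion plus an offset of size at most `T`. Within
one excursion the positions differ because `2 T < 2 ^ (n + 1)`, the length of the cycle; different
excursions start too far apart. -/
theorem Tame.cyc_injOn (H : Tame n ε e h T K) (hh : h + 1 ≤ n)
    (hK : ∀ w ∈ K, ∀ u, u <:+ w → u ∈ K) (hT : ∀ w ∈ K, w.length ≤ T) (hTn : T < 2 ^ n)
    {w w' : List Bool} (hw : w ∈ K) (hw' : w' ∈ K)
    (hl : (place n ε e w).word.length = n) (hl' : (place n ε e w').word.length = n)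
    (hs : (place n ε e w).side = (place n ε e w').side)
    (hc : (place n ε e w).cyc / 2 ≡ (place n ε e w').cyc / 2 [ZMOD 2 ^ n]) : w = w' := by
  have hn : 0 < n := by omega
  obtain ⟨a, ha⟩ := place_cyc_parity hn hl
  obtain ⟨a', ha'⟩ := place_cyc_parity hn hl'
  have sn : ∀ s, sideNum s = 0 ∨ sideNum s = 1 := by intro s; cases s <;> simp [sideNum]
  have d1 : (place n ε e w).cyc / 2 = a := by
    rw [ha]; rcases sn (place n ε e w).side with h | h <;> rw [h] <;> omega
  have d2 : (place n ε e w').cyc / 2 = a' := by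
    rw [ha']; rcases sn (place n ε e w').side with h | h <;> rw [h] <;> omega
  rw [d1, d2] at hc
  have c1 := place_cyc hn hl
  have c2 := place_cyc hn hl'
  rw [ha] at c1
  rw [ha', ← hs] at c2
  have o1 := abs_arcOffset_le (n := n) (ε := ε) (e := e) w
  have o2 := abs_arcOffset_le (n := n) (ε := ε) (e := e) w'
  have t1 := hT w hw
  have t2 := hT w' hw'
  obtain ⟨m, hm⟩ := hc.dvd
  have hTn' : (T : ℤ) < 2 ^ n := by exact_mod_cast hTn
  rw [abs_le] at o1 o2
  by_cases harc : arc n ε e w = arc n ε e w'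
  · refine eq_of_arc_eq hn harc ?_
    rw [harc] at c1
    have : arcOffset n ε e w' - arcOffset n ε e w = 2 * (2 ^ n * m) := by rw [← hm]; linarith
    have hm0 : m = 0 := by
      by_contra hm0
      have hpos : (0 : ℤ) < 2 ^ n := by positivity
      rcases lt_or_gt_of_ne hm0 with h | h
      · have : 2 ^ n * m ≤ 2 ^ n * (-1) := by
          apply mul_le_mul_of_nonneg_left _ hpos.le; omega
        omega
      · have : 2 ^ n * 1 ≤ 2 ^ n * m := by
          apply mul_le_mul_of_nonneg_left _ hpos.le; omega
        omega
    rw [hm0] at this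
    linarith
  · exfalso
    set s1 := sideNum (place n ε e (arc n ε e w)).side
    set s2 := sideNum (place n ε e (arc n ε e w')).side
    have hs1 : s1 = 0 ∨ s1 = 1 := sn _
    have hs2 : s2 = 0 ∨ s2 = 1 := sn _
    refine H.near _ (hK w hw _ (arc_suffix w)) _ (hK w' hw' _ (arc_suffix w')) harc
      ((e (arc n ε e w) : ℤ) - e (arc n ε e w') + 2 ^ n * m) ?_ ?_
    -- Twice the distance of the starts is at most `2 T + 1`: two offsets, and one for the sides. By
    -- integrality the distance is at most `T`.
    · rw [← hm, abs_le]
      constructor <;> omega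
    · have := Int.modEq_add_fac_self (a := (e (arc n ε e w) : ℤ)) (n := 2 ^ n) (t := m)
      rw [show (e (arc n ε e w') : ℤ) + (e (arc n ε e w) - e (arc n ε e w') + 2 ^ n * m) =
        e (arc n ε e w) + 2 ^ n * m by ring]
      exact this.symm

end Tame

end Walk

/-! ### Random coins and leaves rarely give wild walks. -/

section WalkProbability

open Finset Classical

/-- Extend a function on the words of length at most `T` to all words. -/
noncomputable def extend {T : ℕ} {α : Type*} [Nonempty α] (g : TreeNode T → α) (w : List Bool) : α :=
  if h : w.length ≤ T then g ⟨w, h⟩ else Classical.arbitrary α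

theorem extend_apply {T : ℕ} {α : Type*} [Nonempty α] (g : TreeNode T → α) {w : List Bool}
    (h : w.length ≤ T) : extend g w = g ⟨w, h⟩ := dif_pos h

theorem extend_update {T : ℕ} {α : Type*} [Nonempty α] (g : TreeNode T → α) {w u : List Bool}
    (h : w.length ≤ T) (y : α) (hu : u ≠ w) :
    extend (Function.update g ⟨w, h⟩ y) u = extend g u := by
  unfold extend
  split_ifs with hl
  · exact Function.update_of_ne (fun h' => hu (congrArg Subtype.val h')) _ _
  · rfl

variable {n : ℕ} {ε ε' : List Bool → Bool} {e e' : List Bool → Fin (2 ^ n)}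

/-- The walk along `w` reads coins only at proper suffixes of `w` and leaves only at suffixes. This
is the independence behind all resampling arguments for walks. -/
theorem place_congr {w : List Bool} (hε : ∀ c u, c :: u <:+ w → ε u = ε' u)
    (he : ∀ u, u <:+ w → e u = e' u) : place n ε e w = place n ε' e' w := by
  induction w with
  | nil => rfl
  | cons c w ih =>
    rw [place, place, ih (fun c u hu => hε c u (hu.trans (List.suffix_cons _ _)))
      (fun u hu => he u (hu.trans (List.suffix_cons _ _))), hε c w List.suffix_rfl,
      he _ List.suffix_rfl]

theorem climbed_congr {k : ℕ} {w : List Bool} (hε : ∀ c u, c :: u <:+ w → ε u = ε' u)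
    (he : ∀ u, u <:+ w → e u = e' u) : Climbed n ε e k w ↔ Climbed n ε' e' k w := by
  induction k generalizing w with
  | zero => exact Iff.rfl
  | succ k ih =>
    cases w with
    | nil => exact Iff.rfl
    | cons c w =>
      have hε' : ∀ c u, c :: u <:+ w → ε u = ε' u :=
        fun c u hu => hε c u (hu.trans (List.suffix_cons _ _))
      have he' : ∀ u, u <:+ w → e u = e' u := fun u hu => he u (hu.trans (List.suffix_cons _ _))
      rw [Climbed, Climbed, ih hε' he', outPort, outPort, place_congr hε' he',
        hε c w List.suffix_rfl]

/-- At each step at most one of the two values of the coin leads to port `0`, and this coin was not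
read earlier on the walk. -/
theorem card_climbed {T : ℕ} (e : List Bool → Fin (2 ^ n)) (k : ℕ) {w : List Bool}
    (hw : w.length ≤ T) :
    (univ.filter fun ε : TreeNode T → Bool => Climbed n (extend ε) e k w).card * 2 ^ k ≤
      Fintype.card (TreeNode T → Bool) := by
  induction k generalizing w with
  | zero => rw [pow_zero, mul_one]; exact card_le_univ _
  | succ k ih =>
    cases w with
    | nil =>
      have h0 : (univ.filter fun ε : TreeNode T → Bool => Climbed n (extend ε) e (k + 1) []) = ∅ := by
        rw [filter_eq_empty_iff]
        exact fun _ _ h => h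
      rw [h0, card_empty, zero_mul]
      exact Nat.zero_le _
    | cons c w =>
      have hw' : w.length ≤ T := by
        rw [List.length_cons] at hw
        omega
      have inv : ∀ (ε : TreeNode T → Bool) (y : Bool) (c : Bool) (u : List Bool), c :: u <:+ w →
          extend (Function.update ε ⟨w, hw'⟩ y) u = extend ε u := by
        intro ε y c u hu
        refine extend_update ε hw' y ?_
        rintro rfl
        simpa using hu.length_le
      have key := card_resample (fun ε : TreeNode T → Bool => Climbed n (extend ε) e k w)
        (fun _ => ⟨w, hw'⟩)
        (fun ε => univ.filter fun b => (place n (extend ε) e w).port + slot (xor b c) = 0) 1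
        (fun ε _ => by
          rw [card_le_one]
          intro a ha b hb
          simp only [mem_filter, mem_univ, true_and] at ha hb
          have := slot_injective (add_left_cancel (ha.trans hb.symm))
          cases a <;> cases b <;> cases c <;> simp_all)
        (fun ε hε y => ⟨(climbed_congr (inv ε y) fun _ _ => rfl).mpr hε, rfl, by
          rw [place_congr (inv ε y) fun _ _ => rfl]⟩)
      rw [Fintype.card_bool, one_mul] at key
      have h2 : (univ.filter fun ε : TreeNode T → Bool => Climbed n (extend ε) e (k + 1) (c :: w)) =
          univ.filter fun ε : TreeNode T → Bool => Climbed n (extend ε) e k w ∧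
            ε ⟨w, hw'⟩ ∈ univ.filter fun b => (place n (extend ε) e w).port + slot (xor b c) = 0 := by
        refine Finset.ext fun ε => ?_
        rw [mem_filter]
        simp only [Climbed, mem_filter, mem_univ, true_and, outPort, extend_apply ε hw']
        exact and_comm
      rw [h2, pow_succ', ← mul_assoc]
      refine le_trans (le_of_eq ?_) ((Nat.mul_le_mul_right _ key).trans (ih hw'))
      congr!

theorem card_leaf (n : ℕ) : Fintype.card (Leaf n) = 2 ^ n := by
  rw [← Fintype.card_congr (leafEquiv n), Fintype.card_fin]

/-- The height-`h` ancestor of such a leaf is a suffix of `v` of fixed length, hence determined; the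
leaf is then given by its first `h` letters. -/
theorem card_block {h : ℕ} (hh : h ≤ n) (v : List Bool) :
    (univ.filter fun a : Fin (2 ^ n) => (leafEquiv n a).1.drop h <:+ v).card ≤ 2 ^ h := by
  rw [← card_leaf h, ← card_univ]
  refine card_le_card_of_injOn
    (fun a => (⟨(leafEquiv n a).1.take h, by simp [hh, (leafEquiv n a).2]⟩ : Leaf h))
    (fun _ _ => mem_coe.mpr (mem_univ _)) ?_
  intro a ha b hb hab
  simp only [coe_filter, mem_univ, true_and, Set.mem_ofPred_eq] at ha hb
  have hlen : ((leafEquiv n a).1.drop h).length = ((leafEquiv n b).1.drop h).length := by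
    rw [List.length_drop, List.length_drop, (leafEquiv n a).2, (leafEquiv n b).2]
  have h1 := (List.suffix_of_suffix_length_le ha hb hlen.le).eq_of_length hlen
  have h2 : (leafEquiv n a).1.take h = (leafEquiv n b).1.take h := congrArg Subtype.val hab
  refine (leafEquiv n).injective (Subtype.ext ?_)
  rw [← List.take_append_drop h (leafEquiv n a).1, h1, h2, List.take_append_drop]

/-- Since `i` is not a suffix of `j`, the walk along `j` does not read `e i`, which may be
resampled. -/
theorem card_meet {T h : ℕ} (hh : h ≤ n) (ε : List Bool → Bool) {i j : List Bool}
    (hi : i.length ≤ T) (hij : ¬ i <:+ j) :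
    (univ.filter fun e : TreeNode T → Fin (2 ^ n) =>
      (leafEquiv n (extend e i)).1.drop h <:+ (place n ε (extend e) j).word).card * 2 ^ n ≤
      2 ^ h * Fintype.card (TreeNode T → Fin (2 ^ n)) := by
  have key := card_resample_const (⟨i, hi⟩ : TreeNode T)
    (fun e : TreeNode T → Fin (2 ^ n) =>
      univ.filter fun a => (leafEquiv n a).1.drop h <:+ (place n ε (extend e) j).word) (2 ^ h)
    (fun e => card_block hh _)
    (fun e y => by
      rw [place_congr (e' := extend e) (fun _ _ _ => rfl)
        fun u hu => extend_update e hi y fun h => hij (h ▸ hu)])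
  rw [Fintype.card_fin] at key
  refine le_trans (le_of_eq ?_) key
  congr 2
  refine Finset.ext fun e => ?_
  simp only [mem_filter, mem_univ, true_and, extend_apply e hi]

theorem card_near_le (n T : ℕ) (b : ℤ) :
    (univ.filter fun a : Fin (2 ^ n) => ∃ t : ℤ, |t| ≤ T ∧ (a : ℤ) ≡ b + t [ZMOD 2 ^ n]).card ≤
      2 * T + 1 := by
  have hc : (Finset.Icc (-T : ℤ) T).card = 2 * T + 1 := by
    rw [Int.card_Icc]
    omega
  rw [← hc]
  -- Each displacement `t` fixes a residue, hence at most one position.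
  refine card_le_card_of_forall_subsingleton (fun (a : Fin (2 ^ n)) t => (a : ℤ) ≡ b + t [ZMOD 2 ^ n]) ?_ ?_
  · intro a ha
    obtain ⟨t, ht, h⟩ := (mem_filter.mp ha).2
    exact ⟨t, Finset.mem_Icc.mpr (abs_le.mp ht), h⟩
  · rintro t - a ⟨-, ha⟩ a' ⟨-, ha'⟩
    have h := ha.trans ha'.symm
    have b1 : ∀ a : Fin (2 ^ n), (a : ℤ) < 2 ^ n := fun a => by exact_mod_cast a.2
    rw [Int.ModEq, Int.emod_eq_of_lt (by positivity) (b1 a),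
      Int.emod_eq_of_lt (by positivity) (b1 a')] at h
    exact Fin.ext (by exact_mod_cast h)

theorem card_near {T : ℕ} {i j : List Bool} (hi : i.length ≤ T) (hij : i ≠ j) :
    (univ.filter fun e : TreeNode T → Fin (2 ^ n) =>
      ∃ t : ℤ, |t| ≤ T ∧ ((extend e i : Fin (2 ^ n)) : ℤ) ≡ (extend e j : Fin (2 ^ n)) + t [ZMOD 2 ^ n]).card * 2 ^ n ≤
      (2 * T + 1) * Fintype.card (TreeNode T → Fin (2 ^ n)) := by
  have key := card_resample_const (⟨i, hi⟩ : TreeNode T)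
    (fun e : TreeNode T → Fin (2 ^ n) =>
      univ.filter fun a => ∃ t : ℤ, |t| ≤ T ∧ (a : ℤ) ≡ (extend e j : Fin (2 ^ n)) + t [ZMOD 2 ^ n]) (2 * T + 1)
    (fun e => card_near_le n T _)
    (fun e y => by rw [extend_update e hi y hij.symm])
  rw [Fintype.card_fin] at key
  refine le_trans (le_of_eq ?_) key
  congr 2
  refine Finset.ext fun e => ?_
  simp only [mem_filter, mem_univ, true_and, extend_apply e hi]

/-- A real-valued form of a counting inequality `a * m ≤ r * c`. -/
theorem cast_le_of_mul_le {a m r c : ℕ} (hm : 0 < m) (h : a * m ≤ r * c) :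
    (a : ℝ) ≤ r / m * c := by
  have hm' : (0 : ℝ) < m := by exact_mod_cast hm
  rw [div_mul_eq_mul_div, le_div_iff₀ hm']
  exact_mod_cast h

/-- Wild walks are rare. -/
theorem card_not_tame {T h : ℕ} (hh : h ≤ n) (K : Finset (List Bool))
    (hT : ∀ w ∈ K, w.length ≤ T) :
    ((univ.filter fun p : (TreeNode T → Bool) × (TreeNode T → Fin (2 ^ n)) =>
      ¬ Tame n (extend p.1) (extend p.2) h T K).card : ℝ) ≤
    (((K.erase []).card : ℝ) / 2 ^ (h + 1) + (K.card : ℝ) ^ 2 * ((2 ^ h + (2 * T + 1)) / 2 ^ n)) *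
      Fintype.card ((TreeNode T → Bool) × (TreeNode T → Fin (2 ^ n))) := by
  set cε := Fintype.card (TreeNode T → Bool) with hcε
  set ce := Fintype.card (TreeNode T → Fin (2 ^ n)) with hce
  rw [Fintype.card_prod, ← hcε, ← hce]
  have hsub : (univ.filter fun p : (TreeNode T → Bool) × (TreeNode T → Fin (2 ^ n)) =>
      ¬ Tame n (extend p.1) (extend p.2) h T K) ⊆
      ((K.erase []).biUnion fun w => univ.filter fun p =>
        Climbed n (extend p.1) (extend p.2) (h + 1) w) ∪
      ((K ×ˢ K).biUnion fun q => (univ.filter fun p => ¬ q.1 <:+ q.2 ∧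
        (leafEquiv n (extend p.2 q.1)).1.drop h <:+ (place n (extend p.1) (extend p.2) q.2).word) ∪
        univ.filter fun p => q.1 ≠ q.2 ∧
          ∃ t : ℤ, |t| ≤ T ∧ ((extend p.2 q.1 : Fin (2 ^ n)) : ℤ) ≡ (extend p.2 q.2 : Fin (2 ^ n)) + t [ZMOD 2 ^ n]) := by
    intro p hp
    by_contra hc
    refine (mem_filter.mp hp).2 ⟨fun w hw hcl => hc ?_, fun i hi j hj hij hs => hc ?_,
      fun i hi j hj hij t ht hm => hc ?_⟩
    · refine mem_union_left _ (mem_biUnion.mpr ⟨w, mem_erase.mpr ⟨?_, hw⟩, by simpa using hcl⟩)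
      rintro rfl
      exact hcl
    · refine mem_union_right _ (mem_biUnion.mpr ⟨(i, j), mem_product.mpr ⟨hi, hj⟩, ?_⟩)
      exact mem_union_left _ (mem_filter.mpr ⟨mem_univ _, hij, hs⟩)
    · refine mem_union_right _ (mem_biUnion.mpr ⟨(i, j), mem_product.mpr ⟨hi, hj⟩, ?_⟩)
      exact mem_union_right _ (mem_filter.mpr ⟨mem_univ _, hij, t, ht, hm⟩)
  -- The climbs are averaged over the coins with the leaves fixed, the other two events over the
  -- leaves with the coins fixed.
  have b1 : ∀ w ∈ K.erase [], ((univ.filter fun p : (TreeNode T → Bool) ×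
      (TreeNode T → Fin (2 ^ n)) => Climbed n (extend p.1) (extend p.2) (h + 1) w).card : ℝ) ≤
      1 / 2 ^ (h + 1) * (cε * ce) := by
    intro w hw
    refine card_filter_prod_le_right (fun ε e => Climbed n (extend ε) (extend e) (h + 1) w) _ fun e => ?_
    have := cast_le_of_mul_le (r := 1) (by positivity)
      ((card_climbed (extend e) (h + 1) (hT w (mem_of_mem_erase hw))).trans (one_mul _).ge)
    push_cast at this
    exact this
  have b2 : ∀ q ∈ K ×ˢ K, ((univ.filter fun p : (TreeNode T → Bool) ×
      (TreeNode T → Fin (2 ^ n)) => ¬ q.1 <:+ q.2 ∧ (leafEquiv n (extend p.2 q.1)).1.drop h <:+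
        (place n (extend p.1) (extend p.2) q.2).word).card : ℝ) ≤ 2 ^ h / 2 ^ n * (cε * ce) := by
    intro q hq
    refine le_trans (le_of_eq (by congr!)) (card_filter_prod_le (fun ε e => ¬ q.1 <:+ q.2 ∧
      (leafEquiv n (extend e q.1)).1.drop h <:+ (place n (extend ε) (extend e) q.2).word) _
      fun ε => ?_)
    by_cases hs : q.1 <:+ q.2
    · simp only [hs, not_true_eq_false, false_and, filter_false, card_empty, Nat.cast_zero]
      positivity
    · simp only [hs, not_false_eq_true, true_and]
      have := cast_le_of_mul_le (by positivity)
        (card_meet hh (extend ε) (hT _ (mem_product.mp hq).1) hs)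
      push_cast at this
      exact this
  have b3 : ∀ q ∈ K ×ˢ K, ((univ.filter fun p : (TreeNode T → Bool) ×
      (TreeNode T → Fin (2 ^ n)) => q.1 ≠ q.2 ∧
        ∃ t : ℤ, |t| ≤ T ∧ ((extend p.2 q.1 : Fin (2 ^ n)) : ℤ) ≡ (extend p.2 q.2 : Fin (2 ^ n)) + t [ZMOD 2 ^ n]).card : ℝ) ≤
      (2 * T + 1) / 2 ^ n * (cε * ce) := by
    intro q hq
    refine le_trans (le_of_eq (by congr!)) (card_filter_prod_le (fun _ e => q.1 ≠ q.2 ∧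
        ∃ t : ℤ, |t| ≤ T ∧ ((extend e q.1 : Fin (2 ^ n)) : ℤ) ≡ (extend e q.2 : Fin (2 ^ n)) + t [ZMOD 2 ^ n]) _
      fun ε => ?_)
    by_cases hs : q.1 = q.2
    · simp only [hs, ne_eq, not_true_eq_false, false_and, filter_false, card_empty, Nat.cast_zero]
      positivity
    · simp only [hs, ne_eq, not_false_eq_true, true_and]
      have := cast_le_of_mul_le (by positivity)
        (card_near (n := n) (hT _ (mem_product.mp hq).1) hs)
      push_cast at this
      exact this
  have hcard := (card_le_card hsub).trans ((card_union_le _ _).trans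
    (add_le_add card_biUnion_le (card_biUnion_le.trans (sum_le_sum fun q _ => card_union_le _ _))))
  refine (Nat.cast_le (α := ℝ).mpr hcard).trans ?_
  push_cast
  refine (add_le_add (sum_le_card_nsmul _ _ _ b1)
    (sum_le_card_nsmul _ _ _ fun q hq => add_le_add (b2 q hq) (b3 q hq))).trans (le_of_eq ?_)
  rw [card_product, nsmul_eq_mul, nsmul_eq_mul]
  push_cast
  ring

end WalkProbability

/-! ### The run against an infinite binary tree with random labels and names. -/

section IdealRun

open Finset Classical

variable {n : ℕ}

/-- The name of a word: the empty word has the all-zero name. -/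
def nameOf (x : List Bool → Name n) : List Bool → Name n
  | [] => fun _ => false
  | c :: w => x (c :: w)

/-- The colour of an edge seen from a vertex of column parity `b` (`true` if even). -/
def mkColor (b : Bool) (own other : Fin 3) : Color := if b then (own, other) else (other, own)

/-- The answer to the query of the word `w` in an infinite binary tree with names `x` in which
the vertex `u` gives the labels `d u` to its parent and `d u + 1`, `d u + 2` to its children. -/
def idealAnswer (d : List Bool → Fin 3) (x : List Bool → Name n) (w : List Bool) : Answer n :=
  {p | (∃ c, p = (nameOf x (c :: w), mkColor (decide (Even w.length)) (d w + slot c) (d (c :: w)))) ∨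
    ∃ c u, w = c :: u ∧ p = (nameOf x u, mkColor (decide (Even w.length)) (d w) (d u + slot c))}

/-- The words whose names are known after the words in `Q` have been queried. -/
def known (Q : Finset (List Bool)) : Finset (List Bool) :=
  insert [] (Q.biUnion fun u => {false :: u, true :: u})

theorem mem_known {Q : Finset (List Bool)} {w : List Bool} :
    w ∈ known Q ↔ w = [] ∨ ∃ c u, w = c :: u ∧ u ∈ Q := by
  simp only [known, mem_insert, mem_biUnion, mem_singleton]
  refine or_congr_right ⟨?_, ?_⟩
  · rintro ⟨u, hu, rfl | rfl⟩
    exacts [⟨_, u, rfl, hu⟩, ⟨_, u, rfl, hu⟩]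
  · rintro ⟨c, u, rfl, hu⟩
    exact ⟨u, hu, by cases c <;> simp⟩

theorem cons_mem_known {Q : Finset (List Bool)} {c : Bool} {u : List Bool} :
    c :: u ∈ known Q ↔ u ∈ Q := by
  rw [mem_known]
  constructor
  · rintro (h | ⟨c', u', h, hu⟩)
    · exact absurd h (List.cons_ne_nil _ _)
    · rwa [(List.cons.inj h).2]
  · exact fun h => Or.inr ⟨c, u, rfl, h⟩

theorem nil_mem_known (Q : Finset (List Bool)) : [] ∈ known Q := mem_insert_self _ _

theorem known_mono {Q Q' : Finset (List Bool)} (h : Q ⊆ Q') : known Q ⊆ known Q' := by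
  intro w hw
  rw [mem_known] at hw ⊢
  exact hw.imp_right fun ⟨c, u, hw, hu⟩ => ⟨c, u, hw, h hu⟩

theorem card_erase_known_le (Q : Finset (List Bool)) : ((known Q).erase []).card ≤ 2 * Q.card := by
  have h1 : (known Q).erase [] ⊆ Q.biUnion fun u => {false :: u, true :: u} := by
    intro w hw
    obtain ⟨h1, h2⟩ := mem_erase.mp hw
    exact (mem_insert.mp h2).resolve_left h1
  refine (card_le_card h1).trans (card_biUnion_le.trans ?_)
  rw [mul_comm]
  exact sum_le_card_nsmul _ _ _ fun u _ => card_le_two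

theorem card_known_le (Q : Finset (List Bool)) : (known Q).card ≤ 2 * Q.card + 1 := by
  have := card_erase_add_one (nil_mem_known Q)
  have := card_erase_known_le Q
  omega

/-- The state of a simulated run: transcript, queried words, and queries that hit no known name. -/
structure Run (n : ℕ) where
  log : List (Name n × Answer n)
  queried : Finset (List Bool)
  guesses : Finset (Name n)

/-- The words with a known name equal to `a`. -/
def Hits (x : List Bool → Name n) (R : Run n) (a : Name n) (w : List Bool) : Prop :=
  w ∈ known R.queried ∧ nameOf x w = a

/-- One simulated query. -/
noncomputable def Run.step (d : List Bool → Fin 3) (x : List Bool → Name n) (R : Run n)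
    (a : Name n) : Run n :=
  if h : ∃ w, Hits x R a w then
    ⟨R.log ++ [(a, idealAnswer d x h.choose)], insert h.choose R.queried, R.guesses⟩
  else ⟨R.log ++ [(a, ∅)], R.queried, insert a R.guesses⟩

/-- The simulated run of an algorithm against an infinite binary tree. -/
noncomputable def idealRun (A : Algorithm n) (d : List Bool → Fin 3) (x : List Bool → Name n) :
    ℕ → Run n
  | 0 => ⟨[], ∅, ∅⟩
  | k + 1 => (A (idealRun A d x k).log).elim (idealRun A d x k) ((idealRun A d x k).step d x)

variable {A : Algorithm n} {d d' : List Bool → Fin 3} {x x' : List Bool → Name n}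

theorem Run.step_hit {R : Run n} {a : Name n} {w : List Bool} (hw : Hits x R a w)
    (hx : Set.InjOn (nameOf x) ↑(known R.queried)) :
    R.step d x a = ⟨R.log ++ [(a, idealAnswer d x w)], insert w R.queried, R.guesses⟩ := by
  have h : ∃ w, Hits x R a w := ⟨w, hw⟩
  rw [Run.step, dif_pos h, hx h.choose_spec.1 hw.1 (h.choose_spec.2.trans hw.2.symm)]

theorem idealRun_none {k : ℕ} (h : A (idealRun A d x k).log = none) :
    idealRun A d x (k + 1) = idealRun A d x k := by
  rw [idealRun, h]; rfl

theorem idealRun_some {k : ℕ} {a : Name n} (h : A (idealRun A d x k).log = some a) :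
    idealRun A d x (k + 1) = (idealRun A d x k).step d x a := by
  rw [idealRun, h]; rfl

theorem Run.step_queried_subset (R : Run n) (a : Name n) :
    R.queried ⊆ (R.step d x a).queried := by
  unfold Run.step
  split_ifs
  exacts [subset_insert _ _, subset_rfl]

theorem Run.step_guesses_subset (R : Run n) (a : Name n) :
    R.guesses ⊆ (R.step d x a).guesses := by
  unfold Run.step
  split_ifs
  exacts [subset_rfl, subset_insert _ _]

theorem idealRun_queried_mono {k l : ℕ} (h : k ≤ l) :
    (idealRun A d x k).queried ⊆ (idealRun A d x l).queried := by
  induction l, h using Nat.le_induction with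
  | base => exact subset_rfl
  | succ l _ ih =>
    refine ih.trans ?_
    cases hA : A (idealRun A d x l).log with
    | none => rw [idealRun_none hA]
    | some a => rw [idealRun_some hA]; exact Run.step_queried_subset _ _

theorem idealRun_guesses_mono {k l : ℕ} (h : k ≤ l) :
    (idealRun A d x k).guesses ⊆ (idealRun A d x l).guesses := by
  induction l, h using Nat.le_induction with
  | base => exact subset_rfl
  | succ l _ ih =>
    refine ih.trans ?_
    cases hA : A (idealRun A d x l).log with
    | none => rw [idealRun_none hA]
    | some a => rw [idealRun_some hA]; exact Run.step_guesses_subset _ _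

/-- A query adds either a queried word or a guess. -/
theorem idealRun_card_le (k : ℕ) :
    (idealRun A d x k).queried.card + (idealRun A d x k).guesses.card ≤ k := by
  induction k with
  | zero => simp [idealRun]
  | succ k ih =>
    cases hA : A (idealRun A d x k).log with
    | none => rw [idealRun_none hA]; omega
    | some a =>
      rw [idealRun_some hA, Run.step]
      split_ifs with h
      · have := card_insert_le h.choose (idealRun A d x k).queried
        simp only
        omega
      · have := card_insert_le a (idealRun A d x k).guesses
        simp only
        omega

theorem idealRun_queried_subset_known (k : ℕ) :
    (idealRun A d x k).queried ⊆ known (idealRun A d x k).queried := by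
  induction k with
  | zero => simp [idealRun]
  | succ k ih =>
    have hm := known_mono (idealRun_queried_mono (A := A) (d := d) (x := x) (Nat.le_add_right k 1))
    cases hA : A (idealRun A d x k).log with
    | none => rw [idealRun_none hA]; exact ih
    | some a =>
      rw [idealRun_some hA] at hm ⊢
      revert hm
      rw [Run.step]
      split_ifs with h
      · exact fun hm => insert_subset (hm h.choose_spec.1) (ih.trans hm)
      · exact fun _ => ih

theorem mem_known_of_suffix {k : ℕ} {w u : List Bool}
    (hw : w ∈ known (idealRun A d x k).queried) (hu : u <:+ w) :
    u ∈ known (idealRun A d x k).queried := by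
  induction w with
  | nil => rwa [List.suffix_nil.mp hu]
  | cons c w ih =>
    rcases List.suffix_cons_iff.mp hu with rfl | hu
    · exact hw
    · exact ih (idealRun_queried_subset_known k (cons_mem_known.mp hw)) hu

theorem length_le_of_mem_known {k : ℕ} {w : List Bool}
    (hw : w ∈ known (idealRun A d x k).queried) : w.length ≤ k := by
  induction k generalizing w with
  | zero =>
    rcases mem_known.mp hw with rfl | ⟨c, u, rfl, hu⟩
    · simp
    · simp [idealRun] at hu
  | succ k ih =>
    rcases mem_known.mp hw with rfl | ⟨c, u, rfl, hu⟩
    · simp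
    · have hu' : u ∈ known (idealRun A d x k).queried := by
        have h1 := idealRun_queried_subset_known (A := A) (d := d) (x := x) k
        cases hA : A (idealRun A d x k).log with
        | none => rw [idealRun_none hA] at hu; exact h1 hu
        | some a =>
          rw [idealRun_some hA, Run.step] at hu
          split_ifs at hu with h
          · rcases mem_insert.mp hu with rfl | hu
            · exact h.choose_spec.1
            · exact h1 hu
          · exact h1 hu
      have := ih hu'
      rw [List.length_cons]
      omega

theorem nameOf_congr {w : List Bool} (h : x w = x' w) : nameOf x w = nameOf x' w := by
  cases w with
  | nil => rfl
  | cons c w => exact h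

theorem hits_congr {R : Run n} {a : Name n}
    (h : ∀ w ∈ known R.queried, nameOf x w = nameOf x' w) : Hits x R a = Hits x' R a := by
  funext w
  refine propext ⟨fun hw => ⟨hw.1, (h w hw.1) ▸ hw.2⟩, fun hw => ⟨hw.1, (h w hw.1).symm ▸ hw.2⟩⟩

/-- The queried words after a step are determined by the names known before it. -/
theorem Run.step_queried_congr {R : Run n} {a : Name n}
    (h : ∀ w ∈ known R.queried, nameOf x w = nameOf x' w) :
    (R.step d x a).queried = (R.step d' x' a).queried := by
  have hh := hits_congr (a := a) h
  unfold Run.step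
  simp only [hh]
  split_ifs <;> rfl

theorem idealAnswer_congr {w : List Bool} (hd : ∀ u, d u = d' u ∨ (u ≠ w ∧ ∀ c, u ≠ c :: w ∧ w ≠ c :: u))
    (hx : ∀ u, nameOf x u = nameOf x' u ∨ ∀ c, u ≠ c :: w ∧ w ≠ c :: u) :
    idealAnswer d x w = idealAnswer d' x' w := by
  have d0 : d w = d' w := (hd w).resolve_right fun h => h.1 rfl
  have d1 : ∀ c, d (c :: w) = d' (c :: w) :=
    fun c => (hd _).resolve_right fun h => (h.2 c).1 rfl
  have x1 : ∀ c, nameOf x (c :: w) = nameOf x' (c :: w) :=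
    fun c => (hx _).resolve_right fun h => (h c).1 rfl
  ext p
  refine or_congr (exists_congr fun c => by rw [d0, d1, x1])
    (exists_congr fun c => exists_congr fun u => ?_)
  refine and_congr_right ?_
  rintro rfl
  rw [d0, (hd u).resolve_right fun h => (h.2 c).2 rfl,
    (hx u).resolve_right fun h => (h c).2 rfl]

/-- The run depends only on the labels and names of the known words. -/
theorem idealRun_congr {k : ℕ}
    (hd : ∀ w ∈ known (idealRun A d x k).queried, (w = [] → [] ∈ (idealRun A d x k).queried) →
      d w = d' w)
    (hx : ∀ w ∈ known (idealRun A d x k).queried, nameOf x w = nameOf x' w) :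
    idealRun A d x k = idealRun A d' x' k := by
  induction k with
  | zero => rfl
  | succ k ih =>
    have hm := idealRun_queried_mono (A := A) (d := d) (x := x) (Nat.le_add_right k 1)
    have hk := known_mono hm
    have ih := ih (fun w hw h0 => hd w (hk hw) fun h => hm (h0 h)) (fun w hw => hx w (hk hw))
    have hx' : ∀ w ∈ known (idealRun A d x k).queried, nameOf x w = nameOf x' w :=
      fun w hw => hx w (hk hw)
    cases hA : A (idealRun A d x k).log with
    | none => rw [idealRun_none hA, idealRun_none (ih ▸ hA), ih]
    | some a =>
      rw [idealRun_some hA, idealRun_some (ih ▸ hA), ← ih]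
      have hh := hits_congr (a := a) hx'
      rw [idealRun_some hA] at hd hx
      unfold Run.step at hd hx ⊢
      by_cases h : ∃ w, Hits x (idealRun A d x k) a w
      · have h' : ∃ w, Hits x' (idealRun A d x k) a w := hh ▸ h
        rw [dif_pos h] at hd hx ⊢
        rw [dif_pos h']
        have hc : h.choose = h'.choose := by congr!
        rw [← hc]
        have hans : idealAnswer d x h.choose = idealAnswer d' x' h.choose := by
          have hsub := subset_insert h.choose (idealRun A d x k).queried
          have hwk := known_mono hsub h.choose_spec.1
          have hmem : ∀ c u, h.choose = c :: u →
              u ∈ known (insert h.choose (idealRun A d x k).queried) := fun c u hu =>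
            known_mono hsub
              (mem_known_of_suffix h.choose_spec.1 (hu ▸ List.suffix_cons _ _))
          -- The answer reads only the queried word, its parent and its children, and all of them
          -- are known after this step. The label of the root is read only if the root is queried or
          -- a child of it is, and such a child is known only once the root has been queried.
          refine idealAnswer_congr (fun u => ?_) fun u => ?_
          · by_contra hcon
            push Not at hcon
            obtain ⟨hne, hcon⟩ := hcon
            by_cases huw : u = h.choose
            · exact hne (hd u (huw ▸ hwk) fun h0 => by rw [← h0, huw]; exact mem_insert_self _ _)
            · obtain ⟨c, hc⟩ := hcon huw
              by_cases h1 : u = c :: h.choose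
              · exact hne (hd u (h1 ▸ cons_mem_known.mpr (mem_insert_self _ _)) fun h0 =>
                  absurd (h1.symm.trans h0) (List.cons_ne_nil _ _))
              · refine hne (hd u (hmem c u (hc h1)) fun h0 => ?_)
                have h2 := h.choose_spec.1
                rw [hc h1, cons_mem_known, h0] at h2
                exact mem_insert_of_mem h2
          · by_contra hcon
            push Not at hcon
            obtain ⟨hne, c, hc⟩ := hcon
            by_cases h1 : u = c :: h.choose
            · exact hne (hx u (h1 ▸ cons_mem_known.mpr (mem_insert_self _ _)))
            · exact hne (hx u (hmem c u (hc h1)))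
        rw [hans]
      · have h' : ¬ ∃ w, Hits x' (idealRun A d x k) a w := hh ▸ h
        rw [dif_neg h, dif_neg h']

/-- The known names are distinct, and none of them has been guessed before it was known. -/
structure Fresh (x : List Bool → Name n) (R : Run n) : Prop where
  inj : Set.InjOn (nameOf x) ↑(known R.queried)
  guess : ∀ w ∈ known R.queried, nameOf x w ∉ R.guesses

/-- The strings that the algorithm has seen. -/
noncomputable def seen (x : List Bool → Name n) (R : Run n) : Finset (Name n) :=
  (known R.queried).image (nameOf x) ∪ R.guesses

theorem card_seen_le (k : ℕ) : (seen x (idealRun A d x k)).card ≤ 2 * k + 1 := by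
  have h1 := idealRun_card_le (A := A) (d := d) (x := x) k
  have h2 := card_known_le (idealRun A d x k).queried
  have h3 : ((known (idealRun A d x k).queried).image (nameOf x)).card ≤ _ := card_image_le
  have h4 := card_union_le ((known (idealRun A d x k).queried).image (nameOf x))
    (idealRun A d x k).guesses
  unfold seen
  omega

/-- At step `k` the word `w` is queried for the first time. -/
def NewQuery (A : Algorithm n) (d : List Bool → Fin 3) (x : List Bool → Name n) (k : ℕ)
    (w : List Bool) : Prop :=
  w ∉ (idealRun A d x k).queried ∧ (idealRun A d x (k + 1)).queried =
    insert w (idealRun A d x k).queried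

/-- At step `k` the name of a new word `c :: w` has been seen before, or is that of its sibling. -/
def Clash (A : Algorithm n) (d : List Bool → Fin 3) (x : List Bool → Name n) (c : Bool)
    (k : ℕ) : Prop :=
  ∃ w, NewQuery A d x k w ∧
    x (c :: w) ∈ insert (x ((!c) :: w)) (seen x (idealRun A d x k))

/-- Names become known only in sibling pairs, at the first query of a word, so a collision has to
appear at such a step. A later guess cannot equal a known name, because that query would count as a
hit. -/
theorem fresh_of_no_clash {k : ℕ} (h : ∀ l < k, ∀ c, ¬ Clash A d x c l) :
    Fresh x (idealRun A d x k) := by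
  induction k with
  | zero =>
    have hk : ∀ w ∈ known (idealRun A d x 0).queried, w = [] := by
      intro w hw
      rcases mem_known.mp hw with h | ⟨c, u, -, hu⟩
      · exact h
      · simp [idealRun] at hu
    refine ⟨fun w hw w' hw' _ => ?_, fun w _ => by simp [idealRun]⟩
    rw [hk w hw, hk w' hw']
  | succ k ih =>
    have ih := ih fun l hl => h l (by omega)
    have hcl := h k (by omega)
    cases hA : A (idealRun A d x k).log with
    | none => rw [idealRun_none hA]; exact ih
    | some a =>
      by_cases hh : ∃ w, Hits x (idealRun A d x k) a w
      · obtain ⟨w, hw⟩ := hh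
        have hstep := Run.step_hit (d := d) hw ih.inj
        by_cases hwq : w ∈ (idealRun A d x k).queried
        · rw [idealRun_some hA, hstep, insert_eq_of_mem hwq]
          exact ⟨ih.inj, ih.guess⟩
        have hnew : NewQuery A d x k w := ⟨hwq, by rw [idealRun_some hA, hstep]⟩
        have hns : ∀ c, x (c :: w) ∉ seen x (idealRun A d x k) ∧ x (c :: w) ≠ x ((!c) :: w) := by
          intro c
          have h1 : ¬ x (c :: w) ∈ insert (x ((!c) :: w)) (seen x (idealRun A d x k)) :=
            fun hm => hcl c ⟨w, hnew, hm⟩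
          rw [mem_insert, not_or] at h1
          exact ⟨h1.2, h1.1⟩
        rw [idealRun_some hA, hstep]
        have hkn : ∀ u ∈ known (insert w (idealRun A d x k).queried),
            u ∈ known (idealRun A d x k).queried ∨ ∃ c, u = c :: w := by
          intro u hu
          rcases mem_known.mp hu with rfl | ⟨c, v, rfl, hv⟩
          · exact Or.inl (nil_mem_known _)
          · rcases mem_insert.mp hv with rfl | hv
            · exact Or.inr ⟨c, rfl⟩
            · exact Or.inl (cons_mem_known.mpr hv)
        have hold : ∀ u ∈ known (idealRun A d x k).queried, ∀ c, nameOf x u ≠ nameOf x (c :: w) :=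
          fun u hu c he => (hns c).1 (mem_union_left _ (mem_image.mpr ⟨u, hu, he⟩))
        refine ⟨fun u hu v hv huv => ?_, fun u hu => ?_⟩
        · rcases hkn u hu with hu | ⟨c, rfl⟩ <;> rcases hkn v hv with hv | ⟨c', rfl⟩
          · exact ih.inj hu hv huv
          · exact absurd huv (hold u hu c')
          · exact absurd huv.symm (hold v hv c)
          · by_cases hcc : c' = c
            · rw [hcc]
            · obtain rfl : c' = !c := by cases c <;> cases c' <;> simp_all
              exact absurd huv (hns c).2
        · rcases hkn u hu with hu | ⟨c, rfl⟩
          · exact ih.guess u hu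
          · exact fun hg => (hns c).1 (mem_union_right _ hg)
      · rw [idealRun_some hA, Run.step, dif_neg hh]
        refine ⟨ih.inj, fun w hw hg => ?_⟩
        rcases mem_insert.mp hg with hg | hg
        · exact hh ⟨w, hw, hg⟩
        · exact ih.guess w hw hg

/-- The name of the new child has not been read during the first `k` steps and does not influence
which word is queried at step `k`; so it may be resampled. At most `2 k + 1` seen strings and the
sibling's name are forbidden. -/
theorem card_clash {T : ℕ} (A : Algorithm n) (d : List Bool → Fin 3) (c : Bool) {k : ℕ}
    (hk : k < T) :
    (univ.filter fun x : TreeNode T → Name n => Clash A d (extend x) c k).card *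
      Fintype.card (Name n) ≤ (2 * k + 2) * Fintype.card (TreeNode T → Name n) := by
  have hlen : ∀ {x : List Bool → Name n} {w c}, NewQuery A d x k w → (c :: w).length ≤ T := by
    intro x w c hw
    have h1 : c :: w ∈ known (idealRun A d x (k + 1)).queried :=
      cons_mem_known.mpr (hw.2 ▸ mem_insert_self _ _)
    exact (length_le_of_mem_known h1).trans hk
  -- The inspected coordinate depends on the run. The default values of `idx` and `H` play no part,
  -- since resampling is conditioned on a new query at step `k`.
  let idx : (TreeNode T → Name n) → TreeNode T := fun x =>
    if h : ∃ w, NewQuery A d (extend x) k w then ⟨c :: h.choose, hlen h.choose_spec⟩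
    else ⟨[], Nat.zero_le _⟩
  have huniq : ∀ {x : List Bool → Name n} {w w'}, NewQuery A d x k w → NewQuery A d x k w' →
      w = w' := by
    intro x w w' h h'
    have h1 : w ∈ insert w' (idealRun A d x k).queried := by
      rw [← h'.2, h.2]; exact mem_insert_self _ _
    exact (mem_insert.mp h1).resolve_right h.1
  have hidx : ∀ {x : TreeNode T → Name n} {w} (hw : NewQuery A d (extend x) k w),
      idx x = ⟨c :: w, hlen hw⟩ := by
    intro x w hw
    have h : ∃ w, NewQuery A d (extend x) k w := ⟨w, hw⟩
    simp only [idx, dif_pos h]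
    congr 2
    exact huniq h.choose_spec hw
  let H : (TreeNode T → Name n) → Finset (Name n) := fun x =>
    if h : ∃ w, NewQuery A d (extend x) k w then
      insert (extend x ((!c) :: h.choose)) (seen (extend x) (idealRun A d (extend x) k))
    else ∅
  have hH : ∀ {x : TreeNode T → Name n} {w} (_ : NewQuery A d (extend x) k w),
      H x = insert (extend x ((!c) :: w)) (seen (extend x) (idealRun A d (extend x) k)) := by
    intro x w hw
    have h : ∃ w, NewQuery A d (extend x) k w := ⟨w, hw⟩
    simp only [H, dif_pos h]
    rw [huniq h.choose_spec hw]
  have key := card_resample (fun x : TreeNode T → Name n => ∃ w, NewQuery A d (extend x) k w)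
    idx H (2 * k + 2) ?_ ?_
  · refine le_trans (le_of_eq ?_) (key.trans (Nat.mul_le_mul_left _ (card_le_univ _)))
    congr 2
    refine Finset.ext fun x => ?_
    simp only [mem_filter, mem_univ, true_and]
    constructor
    · rintro ⟨w, hw, hm⟩
      refine ⟨⟨w, hw⟩, ?_⟩
      rw [hidx hw, hH hw, ← extend_apply x (hlen hw)]
      exact hm
    · rintro ⟨⟨w, hw⟩, hm⟩
      rw [hidx hw, hH hw, ← extend_apply x (hlen hw)] at hm
      exact ⟨w, hw, hm⟩
  · rintro x ⟨w, hw⟩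
    rw [hH hw]
    have := card_insert_le (extend x ((!c) :: w)) (seen (extend x) (idealRun A d (extend x) k))
    have := card_seen_le (A := A) (d := d) (x := extend x) k
    omega
  · rintro x ⟨w, hw⟩ y
    rw [hidx hw]
    set x' := Function.update x ⟨c :: w, hlen hw⟩ y with hx'
    have hupd : ∀ u, u ≠ c :: w → extend x u = extend x' u := fun u hu =>
      (extend_update x (hlen hw) y hu).symm
    have hn : ∀ u ∈ known (idealRun A d (extend x) k).queried,
        nameOf (extend x) u = nameOf (extend x') u := by
      intro u hu
      refine nameOf_congr (hupd u ?_)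
      rintro rfl
      exact hw.1 (cons_mem_known.mp hu)
    have hrun : idealRun A d (extend x) k = idealRun A d (extend x') k :=
      idealRun_congr (fun _ _ _ => rfl) hn
    have hnew : NewQuery A d (extend x') k w := by
      refine ⟨hrun ▸ hw.1, ?_⟩
      rw [← hrun, ← hw.2]
      cases hA : A (idealRun A d (extend x) k).log with
      | none => rw [idealRun_none hA, idealRun_none (hrun ▸ hA), hrun]
      | some a =>
        rw [idealRun_some hA, idealRun_some (hrun ▸ hA), ← hrun]
        exact (Run.step_queried_congr hn).symm
    refine ⟨⟨w, hnew⟩, hidx hnew, ?_⟩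
    rw [hH hnew, hH hw, ← hrun, hupd ((!c) :: w) (by cases c <;> simp)]
    congr 1
    unfold seen
    congr 1
    exact (image_congr hn).symm

/-- The simulated run rarely sees a name twice. -/
theorem card_not_fresh (T : ℕ) (A : Algorithm n) (d : List Bool → Fin 3) :
    ((univ.filter fun x : TreeNode T → Name n => ¬ Fresh (extend x)
      (idealRun A d (extend x) T)).card : ℝ) ≤
      (2 * T * (2 * T) : ℝ) / 2 ^ (2 * n) * Fintype.card (TreeNode T → Name n) := by
  have hsub : (univ.filter fun x : TreeNode T → Name n => ¬ Fresh (extend x)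
      (idealRun A d (extend x) T)) ⊆ (range T ×ˢ (univ : Finset Bool)).biUnion fun q =>
        univ.filter fun x => Clash A d (extend x) q.2 q.1 := by
    intro x hx
    by_contra hc
    refine (mem_filter.mp hx).2 (fresh_of_no_clash fun l hl c hcl => hc ?_)
    exact mem_biUnion.mpr ⟨(l, c), by simpa using hl, by simpa using hcl⟩
  have hcard : Fintype.card (Name n) = 2 ^ (2 * n) := by simp
  refine (Nat.cast_le (α := ℝ).mpr ((card_le_card hsub).trans card_biUnion_le)).trans ?_
  push_cast
  refine (sum_le_card_nsmul _ _ ((2 * T : ℝ) / 2 ^ (2 * n) *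
    Fintype.card (TreeNode T → Name n)) fun q hq => ?_).trans (le_of_eq ?_)
  · have hq1 : q.1 < T := mem_range.mp (mem_product.mp hq).1
    have h1 := card_clash A d q.2 hq1
    rw [hcard] at h1
    have h2 := cast_le_of_mul_le (by positivity)
      (h1.trans (Nat.mul_le_mul_right _ (show 2 * q.1 + 2 ≤ 2 * T by omega)))
    push_cast at h2
    exact h2
  · rw [card_product, card_range, card_univ, Fintype.card_bool, nsmul_eq_mul]
    push_cast
    ring

end IdealRun

/-! ### In a compatible world the true oracle answers as the simulation does. -/

section Simulation

open Classical

variable {n : ℕ}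

/-- The position on the cycle given by an integer. -/
def cycIdx (n : ℕ) (q : ℤ) : Fin (2 ^ n) :=
  ⟨(q % 2 ^ n).toNat, by
    have h1 := Int.emod_lt_of_pos q (show (0 : ℤ) < 2 ^ n by positivity)
    have h2 := Int.emod_nonneg q (show (2 : ℤ) ^ n ≠ 0 by positivity)
    zify
    rw [Int.toNat_of_nonneg h2]
    exact h1⟩

theorem coe_cycIdx (q : ℤ) : ((cycIdx n q : ℕ) : ℤ) = q % 2 ^ n :=
  Int.toNat_of_nonneg (Int.emod_nonneg q (by positivity))

theorem cycIdx_eq_iff {q q' : ℤ} : cycIdx n q = cycIdx n q' ↔ q ≡ q' [ZMOD 2 ^ n] := by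
  rw [Int.ModEq, ← coe_cycIdx, ← coe_cycIdx, Fin.ext_iff]
  exact Nat.cast_inj.symm

theorem cycIdx_coe (a : Fin (2 ^ n)) : cycIdx n (a : ℤ) = a := by
  have h : ((cycIdx n (a : ℤ) : ℕ) : ℤ) = a := by
    rw [coe_cycIdx, Int.emod_eq_of_lt (by positivity) (by exact_mod_cast a.2)]
  exact Fin.ext (by exact_mod_cast h)

theorem cycIdx_add_one (q : ℤ) : cycIdx n (q + 1) = cycIdx n q + 1 := by
  apply Fin.ext
  zify
  rw [coe_cycIdx, Fin.val_add]
  push_cast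
  have h1 : (((1 : Fin (2 ^ n)) : ℕ) : ℤ) = 1 % 2 ^ n := by
    rw [Fin.val_one']
    push_cast
    rfl
  rw [coe_cycIdx, h1, ← Int.add_emod]

theorem sideNum_div (s : Bool) (a : ℤ) : (2 * a + sideNum s) / 2 = a := by
  cases s <;> simp only [sideNum, Bool.false_eq_true, if_true, if_false] <;> omega

section Vert

variable (n) (ε : List Bool → Bool) (e : List Bool → Fin (2 ^ n))

/-- The vertex reached by the walk along a word. -/
noncomputable def vert (w : List Bool) : Vertex n :=
  if (place n ε e w).side then Sum.inr ⟨(place n ε e w).word, word_length_le w⟩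
  else Sum.inl ⟨(place n ε e w).word, word_length_le w⟩

variable {n ε e}

theorem vert_right {w : List Bool} (h : (place n ε e w).side = true) :
    vert n ε e w = Sum.inr ⟨(place n ε e w).word, word_length_le w⟩ := if_pos h

theorem vert_left {w : List Bool} (h : (place n ε e w).side = false) :
    vert n ε e w = Sum.inl ⟨(place n ε e w).word, word_length_le w⟩ := by
  rw [vert, h]; rfl

theorem vert_eq_iff {ε' : List Bool → Bool} {e' : List Bool → Fin (2 ^ n)} {w w' : List Bool} :
    vert n ε e w = vert n ε' e' w' ↔ (place n ε e w).side = (place n ε' e' w').side ∧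
      (place n ε e w).word = (place n ε' e' w').word := by
  cases h : (place n ε e w).side <;> cases h' : (place n ε' e' w').side
  · rw [vert_left h, vert_left h']; simp
  · rw [vert_left h, vert_right h']; simp
  · rw [vert_right h, vert_left h']; simp
  · rw [vert_right h, vert_right h']; simp

theorem vert_nil : vert n ε e [] = entrance n := rfl

end Vert

/-- The standing assumptions on the walks along a set of known words. -/
structure GoodWalk (n : ℕ) (ε : List Bool → Bool) (e : List Bool → Fin (2 ^ n)) (h T : ℕ)
    (Q : Finset (List Bool)) : Prop where
  height : h + 1 ≤ n
  small : T < 2 ^ n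
  length_le : ∀ w ∈ known Q, w.length ≤ T
  suffix_closed : ∀ w ∈ known Q, ∀ u, u <:+ w → u ∈ known Q
  queried_known : Q ⊆ known Q
  tame : Tame n ε e h T (known Q)

/-- The cycle passes through the leaves visited by the walks at the prescribed positions. -/
def CycleOk (ε : List Bool → Bool) (e : List Bool → Fin (2 ^ n)) (Q : Finset (List Bool))
    (Z : LeafCycle n) : Prop :=
  ∀ w ∈ known Q, (place n ε e w).word.length = n →
    ((if (place n ε e w).side then Z.2 else Z.1) (cycIdx n ((place n ε e w).cyc / 2))).1 =
      (place n ε e w).word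

variable {ε : List Bool → Bool} {e : List Bool → Fin (2 ^ n)} {h T : ℕ}
  {Q : Finset (List Bool)} {Z : LeafCycle n}

/-- The known part of the infinite tree is embedded in the graph, so the algorithm has seen no
cycle. -/
theorem GoodWalk.vert_injOn (H : GoodWalk n ε e h T Q) : Set.InjOn (vert n ε e) ↑(known Q) :=
  fun _ hw _ hw' hv => H.tame.injOn H.height H.suffix_closed hw hw' (vert_eq_iff.mp hv).2

theorem GoodWalk.vert_ne_exit (H : GoodWalk n ε e h T Q) {w : List Bool} (hw : w ∈ known Q) :
    vert n ε e w ≠ exit n := by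
  cases hs : (place n ε e w).side
  · rw [vert_left hs]
    exact Sum.inl_ne_inr
  · rw [vert_right hs]
    intro he
    have h1 := congrArg Subtype.val (Sum.inr.inj he)
    exact H.tame.ne_exit H.height H.suffix_closed hw hs h1

theorem GoodWalk.tail_mem (H : GoodWalk n ε e h T Q) {c : Bool} {w : List Bool}
    (hw : c :: w ∈ known Q) : w ∈ known Q :=
  H.suffix_closed _ hw _ (List.suffix_cons _ _)

theorem GoodWalk.climb_word (H : GoodWalk n ε e h T Q) {c : Bool} {w : List Bool}
    (hw : w ∈ known Q) (h0 : outPort n ε e c w = 0) :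
    ∃ b, (place n ε e w).word = b :: (place n ε e w).word.tail := by
  have hne : w ≠ [] := by
    rintro rfl
    exact outPort_ne_port c [] h0
  obtain ⟨b, v, hv⟩ := List.exists_cons_of_ne_nil (H.tame.ne_root H.height H.suffix_closed hw hne)
  exact ⟨b, by rw [hv]; rfl⟩

/-- How one step of the walk changes side and word. -/
theorem GoodWalk.step_cases (H : GoodWalk n ε e h T Q) {c : Bool} {w : List Bool}
    (hw : c :: w ∈ known Q) :
    (outPort n ε e c w = 0 ∧ (place n ε e (c :: w)).side = (place n ε e w).side ∧
      ∃ b, (place n ε e w).word = b :: (place n ε e (c :: w)).word ∧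
        (place n ε e (c :: w)).port = slot b) ∨
    (outPort n ε e c w ≠ 0 ∧ (place n ε e (c :: w)).side = (place n ε e w).side ∧
      (place n ε e (c :: w)).port = 0 ∧
      (place n ε e (c :: w)).word = decide (outPort n ε e c w = 2) :: (place n ε e w).word) ∨
    Crossing n ε e (c :: w) := by
  by_cases h0 : outPort n ε e c w = 0
  · obtain ⟨b, hb⟩ := H.climb_word (H.tail_mem hw) h0
    refine Or.inl ⟨h0, by rw [place_climb h0], b, by rw [place_climb h0]; exact hb, ?_⟩
    rw [place_climb h0]
    simp only
    rw [hb]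
    rfl
  · by_cases hl : (place n ε e w).word.length < n
    · exact Or.inr (Or.inl ⟨h0, by rw [place_down h0 hl], by rw [place_down h0 hl],
        by rw [place_down h0 hl]⟩)
    · exact Or.inr (Or.inr ⟨h0, hl⟩)

theorem Crossing.leaf {w : List Bool} (hc : Crossing n ε e w) :
    (place n ε e w).word.length = n := by
  rw [hc.word]
  exact (leafEquiv n _).2

/-- Position and direction of a step along the cycle. -/
theorem cross_left {c : Bool} {w : List Bool} (hn : 0 < n) (hc : Crossing n ε e (c :: w))
    (hs : (place n ε e w).side = false) :
    (outPort n ε e c w = 1 ∧ (place n ε e (c :: w)).cyc / 2 = (place n ε e w).cyc / 2) ∨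
    (outPort n ε e c w = 2 ∧ (place n ε e (c :: w)).cyc / 2 + 1 = (place n ε e w).cyc / 2) := by
  obtain ⟨a, ha⟩ := place_cyc_parity hn hc.tail_leaf
  have h0 := hc.1
  rw [place_cross hc, ha, hs]
  have : outPort n ε e c w = 1 ∨ outPort n ε e c w = 2 := by
    revert h0; generalize outPort n ε e c w = p; revert p; decide
  rcases this with h1 | h1
  · refine Or.inl ⟨h1, ?_⟩
    simp only [h1, dir, sideNum]
    norm_num
    omega
  · refine Or.inr ⟨h1, ?_⟩
    simp only [h1, dir, sideNum]
    norm_num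
    omega

theorem cross_right {c : Bool} {w : List Bool} (hn : 0 < n) (hc : Crossing n ε e (c :: w))
    (hs : (place n ε e w).side = true) :
    (outPort n ε e c w = 1 ∧ (place n ε e (c :: w)).cyc / 2 = (place n ε e w).cyc / 2) ∨
    (outPort n ε e c w = 2 ∧ (place n ε e (c :: w)).cyc / 2 = (place n ε e w).cyc / 2 + 1) := by
  obtain ⟨a, ha⟩ := place_cyc_parity hn hc.tail_leaf
  have h0 := hc.1
  rw [place_cross hc, ha, hs]
  have : outPort n ε e c w = 1 ∨ outPort n ε e c w = 2 := by
    revert h0; generalize outPort n ε e c w = p; revert p; decide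
  rcases this with h1 | h1
  · refine Or.inl ⟨h1, ?_⟩
    simp only [h1, dir, sideNum]
    norm_num
    omega
  · refine Or.inr ⟨h1, ?_⟩
    simp only [h1, dir, sideNum]
    norm_num
    omega

/-- The walks are walks in the graph. -/
theorem GoodWalk.adj (H : GoodWalk n ε e h T Q) (hZ : CycleOk ε e Q Z) {c : Bool} {w : List Bool}
    (hw : c :: w ∈ known Q) : (graph Z).Adj (vert n ε e w) (vert n ε e (c :: w)) := by
  have hn : 0 < n := by have := H.height; omega
  have hw' := H.tail_mem hw
  rw [graph, SimpleGraph.fromRel_adj]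
  refine ⟨fun heq => ?_, ?_⟩
  · have := congrArg List.length (H.vert_injOn hw' hw heq)
    simp at this
  rcases H.step_cases hw with ⟨-, hs, b, hb, -⟩ | ⟨-, hs, -, hb⟩ | hc
  · refine Or.inr ?_
    cases hs' : (place n ε e w).side
    · rw [vert_left (hs.trans hs'), vert_left hs']; exact ⟨b, hb⟩
    · rw [vert_right (hs.trans hs'), vert_right hs']; exact ⟨b, hb⟩
  · refine Or.inl ?_
    cases hs' : (place n ε e w).side
    · rw [vert_left (hs.trans hs'), vert_left hs']; exact ⟨_, hb⟩
    · rw [vert_right (hs.trans hs'), vert_right hs']; exact ⟨_, hb⟩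
  · have z1 := hZ w hw' hc.tail_leaf
    have z2 := hZ _ hw hc.leaf
    have hflip : (place n ε e (c :: w)).side = !(place n ε e w).side := by rw [place_cross hc]
    cases hs : (place n ε e w).side
    · rw [hs] at hflip z1
      rw [hflip] at z2
      refine Or.inl ?_
      rw [vert_left hs, vert_right hflip]
      refine ⟨cycIdx n ((place n ε e (c :: w)).cyc / 2), ?_, z2.symm⟩
      rcases cross_left hn hc hs with ⟨-, hq⟩ | ⟨-, hq⟩
      · exact Or.inl (by rw [hq]; exact z1.symm)
      · exact Or.inr (by rw [← cycIdx_add_one, hq]; exact z1.symm)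
    · rw [hs] at hflip z1
      rw [hflip] at z2
      refine Or.inr ?_
      rw [vert_right hs, vert_left hflip]
      refine ⟨cycIdx n ((place n ε e w).cyc / 2), ?_, z1.symm⟩
      rcases cross_right hn hc hs with ⟨-, hq⟩ | ⟨-, hq⟩
      · exact Or.inl (by rw [← hq]; exact z2.symm)
      · exact Or.inr (by rw [← cycIdx_add_one, ← hq]; exact z2.symm)

theorem entrance_neighbor (hn : 0 < n) {u : Vertex n} (hu : (graph Z).Adj (entrance n) u) :
    ∃ b, u = Sum.inl ⟨[b], hn⟩ := by
  rw [graph, SimpleGraph.fromRel_adj] at hu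
  rcases u with ⟨u, hl⟩ | ⟨u, hl⟩
  · rcases hu.2 with ⟨b, hb⟩ | ⟨b, hb⟩
    · exact ⟨b, congrArg Sum.inl (Subtype.ext hb)⟩
    · exact absurd hb.symm (List.cons_ne_nil _ _)
  · rcases hu.2 with ⟨i, hi | hi, -⟩ | hf
    · have := (Z.1 i).2
      rw [← hi] at this
      simp at this
      omega
    · have := (Z.1 (i + 1)).2
      rw [← hi] at this
      simp at this
      omega
    · exact hf.elim

/-- All neighbours of a queried vertex are known. -/
theorem GoodWalk.neighbor (H : GoodWalk n ε e h T Q) (hZ : CycleOk ε e Q Z) {w : List Bool}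
    (hw : w ∈ Q) {u : Vertex n} (hu : (graph Z).Adj (vert n ε e w) u) :
    (∃ c, u = vert n ε e (c :: w)) ∨ ∃ c v, w = c :: v ∧ u = vert n ε e v := by
  have hn : 0 < n := by have := H.height; omega
  have hk : ∀ c, c :: w ∈ known Q := fun c => cons_mem_known.mpr hw
  have a1 := H.adj hZ (hk false)
  have a2 := H.adj hZ (hk true)
  have n12 : vert n ε e (false :: w) ≠ vert n ε e (true :: w) := fun heq => by
    simpa using H.vert_injOn (hk false) (hk true) heq
  cases w with
  -- The ENTRANCE has only two neighbours, and its two children in the infinite tree already account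
  -- for them.
  | nil =>
    refine Or.inl ?_
    obtain ⟨b, rfl⟩ := entrance_neighbor hn hu
    obtain ⟨b1, h1⟩ := entrance_neighbor hn a1
    obtain ⟨b2, h2⟩ := entrance_neighbor hn a2
    rw [h1, h2] at n12
    by_cases hb : b = b1
    · exact ⟨false, by rw [h1, hb]⟩
    · refine ⟨true, ?_⟩
      rw [h2]
      have : b1 ≠ b2 := by rintro rfl; exact n12 rfl
      have : b = b2 := by cases b <;> cases b1 <;> cases b2 <;> simp_all
      rw [this]
  | cons c v =>
    have hwk := H.queried_known hw
    have hv := H.tail_mem hwk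
    have a3 := (H.adj hZ hwk).symm
    have n13 : vert n ε e (false :: c :: v) ≠ vert n ε e v := fun heq => by
      have := congrArg List.length (H.vert_injOn (hk false) hv heq)
      simp at this
      omega
    have n23 : vert n ε e (true :: c :: v) ≠ vert n ε e v := fun heq => by
      have := congrArg List.length (H.vert_injOn (hk true) hv heq)
      simp at this
      omega
    -- Degrees are at most three, and by injectivity the predecessor and the two children are three
    -- distinct neighbours.
    obtain ⟨x, y, z, hxyz⟩ := exists_three Z (vert n ε e (c :: v))
    have hsub : ({vert n ε e (false :: c :: v), vert n ε e (true :: c :: v), vert n ε e v} :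
        Finset (Vertex n)) ⊆ {x, y, z} := by
      intro t ht
      simp only [Finset.mem_insert, Finset.mem_singleton] at ht ⊢
      rcases ht with rfl | rfl | rfl
      · exact hxyz a1
      · exact hxyz a2
      · exact hxyz a3
    have heq := Finset.eq_of_subset_of_card_le hsub (by
      rw [Finset.card_eq_three.mpr ⟨_, _, _, n12, n13, n23, rfl⟩]
      exact Finset.card_le_three)
    have hmem : u ∈ ({x, y, z} : Finset (Vertex n)) := by
      have := hxyz hu
      simpa using this
    rw [← heq] at hmem
    simp only [Finset.mem_insert, Finset.mem_singleton] at hmem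
    rcases hmem with rfl | rfl | rfl
    · exact Or.inl ⟨_, rfl⟩
    · exact Or.inl ⟨_, rfl⟩
    · exact Or.inr ⟨c, v, rfl, rfl⟩

theorem column_vert (w : List Bool) : column (vert n ε e w) =
    if (place n ε e w).side then 2 * n + 1 - (place n ε e w).word.length
    else (place n ε e w).word.length := by
  cases hs : (place n ε e w).side
  · rw [vert_left hs]; rfl
  · rw [vert_right hs]; rfl

/-- Every step of the walk changes the column by one, also between the columns `n` and `n + 1` of
the leaves. The order of letter and digit in a colour can therefore be read off the word. -/
theorem GoodWalk.even_column (H : GoodWalk n ε e h T Q) {w : List Bool} (hw : w ∈ known Q) :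
    Even (column (vert n ε e w)) ↔ Even w.length := by
  induction w with
  | nil => simp [vert_nil, column, entrance]
  | cons c w ih =>
    have ih := ih (H.tail_mem hw)
    rw [List.length_cons, Nat.even_add_one, ← ih, ← Nat.even_add_one]
    have l1 := word_length_le (n := n) (ε := ε) (e := e) w
    have l2 := word_length_le (n := n) (ε := ε) (e := e) (c :: w)
    rw [column_vert, column_vert]
    rcases H.step_cases hw with ⟨-, hs, b, hb, -⟩ | ⟨-, hs, -, hb⟩ | hc
    · have hl := congrArg List.length hb
      rw [List.length_cons] at hl
      rw [hs, Nat.even_iff, Nat.even_iff]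
      split_ifs <;> omega
    · have hl := congrArg List.length hb
      rw [List.length_cons] at hl
      rw [hs, Nat.even_iff, Nat.even_iff]
      split_ifs <;> omega
    · rw [hc.tail_leaf, hc.leaf, show (place n ε e (c :: w)).side = !(place n ε e w).side by
        rw [place_cross hc]]
      cases (place n ε e w).side <;> simp only [Nat.even_iff] <;> simp <;> omega

/-- The colouring gives the prescribed labels to the known edges. -/
structure LabelOk (d : List Bool → Fin 3) (ε : List Bool → Bool) (e : List Bool → Fin (2 ^ n))
    (Q : Finset (List Bool)) (v : Vertex n) (g : (graph Z).neighborSet v ↪ Fin 3) : Prop where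
  parent : ∀ c w, c :: w ∈ known Q → v = vert n ε e (c :: w) →
    ∀ u (hu : (graph Z).Adj v u), u = vert n ε e w → g ⟨u, hu⟩ = d (c :: w)
  child : ∀ c w, w ∈ Q → v = vert n ε e w →
    ∀ u (hu : (graph Z).Adj v u), u = vert n ε e (c :: w) → g ⟨u, hu⟩ = d w + slot c

/-- The naming gives the prescribed names to the known vertices and uses no guessed name. -/
structure NameOk (x : List Bool → Name n) (ε : List Bool → Bool) (e : List Bool → Fin (2 ^ n))
    (Q : Finset (List Bool)) (G : Finset (Name n)) (f : Naming n) : Prop where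
  name : ∀ w ∈ known Q, f.1 (vert n ε e w) = nameOf x w
  guess : ∀ v, f.1 v ∉ G

variable {d : List Bool → Fin 3} {x : List Bool → Name n} {G : Finset (Name n)}
  {C : Coloring Z} {f : Naming n}

/-- The neighbours of a queried vertex are exactly its parent and children in the infinite tree, and
compatibility prescribes their names and both labels of each joining edge. -/
theorem GoodWalk.oracle_eq (H : GoodWalk n ε e h T Q) (hZ : CycleOk ε e Q Z)
    (hC : ∀ v, LabelOk d ε e Q v (C v)) (hf : NameOk x ε e Q G f) {w : List Bool} (hw : w ∈ Q) :
    oracle C f (nameOf x w) = idealAnswer d x w := by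
  have hwk := H.queried_known hw
  have hchild : ∀ c (hu : (graph Z).Adj (vert n ε e w) (vert n ε e (c :: w))),
      edgeColor C hu = mkColor (decide (Even w.length)) (d w + slot c) (d (c :: w)) := by
    intro c hu
    rw [edgeColor, mkColor, (hC _).child c w hw rfl _ hu rfl,
      (hC _).parent c w (cons_mem_known.mpr hw) rfl _ hu.symm rfl]
    simp only [H.even_column hwk, decide_eq_true_eq]
  have hparent : ∀ c v, w = c :: v → ∀ hu : (graph Z).Adj (vert n ε e w) (vert n ε e v),
      edgeColor C hu = mkColor (decide (Even w.length)) (d w) (d v + slot c) := by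
    rintro c v rfl hu
    rw [edgeColor, mkColor, (hC _).parent c v hwk rfl _ hu rfl,
      (hC _).child c v (cons_mem_known.mp hwk) rfl _ hu.symm rfl]
    simp only [H.even_column hwk, decide_eq_true_eq]
  ext p
  constructor
  · rintro ⟨v, u, hu, hv, rfl⟩
    rw [← hf.name w hwk] at hv
    obtain rfl := f.1.injective hv
    rcases H.neighbor hZ hw hu with ⟨c, rfl⟩ | ⟨c, v, hcv, rfl⟩
    · exact Or.inl ⟨c, by rw [hchild c hu, hf.name _ (cons_mem_known.mpr hw)]⟩
    · exact Or.inr ⟨c, v, hcv, by rw [hparent c v hcv hu, hf.name v (H.tail_mem (hcv ▸ hwk))]⟩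
  · rintro (⟨c, rfl⟩ | ⟨c, v, hcv, rfl⟩)
    · have ha := H.adj hZ (cons_mem_known (c := c).mpr hw)
      exact ⟨_, _, ha, hf.name w hwk,
        by rw [hchild c ha, hf.name _ (cons_mem_known.mpr hw)]⟩
    · have ha : (graph Z).Adj (vert n ε e w) (vert n ε e v) := by
        subst hcv
        exact (H.adj hZ hwk).symm
      exact ⟨_, _, ha, hf.name w hwk, by
        rw [hparent c v hcv ha, hf.name v (H.tail_mem (hcv ▸ hwk))]⟩

theorem oracle_eq_empty {a : Name n} (ha : ∀ v, f.1 v ≠ a) : oracle C f a = ∅ := by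
  refine Set.eq_empty_of_forall_notMem ?_
  rintro p ⟨v, u, hu, hv, -⟩
  exact ha v hv

variable {A : Algorithm n}

theorem transcript_none {O : Name n → Answer n} {k : ℕ} (hA : A (transcript A O k) = none) :
    transcript A O (k + 1) = transcript A O k := by
  rw [transcript, hA]

theorem transcript_some {O : Name n → Answer n} {k : ℕ} {a : Name n}
    (hA : A (transcript A O k) = some a) :
    transcript A O (k + 1) = transcript A O k ++ [(a, O a)] := by
  rw [transcript, hA]

/-- The real run is the simulated one. -/
theorem GoodWalk.transcript_eq (H : GoodWalk n ε e h T (idealRun A d x T).queried)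
    (hx : Fresh x (idealRun A d x T)) (hZ : CycleOk ε e (idealRun A d x T).queried Z)
    (hC : ∀ v, LabelOk d ε e (idealRun A d x T).queried v (C v))
    (hf : NameOk x ε e (idealRun A d x T).queried (idealRun A d x T).guesses f)
    {k : ℕ} (hk : k ≤ T) : transcript A (oracle C f) k = (idealRun A d x k).log := by
  induction k with
  | zero => rfl
  | succ k ih =>
    have ih := ih (by omega)
    cases hA : A (idealRun A d x k).log with
    | none => rw [transcript_none (ih ▸ hA), idealRun_none hA, ih]
    | some a =>
      rw [transcript_some (ih ▸ hA), idealRun_some hA, ih]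
      by_cases hh : ∃ w, Hits x (idealRun A d x k) a w
      · obtain ⟨w, hw⟩ := hh
        have hstep := Run.step_hit (d := d) hw (hx.inj.mono (by
          exact_mod_cast known_mono (idealRun_queried_mono (by omega))))
        have hwQ : w ∈ (idealRun A d x T).queried := by
          refine idealRun_queried_mono hk ?_
          rw [idealRun_some hA, hstep]
          exact Finset.mem_insert_self _ _
        rw [hstep, ← hw.2, H.oracle_eq hZ hC hf hwQ]
      -- A query that hits no known name is recorded as a guess, and a compatible naming uses no
      -- guess.
      · have hg : a ∈ (idealRun A d x T).guesses := by
          refine idealRun_guesses_mono hk ?_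
          rw [idealRun_some hA, Run.step, dif_neg hh]
          exact Finset.mem_insert_self _ _
        rw [Run.step, dif_neg hh, oracle_eq_empty]
        rintro v rfl
        exact hf.guess v hg

theorem idealRun_log_mem (hx : Fresh x (idealRun A d x T)) {k : ℕ} (hk : k ≤ T)
    {q : Name n × Answer n} (hq : q ∈ (idealRun A d x k).log) :
    (∃ w ∈ (idealRun A d x T).queried, q.1 = nameOf x w) ∨ q.1 ∈ (idealRun A d x T).guesses := by
  induction k with
  | zero => simp [idealRun] at hq
  | succ k ih =>
    cases hA : A (idealRun A d x k).log with
    | none => rw [idealRun_none hA] at hq; exact ih (by omega) hq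
    | some a =>
      have hm := idealRun_queried_mono (A := A) (d := d) (x := x) hk
      have hm' := idealRun_guesses_mono (A := A) (d := d) (x := x) hk
      rw [idealRun_some hA] at hq hm hm'
      by_cases hh : ∃ w, Hits x (idealRun A d x k) a w
      · obtain ⟨w, hw⟩ := hh
        have hstep := Run.step_hit (d := d) hw (hx.inj.mono (by
          exact_mod_cast known_mono (idealRun_queried_mono (by omega))))
        rw [hstep] at hq hm
        rcases List.mem_append.mp hq with hq | hq
        · exact ih (by omega) hq
        · rw [List.mem_singleton.mp hq]
          exact Or.inl ⟨w, hm (Finset.mem_insert_self _ _), hw.2.symm⟩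
      · rw [Run.step, dif_neg hh] at hq hm'
        rcases List.mem_append.mp hq with hq | hq
        · exact ih (by omega) hq
        · rw [List.mem_singleton.mp hq]
          exact Or.inr (hm' (Finset.mem_insert_self _ _))

/-- Until the algorithm stops, every step adds an entry. It has stopped by step `T`, as the next
step would otherwise produce `T + 1` entries. -/
theorem transcript_eq_of_length_le {O : Name n → Answer n}
    (hlen : ∀ k, (transcript A O k).length ≤ T) {k : ℕ} (hk : T ≤ k) :
    transcript A O k = transcript A O T := by
  have h1 : ∀ k, A (transcript A O k) = none ∨ (transcript A O k).length = k := by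
    intro k
    induction k with
    | zero => exact Or.inr rfl
    | succ k ih =>
      cases hA : A (transcript A O k) with
      | none => rw [transcript_none hA]; exact Or.inl hA
      | some a =>
        right
        rw [transcript_some hA, List.length_append, ih.resolve_left (by rw [hA]; simp)]
        rfl
  have h2 : A (transcript A O T) = none := by
    cases hA : A (transcript A O T) with
    | none => rfl
    | some a =>
      have := hlen (T + 1)
      rw [transcript_some hA, List.length_append, (h1 T).resolve_left (by rw [hA]; simp)] at this
      simp at this
  induction k, hk using Nat.le_induction with
  | base => rfl
  | succ k _ ih => rw [transcript_none (ih ▸ h2), ih]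

/-- Each query is the name of a known vertex, hence not of the EXIT, or a guess that names no
vertex. -/
theorem GoodWalk.not_wins (H : GoodWalk n ε e h T (idealRun A d x T).queried)
    (hx : Fresh x (idealRun A d x T)) (hZ : CycleOk ε e (idealRun A d x T).queried Z)
    (hC : ∀ v, LabelOk d ε e (idealRun A d x T).queried v (C v))
    (hf : NameOk x ε e (idealRun A d x T).queried (idealRun A d x T).guesses f)
    (hlen : ∀ k, (transcript A (oracle C f) k).length ≤ T) : ¬ Wins A C f := by
  rintro ⟨k, q, hq, hqe⟩
  have hmin : q ∈ transcript A (oracle C f) (min k T) := by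
    rcases le_total k T with hk | hk
    · rwa [min_eq_left hk]
    · rwa [min_eq_right hk, ← transcript_eq_of_length_le hlen hk]
  rw [H.transcript_eq hx hZ hC hf (min_le_right _ _)] at hmin
  rcases idealRun_log_mem hx (min_le_right _ _) hmin with ⟨w, hw, hqw⟩ | hg
  · have hwk := H.queried_known hw
    rw [hqe, ← hf.name w hwk] at hqw
    exact H.vert_ne_exit hwk (f.1.injective hqw).symm
  · rw [hqe] at hg
    exact hf.guess _ hg

end Simulation

/-! ### Recovering the used choices of the simulation from a world. -/

section Decoding

open Classical

variable {n : ℕ} {Z : LeafCycle n} {C : Coloring Z} {f : Naming n} {h T : ℕ}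
  {d d' : List Bool → Fin 3} {ε ε' : List Bool → Bool} {x x' : List Bool → Name n}
  {e e' : List Bool → Fin (2 ^ n)} {Q Q' : Finset (List Bool)} {G G' : Finset (Name n)}

/-- Two sets of choices lead to the same known vertex. -/
structure AgreeAt (n : ℕ) (d d' : List Bool → Fin 3) (ε ε' : List Bool → Bool)
    (x x' : List Bool → Name n) (e e' : List Bool → Fin (2 ^ n)) (w : List Bool) : Prop where
  side : (place n ε e w).side = (place n ε' e' w).side
  word : (place n ε e w).word = (place n ε' e' w).word
  port : (place n ε e w).port = (place n ε' e' w).port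
  name : nameOf x w = nameOf x' w
  label : w ≠ [] → d w = d' w
  leaf : (place n ε e w).word.length = n → e w = e' w

theorem AgreeAt.vert {w : List Bool} (H : AgreeAt n d d' ε ε' x x' e e' w) :
    vert n ε e w = vert n ε' e' w :=
  vert_eq_iff.mpr ⟨H.side, H.word⟩

/-- Each leaf occurs only once in the ordering of its side, so the common cycle fixes its position.
-/
theorem CycleOk.cyc_eq (hZ : CycleOk ε e Q Z) (hZ' : CycleOk ε' e' Q' Z) {w : List Bool}
    (hw : w ∈ known Q) (hw' : w ∈ known Q')
    (hs : (place n ε e w).side = (place n ε' e' w).side)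
    (hword : (place n ε e w).word = (place n ε' e' w).word)
    (hl : (place n ε e w).word.length = n) :
    (place n ε e w).cyc / 2 ≡ (place n ε' e' w).cyc / 2 [ZMOD 2 ^ n] := by
  have z1 := hZ w hw hl
  have z2 := hZ' w hw' (hword ▸ hl)
  rw [← hs, ← hword, ← z1] at z2
  exact cycIdx_eq_iff.mp (Equiv.injective _ (Subtype.ext z2)).symm

/-- The out-port is determined by the vertices before and after the step. -/
theorem GoodWalk.outPort_eq (H : GoodWalk n ε e h T Q) (H' : GoodWalk n ε' e' h T Q')
    (hZ : CycleOk ε e Q Z) (hZ' : CycleOk ε' e' Q' Z) {c : Bool} {w : List Bool}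
    (hw : c :: w ∈ known Q) (hw' : c :: w ∈ known Q')
    (hv : GluedTrees.vert n ε e w = GluedTrees.vert n ε' e' w)
    (hv' : GluedTrees.vert n ε e (c :: w) = GluedTrees.vert n ε' e' (c :: w)) :
    outPort n ε e c w = outPort n ε' e' c w ∧
      (place n ε e (c :: w)).port = (place n ε' e' (c :: w)).port := by
  have hn : 0 < n := by have := H.height; omega
  obtain ⟨hs, hword⟩ := vert_eq_iff.mp hv
  obtain ⟨hs', hword'⟩ := vert_eq_iff.mp hv'
  have hlen := congrArg List.length hword
  have hlen' := congrArg List.length hword'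
  have flip : ∀ {ε e}, Crossing n ε e (c :: w) →
      (place n ε e (c :: w)).side = !(place n ε e w).side := fun hc => by rw [place_cross hc]
  rcases H.step_cases hw with ⟨o1, s1, b1, w1, p1⟩ | ⟨o1, s1, p1, w1⟩ | c1 <;>
  rcases H'.step_cases hw' with ⟨o2, s2, b2, w2, p2⟩ | ⟨o2, s2, p2, w2⟩ | c2
  · refine ⟨o1.trans o2.symm, ?_⟩
    rw [hword, w2] at w1
    rw [p1, p2, (List.cons.inj w1).1]
  · have l1 := congrArg List.length w1
    have l2 := congrArg List.length w2
    rw [List.length_cons] at l1 l2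
    omega
  · rw [flip c2, ← hs, ← s1] at hs'
    simp at hs'
  · have l1 := congrArg List.length w1
    have l2 := congrArg List.length w2
    rw [List.length_cons] at l1 l2
    omega
  · refine ⟨?_, p1.trans p2.symm⟩
    rw [hword', w2] at w1
    have := congrArg slot (List.cons.inj w1).1
    rwa [slot_decide o1, slot_decide o2, eq_comm] at this
  · rw [flip c2, ← hs, ← s1] at hs'
    simp at hs'
  · rw [flip c1, hs, ← s2] at hs'
    simp at hs'
  · rw [flip c1, hs, ← s2] at hs'
    simp at hs'
  · have hp : ∀ {ε e}, Crossing n ε e (c :: w) → (place n ε e (c :: w)).port = outPort n ε e c w :=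
      fun hc => by rw [place_cross hc]
    rw [hp c1, hp c2, and_self]
    have q1 := hZ.cyc_eq hZ' (H.tail_mem hw) (H'.tail_mem hw') hs hword c1.tail_leaf
    have q2 := hZ.cyc_eq hZ' hw hw' hs' hword' c1.leaf
    -- Modulo `2 ^ n ≥ 2`, the two cycle neighbours of a leaf have different positions; so the
    -- neighbour reached determines the port.
    have no : ∀ {a b : ℤ}, a ≡ b [ZMOD 2 ^ n] → ¬ a ≡ b + 1 [ZMOD 2 ^ n] := by
      intro a b h1 h2
      have h3 := (h1.symm.trans h2).dvd
      rw [add_sub_cancel_left] at h3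
      have h4 := (Int.isUnit_iff.mp (isUnit_of_dvd_one h3))
      have h5 : (2 : ℤ) ^ 1 ≤ 2 ^ n := pow_le_pow_right₀ (by norm_num) hn
      omega
    cases hs0 : (place n ε e w).side
    · rcases cross_left hn c1 hs0 with ⟨o1, r1⟩ | ⟨o1, r1⟩ <;>
      rcases cross_left hn c2 (hs ▸ hs0) with ⟨o2, r2⟩ | ⟨o2, r2⟩
      · rw [o1, o2]
      · rw [r1] at q2
        rw [← r2] at q1
        exact absurd q1 (no q2)
      · rw [r2] at q2
        rw [← r1] at q1
        exact absurd q1.symm (no q2.symm)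
      · rw [o1, o2]
    · rcases cross_right hn c1 hs0 with ⟨o1, r1⟩ | ⟨o1, r1⟩ <;>
      rcases cross_right hn c2 (hs ▸ hs0) with ⟨o2, r2⟩ | ⟨o2, r2⟩
      · rw [o1, o2]
      · rw [r1, r2] at q2
        exact absurd q2 (no q1)
      · rw [r1, r2] at q2
        exact absurd q2.symm (no q1.symm)
      · rw [o1, o2]

/-- Agreement at a queried vertex extends to its children. -/
theorem AgreeAt.step (H : GoodWalk n ε e h T Q) (H' : GoodWalk n ε' e' h T Q')
    (hZ : CycleOk ε e Q Z) (hZ' : CycleOk ε' e' Q' Z)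
    (hC : ∀ v, LabelOk d ε e Q v (C v)) (hC' : ∀ v, LabelOk d' ε' e' Q' v (C v))
    (hf : NameOk x ε e Q G f) (hf' : NameOk x' ε' e' Q' G' f) {w : List Bool}
    (hw : w ∈ Q) (hw' : w ∈ Q') (hag : AgreeAt n d d' ε ε' x x' e e' w) :
    d w = d' w ∧ ε w = ε' w ∧ ∀ c, AgreeAt n d d' ε ε' x x' e e' (c :: w) := by
  have hn : 0 < n := by have := H.height; omega
  have hk : ∀ c, c :: w ∈ known Q := fun c => cons_mem_known.mpr hw
  have hk' : ∀ c, c :: w ∈ known Q' := fun c => cons_mem_known.mpr hw'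
  have hv := hag.vert
  have hadj' : ∀ c, (graph Z).Adj (GluedTrees.vert n ε e w) (GluedTrees.vert n ε' e' (c :: w)) :=
    fun c => hv ▸ H'.adj hZ' (hk' c)
  have hlab' : ∀ c, C (GluedTrees.vert n ε e w) ⟨_, hadj' c⟩ = d' w + slot c :=
    fun c => (hC' _).child c w hw' hv _ (hadj' c) rfl
  have hlab : ∀ c, C (GluedTrees.vert n ε e w) ⟨_, H.adj hZ (hk c)⟩ = d w + slot c :=
    fun c => (hC _).child c w hw rfl _ _ rfl
  have hd : d w = d' w := by
    -- At the root no label towards a parent is visible. There `d w` is the one label that neither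
    -- neighbour receives.
    by_cases h0 : w = []
    · have hne : ∀ c, d' w + slot c ≠ d w := by
        intro c
        rw [← hlab' c]
        rcases H.neighbor hZ hw (hadj' c) with ⟨b, hb⟩ | ⟨b, v, hb, -⟩
        · rw [(hC _).child b w hw rfl _ (hadj' c) hb]
          intro hcon
          exact slot_ne_zero b (by simpa using hcon)
        · rw [h0] at hb
          exact absurd hb.symm (List.cons_ne_nil _ _)
      have a1 := hne false
      have a2 := hne true
      revert a1 a2
      generalize d w = p
      generalize d' w = q
      revert p q
      decide
    · exact hag.label h0
  -- The child `c` is the neighbour labelled `d w + slot c`, and labels at a vertex are distinct.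
  -- Its position then reveals the out-port, hence the coin.
  have hvc : ∀ c, GluedTrees.vert n ε e (c :: w) = GluedTrees.vert n ε' e' (c :: w) := by
    intro c
    have : C (GluedTrees.vert n ε e w) ⟨_, H.adj hZ (hk c)⟩ =
        C (GluedTrees.vert n ε e w) ⟨_, hadj' c⟩ := by rw [hlab, hlab', hd]
    exact congrArg Subtype.val ((C _).injective this)
  have hout := fun c => H.outPort_eq H' hZ hZ' (hk c) (hk' c) hv (hvc c)
  refine ⟨hd, ?_, fun c => ?_⟩
  · have := (hout false).1
    unfold outPort at this
    rw [hag.port] at this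
    simpa using slot_injective (add_left_cancel this)
  · obtain ⟨hs, hword⟩ := vert_eq_iff.mp (hvc c)
    refine ⟨hs, hword, (hout c).2, ?_, fun _ => ?_, fun hl => ?_⟩
    · rw [← hf.name _ (hk c), ← hf'.name _ (hk' c), hvc c]
    · have ha := (H.adj hZ (hk c)).symm
      rw [← (hC _).parent c w (hk c) rfl _ ha rfl, (hC' _).parent c w (hk' c) (hvc c) _ ha hv]
    · have hcross : Crossing n ε e (c :: w) ↔ Crossing n ε' e' (c :: w) := by
        rw [Crossing, Crossing, (hout c).1, hag.word]
      -- After a crossing `e` is the leaf itself; after a descent it is the position of the leaf on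
      -- the cycle.
      by_cases hc : Crossing n ε e (c :: w)
      · have := hword
        rw [hc.word, (hcross.mp hc).word] at this
        exact (leafEquiv n).injective (Subtype.ext this)
      · have q := hZ.cyc_eq hZ' (hk c) (hk' c) hs hword hl
        rw [(place_leaf_of_not_crossing hn hl hc).2,
          (place_leaf_of_not_crossing hn (hword ▸ hl) (fun h => hc (hcross.mpr h))).2,
          sideNum_div, sideNum_div, ← cycIdx_eq_iff, cycIdx_coe, cycIdx_coe] at q
        exact q

theorem agreeAt_nil (hn : 0 < n) : AgreeAt n d d' ε ε' x x' e e' [] :=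
  ⟨rfl, rfl, rfl, rfl, fun h => absurd rfl h, fun h => by simp [place] at h; omega⟩

/-- A world determines all the choices that a compatible simulation has used. -/
theorem agree_of_compat {A : Algorithm n} (H : GoodWalk n ε e h T (idealRun A d x T).queried)
    (H' : GoodWalk n ε' e' h T (idealRun A d' x' T).queried)
    (hZ : CycleOk ε e (idealRun A d x T).queried Z)
    (hZ' : CycleOk ε' e' (idealRun A d' x' T).queried Z)
    (hC : ∀ v, LabelOk d ε e (idealRun A d x T).queried v (C v))
    (hC' : ∀ v, LabelOk d' ε' e' (idealRun A d' x' T).queried v (C v))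
    (hf : NameOk x ε e (idealRun A d x T).queried G f)
    (hf' : NameOk x' ε' e' (idealRun A d' x' T).queried G' f) :
    idealRun A d x T = idealRun A d' x' T ∧
    (∀ w ∈ (idealRun A d x T).queried, d w = d' w ∧ ε w = ε' w) ∧
    ∀ w ∈ known (idealRun A d x T).queried, AgreeAt n d d' ε ε' x x' e e' w := by
  have hn : 0 < n := by have := H.height; omega
  have key : ∀ w, w ∈ known (idealRun A d x T).queried → w ∈ known (idealRun A d' x' T).queried →
      AgreeAt n d d' ε ε' x x' e e' w := by
    intro w
    induction w with
    | nil => exact fun _ _ => agreeAt_nil hn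
    | cons c w ih =>
      intro hw hw'
      exact (AgreeAt.step H H' hZ hZ' hC hC' hf hf' (cons_mem_known.mp hw) (cons_mem_known.mp hw')
        (ih (H.tail_mem hw) (H'.tail_mem hw'))).2.2 c
  have both : ∀ w, w ∈ (idealRun A d x T).queried → w ∈ (idealRun A d' x' T).queried →
      d w = d' w ∧ ε w = ε' w := by
    intro w hw hw'
    have h1 := AgreeAt.step H H' hZ hZ' hC hC' hf hf' hw hw'
      (key w (H.queried_known hw) (H'.queried_known hw'))
    exact ⟨h1.1, h1.2.1⟩
  -- Equal runs up to step `k` know the same names, so they query the same word next; decoding at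
  -- this word then makes the whole step agree.
  have run : ∀ k ≤ T, idealRun A d x k = idealRun A d' x' k := by
    intro k
    induction k with
    | zero => exact fun _ => rfl
    | succ k ih =>
      intro hk
      have ih := ih (by omega)
      have hm := idealRun_queried_mono (A := A) (d := d) (x := x) (show k ≤ T by omega)
      have hm' := idealRun_queried_mono (A := A) (d := d') (x := x') (show k ≤ T by omega)
      have hnames : ∀ w ∈ known (idealRun A d x k).queried, nameOf x w = nameOf x' w :=
        fun w hw => (key w (known_mono hm hw) (known_mono hm' (ih ▸ hw))).name
      have hq : (idealRun A d x (k + 1)).queried = (idealRun A d' x' (k + 1)).queried := by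
        cases hA : A (idealRun A d x k).log with
        | none => rw [idealRun_none hA, idealRun_none (ih ▸ hA), ih]
        | some a =>
          rw [idealRun_some hA, idealRun_some (ih ▸ hA), ← ih]
          exact Run.step_queried_congr hnames
      have hm1 := idealRun_queried_mono (A := A) (d := d) (x := x) hk
      have hm1' := idealRun_queried_mono (A := A) (d := d') (x := x') hk
      have ag : ∀ w ∈ known (idealRun A d x (k + 1)).queried,
          AgreeAt n d d' ε ε' x x' e e' w :=
        fun w hw => key w (known_mono hm1 hw) (known_mono hm1' (hq ▸ hw))
      refine idealRun_congr (fun w hw h0 => ?_) fun w hw => (ag w hw).name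
      by_cases hw0 : w = []
      · have h1 := h0 hw0
        rw [hw0]
        exact (both [] (hm1 h1) (hm1' (hq ▸ h1))).1
      · exact (ag w hw).label hw0
  have hrun := run T le_rfl
  exact ⟨hrun, fun w hw => both w hw (hrun ▸ hw), fun w hw => key w hw (hrun ▸ hw)⟩

end Decoding

/-! ### The share of cycles, colourings and namings that fit given choices. -/

section Compatible

open Finset Classical

variable {n : ℕ} {Z : LeafCycle n} {h T : ℕ} {d : List Bool → Fin 3} {ε : List Bool → Bool}
  {x : List Bool → Name n} {e : List Bool → Fin (2 ^ n)} {Q : Finset (List Bool)}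
  {G : Finset (Name n)}

variable (n ε e Q) in
/-- The known words at which the walk is at a leaf. -/
noncomputable def leafWords : Finset (List Bool) :=
  (known Q).filter fun w => (place n ε e w).word.length = n

/-- On each side the cycle condition pins an ordering at distinct positions (`Tame.cyc_injOn`) to
distinct leaves (`Tame.injOn`), so `card_pinned` applies, and the two orderings are independent. -/
theorem GoodWalk.card_cycleOk (H : GoodWalk n ε e h T Q) :
    Fintype.card (LeafCycle n) ≤ (2 ^ n) ^ (leafWords n ε e Q).card *
      (univ.filter fun Z : LeafCycle n => CycleOk ε e Q Z).card := by
  have hinh : Nonempty (Leaf n) := ⟨leafEquiv n (cycIdx n 0)⟩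
  let a : List Bool → Fin (2 ^ n) := fun w => cycIdx n ((place n ε e w).cyc / 2)
  let b : List Bool → Leaf n := fun w =>
    if hl : (place n ε e w).word.length = n then ⟨(place n ε e w).word, hl⟩
    else Classical.arbitrary _
  let J : Bool → Finset (List Bool) := fun s =>
    (leafWords n ε e Q).filter fun w => (place n ε e w).side = s
  let ev : (Fin (2 ^ n) ≃ Leaf n) → Fin (2 ^ n) → Leaf n := fun σ => σ
  have hJ : ∀ {s w}, w ∈ J s → w ∈ known Q ∧ (place n ε e w).word.length = n ∧
      (place n ε e w).side = s := by
    intro s w hw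
    obtain ⟨hw, hs⟩ := mem_filter.mp hw
    exact ⟨(mem_filter.mp hw).1, (mem_filter.mp hw).2, hs⟩
  have hpin : ∀ s, Fintype.card (Fin (2 ^ n) ≃ Leaf n) ≤
      (2 ^ n) ^ (J s).card * (pinned ev a b (J s)).card := by
    intro s
    have := card_pinned ev (fun y y' σ => σ.trans (Equiv.swap y y')) DFunLike.coe_injective
      (fun σ => σ.injective) (fun y y' σ i => rfl) a b ∅ (J s) (disjoint_empty_left _) ?_ ?_
    · rw [empty_union, card_leaf] at this
      refine le_trans (le_of_eq ?_) this
      simp [pinned, card_univ]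
    · rw [empty_union]
      intro w hw w' hw' heq
      obtain ⟨k1, l1, s1⟩ := hJ hw
      obtain ⟨k2, l2, s2⟩ := hJ hw'
      exact H.tame.cyc_injOn H.height H.suffix_closed H.length_le H.small k1 k2 l1 l2
        (s1.trans s2.symm) (cycIdx_eq_iff.mp heq)
    · rw [empty_union]
      intro w hw w' hw' heq
      obtain ⟨k1, l1, s1⟩ := hJ hw
      obtain ⟨k2, l2, s2⟩ := hJ hw'
      simp only [b, dif_pos l1, dif_pos l2] at heq
      exact H.tame.injOn H.height H.suffix_closed k1 k2 (congrArg Subtype.val heq)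
  have hsub : pinned ev a b (J false) ×ˢ pinned ev a b (J true) ⊆
      univ.filter fun Z : LeafCycle n => CycleOk ε e Q Z := by
    rintro ⟨Z1, Z2⟩ hZ
    simp only [mem_product, pinned, mem_filter, mem_univ, true_and] at hZ ⊢
    intro w hw hl
    have hb : (b w).1 = (place n ε e w).word := by simp only [b, dif_pos hl]
    cases hs : (place n ε e w).side
    · rw [← hb, ← hZ.1 w (mem_filter.mpr ⟨mem_filter.mpr ⟨hw, hl⟩, hs⟩)]
      rfl
    · rw [← hb, ← hZ.2 w (mem_filter.mpr ⟨mem_filter.mpr ⟨hw, hl⟩, hs⟩)]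
      rfl
  have hcard : (leafWords n ε e Q).card = (J false).card + (J true).card := by
    have := card_filter_add_card_filter_not (s := leafWords n ε e Q)
      (fun w => (place n ε e w).side = false)
    rw [← this]
    congr 2
    refine filter_congr fun w _ => ?_
    simp
  rw [Fintype.card_prod, hcard, pow_add]
  refine (Nat.mul_le_mul (hpin false) (hpin true)).trans ?_
  have := card_le_card hsub
  rw [card_product] at this
  refine le_trans (le_of_eq ?_) (Nat.mul_le_mul_left _ this)
  ring

variable (Q) in
/-- The known words whose label towards the parent is visible. -/
noncomputable def labelWords : Finset (List Bool) :=
  (known Q).filter fun w => w ≠ [] ∨ w ∈ Q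

theorem card_embedding_le_six (v : Vertex n) :
    Nat.card ((graph Z).neighborSet v ↪ Fin 3) ≤ 6 := by
  have := Fintype.ofFinite ((graph Z).neighborSet v)
  rw [Nat.card_eq_fintype_card, Fintype.card_embedding_eq, Fintype.card_fin]
  generalize Fintype.card ((graph Z).neighborSet v) = k
  rcases lt_or_ge k 4 with hk | hk
  · interval_cases k <;> decide
  · rw [Nat.descFactorial_of_lt (by omega)]
    omega

/-- A queried vertex has a labelling as prescribed. -/
theorem GoodWalk.exists_label (H : GoodWalk n ε e h T Q) (hZ : CycleOk ε e Q Z)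
    (d : List Bool → Fin 3) {w : List Bool} (hw : w ∈ Q) :
    ∃ g : (graph Z).neighborSet (vert n ε e w) ↪ Fin 3, LabelOk d ε e Q _ g := by
  have hwk := H.queried_known hw
  have hk : ∀ c, c :: w ∈ known Q := fun c => cons_mem_known.mpr hw
  have n12 : vert n ε e (true :: w) ≠ vert n ε e (false :: w) := fun heq => by
    simpa using H.vert_injOn (hk true) (hk false) heq
  have n3 : ∀ c b v, w = b :: v → vert n ε e v ≠ vert n ε e (c :: w) := by
    rintro c b v rfl heq
    have := congrArg List.length (H.vert_injOn (H.tail_mem hwk) (hk c) heq)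
    simp at this
    omega
  let g : (graph Z).neighborSet (vert n ε e w) → Fin 3 := fun u =>
    if u.1 = vert n ε e (false :: w) then d w + 1
    else if u.1 = vert n ε e (true :: w) then d w + 2 else d w
  have gc : ∀ c (u : (graph Z).neighborSet (vert n ε e w)), u.1 = vert n ε e (c :: w) →
      g u = d w + slot c := by
    intro c u hu
    cases c
    · simp only [g, hu, if_true]; rfl
    · simp only [g, hu, if_neg n12, if_true]; rfl
  have gp : ∀ b v (u : (graph Z).neighborSet (vert n ε e w)), w = b :: v → u.1 = vert n ε e v →
      g u = d w := by
    intro b v u hv hu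
    simp only [g, hu, if_neg (n3 _ b v hv)]
  have hinj : Function.Injective g := by
    intro u u' huu
    have slot0 : ∀ c, d w + slot c ≠ d w := fun c hc => slot_ne_zero c (by simpa using hc)
    rcases H.neighbor hZ hw u.2 with ⟨c, hc⟩ | ⟨b, v, hv, hc⟩ <;>
    rcases H.neighbor hZ hw u'.2 with ⟨c', hc'⟩ | ⟨b', v', hv', hc'⟩
    · rw [gc c u hc, gc c' u' hc'] at huu
      have := slot_injective (add_left_cancel huu)
      exact Subtype.ext (by rw [hc, hc', this])
    · rw [gc c u hc, gp b' v' u' hv' hc'] at huu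
      exact absurd huu (slot0 c)
    · rw [gp b v u hv hc, gc c' u' hc'] at huu
      exact absurd huu.symm (slot0 c')
    · rw [hv] at hv'
      exact Subtype.ext (by rw [hc, hc', (List.cons.inj hv').2])
  refine ⟨⟨g, hinj⟩, ⟨fun c u hcu hv t ht htu => ?_, fun c u hu hv t ht htu => ?_⟩⟩
  · have hwu := H.vert_injOn hwk hcu hv
    change g ⟨t, ht⟩ = _
    rw [gp c u ⟨t, ht⟩ hwu htu, hwu]
  · have hwu := H.vert_injOn hwk (H.queried_known hu) hv
    subst hwu
    exact gc c ⟨t, ht⟩ htu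

/-- The share of the labellings of a vertex that are as prescribed. -/
theorem GoodWalk.card_labelOk_at (H : GoodWalk n ε e h T Q) (hZ : CycleOk ε e Q Z)
    (d : List Bool → Fin 3) (v : Vertex n) :
    Nat.card ((graph Z).neighborSet v ↪ Fin 3) ≤
      (∏ w ∈ known Q with vert n ε e w = v,
        (if w ≠ [] ∨ w ∈ Q then 3 else 1) * (if w ∈ Q then 2 else 1)) *
      Nat.card {g : (graph Z).neighborSet v ↪ Fin 3 // LabelOk d ε e Q v g} := by
  by_cases hv : ∃ w ∈ known Q, vert n ε e w = v
  · obtain ⟨w, hwk, rfl⟩ := hv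
    have hfil : (known Q).filter (fun u => vert n ε e u = vert n ε e w) = {w} := by
      refine Finset.ext fun u => ?_
      rw [mem_filter, mem_singleton]
      exact ⟨fun hu => H.vert_injOn hu.1 hwk hu.2, fun hu => ⟨hu ▸ hwk, by rw [hu]⟩⟩
    rw [hfil, prod_singleton]
    -- At a queried vertex the whole labelling is prescribed, one of at most six. The factor `3`
    -- stands for `d w` and the factor `2` for the coin `ε w`.
    by_cases hw : w ∈ Q
    · rw [if_pos (Or.inr hw), if_pos hw]
      have : Nonempty {g : (graph Z).neighborSet (vert n ε e w) ↪ Fin 3 //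
          LabelOk d ε e Q (vert n ε e w) g} :=
        let ⟨g, hg⟩ := H.exists_label hZ d hw
        ⟨⟨g, hg⟩⟩
      have h1 := Nat.card_pos (α := {g : (graph Z).neighborSet (vert n ε e w) ↪ Fin 3 //
          LabelOk d ε e Q (vert n ε e w) g})
      have h2 := card_embedding_le_six (Z := Z) (vert n ε e w)
      omega
    · rw [if_neg hw, mul_one]
      have nochild : ∀ u ∈ Q, vert n ε e w ≠ vert n ε e u := by
        intro u hu heq
        rw [H.vert_injOn hwk (H.queried_known hu) heq] at hw
        exact hw hu
      cases w with
      | nil =>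
        rw [if_neg (by simp [hw]), one_mul]
        refine le_of_eq (Nat.card_congr (Equiv.subtypeUnivEquiv fun g => ⟨?_, ?_⟩).symm)
        · intro c u hcu heq
          exact absurd (H.vert_injOn (nil_mem_known Q) hcu heq) (List.cons_ne_nil _ _).symm
        · intro c u hu heq
          exact absurd heq (nochild u hu)
      | cons c w =>
        rw [if_pos (Or.inl (List.cons_ne_nil _ _))]
        have hadj := (H.adj hZ hwk).symm
        have := Fintype.ofFinite ((graph Z).neighborSet (vert n ε e (c :: w)))
        let ev : ((graph Z).neighborSet (vert n ε e (c :: w)) ↪ Fin 3) →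
          (graph Z).neighborSet (vert n ε e (c :: w)) → Fin 3 := fun σ => σ
        -- At a known but unqueried vertex only the label towards the parent is prescribed, which
        -- costs a factor of at most `3`.
        have key := card_pinned_insert ev (fun y y' σ => σ.trans (Equiv.swap y y').toEmbedding)
          DFunLike.coe_injective (fun σ => σ.injective) (fun y y' σ i => rfl)
          (fun _ : Unit => ⟨vert n ε e w, hadj⟩) (fun _ => d (c :: w)) ∅ () (by simp) (by simp)
        rw [Fintype.card_fin] at key
        have h1 : (pinned ev (fun _ : Unit => ⟨vert n ε e w, hadj⟩) (fun _ => d (c :: w)) ∅).card =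
            Nat.card ((graph Z).neighborSet (vert n ε e (c :: w)) ↪ Fin 3) := by
          rw [Nat.card_eq_fintype_card, ← card_univ]
          simp [pinned]
        rw [← h1]
        refine key.trans (Nat.mul_le_mul_left _ ?_)
        rw [Nat.card_eq_fintype_card, Fintype.card_subtype]
        refine card_le_card fun g hg => ?_
        simp only [pinned, mem_filter, mem_univ, true_and, ev] at hg ⊢
        have hg := hg () (by simp)
        refine ⟨fun c' u hcu heq t ht htu => ?_, fun c' u hu heq => absurd heq (nochild u hu)⟩
        have h2 := H.vert_injOn hwk hcu heq
        rw [← h2, ← hg]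
        subst htu
        congr 2
        rw [(List.cons.inj h2).2]
  · have hfil : (known Q).filter (fun u => vert n ε e u = v) = ∅ := by
      rw [filter_eq_empty_iff]
      exact fun u hu heq => hv ⟨u, hu, heq⟩
    rw [hfil, prod_empty, one_mul]
    refine le_of_eq (Nat.card_congr (Equiv.subtypeUnivEquiv fun g => ⟨?_, ?_⟩).symm)
    · intro c u hcu heq
      exact absurd ⟨_, hcu, heq.symm⟩ hv
    · intro c u hu heq
      exact absurd ⟨_, H.queried_known hu, heq.symm⟩ hv

/-- Vertices are labelled independently, so the local shares multiply; each vertex carries at most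
one known word. -/
theorem GoodWalk.card_labelOk (H : GoodWalk n ε e h T Q) (hZ : CycleOk ε e Q Z)
    (d : List Bool → Fin 3) :
    Fintype.card (Coloring Z) ≤ 3 ^ (labelWords Q).card * 2 ^ Q.card *
      (univ.filter fun C : Coloring Z => ∀ v, LabelOk d ε e Q v (C v)).card := by
  have h1 : Fintype.card (Coloring Z) =
      ∏ v, Nat.card ((graph Z).neighborSet v ↪ Fin 3) := by
    rw [← Nat.card_eq_fintype_card, Nat.card_pi]
  have h2 : (univ.filter fun C : Coloring Z => ∀ v, LabelOk d ε e Q v (C v)).card =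
      ∏ v, Nat.card {g : (graph Z).neighborSet v ↪ Fin 3 // LabelOk d ε e Q v g} := by
    rw [← Nat.card_pi, ← Nat.card_congr (Equiv.subtypePiEquivPi
      (p := fun v (g : (graph Z).neighborSet v ↪ Fin 3) => LabelOk d ε e Q v g)),
      Nat.card_eq_fintype_card, Fintype.card_subtype]
  have h3 : 3 ^ (labelWords Q).card * 2 ^ Q.card = ∏ w ∈ known Q,
      (if w ≠ [] ∨ w ∈ Q then 3 else 1) * (if w ∈ Q then 2 else 1) := by
    rw [prod_mul_distrib, prod_ite, prod_ite, prod_const_one, prod_const_one, prod_const,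
      prod_const, mul_one, mul_one, filter_mem_eq_inter, inter_eq_right.mpr H.queried_known]
    rfl
  rw [h1, h2, h3, ← prod_fiberwise (known Q) (vert n ε e), ← prod_mul_distrib]
  exact prod_le_prod' fun v _ => H.card_labelOk_at hZ d v

/-- Prescribing the known names costs a factor `|Name|` for each word other than the root. Given
these names, a union bound over guesses and vertices lets a fraction of at most `δ` of the namings
use a guess. -/
theorem GoodWalk.card_nameOk (H : GoodWalk n ε e h T Q)
    (hx : Set.InjOn (nameOf x) ↑(known Q)) (hG : ∀ w ∈ known Q, nameOf x w ∉ G) {δ : ℝ}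
    (hδ : (G.card * Fintype.card (Vertex n) : ℝ) ≤
      δ * (Fintype.card (Name n) - (known Q).card : ℕ))
    (hpos : (known Q).card < Fintype.card (Name n)) (hδ1 : δ ≤ 1) :
    (1 - δ) * Fintype.card (Naming n) ≤ (Fintype.card (Name n) : ℝ) ^ ((known Q).erase []).card *
      (univ.filter fun f : Naming n => NameOk x ε e Q G f).card := by
  let ev : (Vertex n ↪ Name n) → Vertex n → Name n := fun σ => σ
  let a := vert n ε e
  let b := nameOf x
  let act : Name n → Name n → (Vertex n ↪ Name n) → (Vertex n ↪ Name n) :=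
    fun y y' σ => σ.trans (Equiv.swap y y').toEmbedding
  have hun : {[]} ∪ (known Q).erase [] = known Q := by
    rw [← insert_eq, insert_erase (nil_mem_known Q)]
  -- The name of the ENTRANCE is pinned from the start, which is exactly what distinguishes `Naming
  -- n` among all embeddings.
  have key := card_pinned ev act DFunLike.coe_injective (fun σ => σ.injective)
    (fun y y' σ i => rfl) a b {[]} ((known Q).erase []) (by simp)
    (by rw [hun]; exact H.vert_injOn) (by rw [hun]; exact hx)
  rw [hun] at key
  have hit := card_pinned_hit ev act DFunLike.coe_injective (fun σ => σ.injective)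
    (fun y y' σ i => rfl) a b (known Q) G hG
  have c1 : (pinned ev a b {[]}).card = Fintype.card (Naming n) := by
    rw [Fintype.card_subtype]
    congr 1
    refine Finset.ext fun f => ?_
    simp [pinned, ev, a, b, vert_nil, nameOf]
  have c2 : ((pinned ev a b (known Q)).filter fun σ => ¬ ∃ i, ev σ i ∈ G).card ≤
      (univ.filter fun f : Naming n => NameOk x ε e Q G f).card := by
    refine card_le_card_of_surjOn (fun f => f.1) ?_
    intro σ hσ
    simp only [pinned, coe_filter, mem_filter, mem_univ, true_and, Set.mem_ofPred_eq,
      not_exists] at hσ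
    refine ⟨⟨σ, hσ.1 [] (nil_mem_known Q)⟩, ?_, rfl⟩
    simp only [coe_filter, mem_univ, true_and, Set.mem_ofPred_eq]
    exact ⟨hσ.1, hσ.2⟩
  have c3 := card_filter_add_card_filter_not (s := pinned ev a b (known Q))
    (fun σ => ∃ i, ev σ i ∈ G)
  set p := (pinned ev a b (known Q)).card
  set q := ((pinned ev a b (known Q)).filter fun σ => ∃ i, ev σ i ∈ G).card
  set r := ((pinned ev a b (known Q)).filter fun σ => ¬ ∃ i, ev σ i ∈ G).card
  have hm : (0 : ℝ) < (Fintype.card (Name n) - (known Q).card : ℕ) := by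
    exact_mod_cast Nat.sub_pos_of_lt hpos
  have hq : (q : ℝ) ≤ δ * p := by
    have h1 : (q : ℝ) * (Fintype.card (Name n) - (known Q).card : ℕ) ≤
        G.card * Fintype.card (Vertex n) * p := by exact_mod_cast hit
    have h2 := h1.trans (mul_le_mul_of_nonneg_right hδ (Nat.cast_nonneg p))
    rw [mul_right_comm] at h2
    exact le_of_mul_le_mul_right h2 hm
  have hr : (1 - δ) * p ≤ r := by
    have : (q : ℝ) + r = p := by exact_mod_cast c3
    linarith
  have hk : (Fintype.card (Naming n) : ℝ) ≤
      (Fintype.card (Name n) : ℝ) ^ ((known Q).erase []).card * p := by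
    rw [← c1]; exact_mod_cast key
  calc (1 - δ) * Fintype.card (Naming n)
      ≤ (1 - δ) * ((Fintype.card (Name n) : ℝ) ^ ((known Q).erase []).card * p) :=
        mul_le_mul_of_nonneg_left hk (by linarith)
    _ = (Fintype.card (Name n) : ℝ) ^ ((known Q).erase []).card * ((1 - δ) * p) := by ring
    _ ≤ _ := by
        refine mul_le_mul_of_nonneg_left (hr.trans ?_) (by positivity)
        exact_mod_cast c2

end Compatible

/-! ### Double counting of seeds against worlds. -/

section Coupling

open Finset Classical

variable {n : ℕ}

/-- The random choices of the simulation: labels, names, coins, and leaves or cycle positions. -/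
abbrev Seed (n T : ℕ) : Type :=
  (TreeNode T → Fin 3) × (TreeNode T → Name n) × (TreeNode T → Bool) × (TreeNode T → Fin (2 ^ n))

/-- The simulated run of an algorithm with given choices. -/
noncomputable def seedRun {T : ℕ} (A : Algorithm n) (s : Seed n T) : Run n :=
  idealRun A (extend s.1) (extend s.2.1) T

/-- The known names are fresh and the walks are tame. -/
def Good {T : ℕ} (A : Algorithm n) (h : ℕ) (s : Seed n T) : Prop :=
  Fresh (extend s.2.1) (seedRun A s) ∧
    Tame n (extend s.2.2.1) (extend s.2.2.2) h T (known (seedRun A s).queried)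

theorem card_not_fresh_seed {T : ℕ} (A : Algorithm n) :
    ((univ.filter fun s : Seed n T => ¬ Fresh (extend s.2.1) (seedRun A s)).card : ℝ) ≤
      (2 * T * (2 * T) : ℝ) / 2 ^ (2 * n) * (Fintype.card (Seed n T) : ℕ) := by
  have h2 := fun d : TreeNode T → Fin 3 =>
    card_filter_prod_le_right (fun (x : TreeNode T → Name n)
      (_ : (TreeNode T → Bool) × (TreeNode T → Fin (2 ^ n))) =>
        ¬ Fresh (extend x) (idealRun A (extend d) (extend x) T))
      ((2 * T * (2 * T) : ℝ) / 2 ^ (2 * n)) fun _ =>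
      card_not_fresh T A (extend d)
  simp only [← Nat.cast_mul, ← Fintype.card_prod] at h2
  have h1 := card_filter_prod_le (fun (d : TreeNode T → Fin 3) (q : (TreeNode T → Name n) ×
      (TreeNode T → Bool) × (TreeNode T → Fin (2 ^ n))) =>
        ¬ Fresh (extend q.1) (idealRun A (extend d) (extend q.1) T)) _ h2
  rw [← Nat.cast_mul, ← Fintype.card_prod] at h1
  exact h1

theorem card_not_tame_seed {T h : ℕ} (A : Algorithm n) (hh : h ≤ n) :
    ((univ.filter fun s : Seed n T => ¬ Tame n (extend s.2.2.1) (extend s.2.2.2) h T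
        (known (seedRun A s).queried)).card : ℝ) ≤
      ((2 * T : ℝ) / 2 ^ (h + 1) + (2 * T + 1 : ℝ) ^ 2 * ((2 ^ h + (2 * T + 1)) / 2 ^ n)) *
        (Fintype.card (Seed n T) : ℕ) := by
  have h3 : ∀ (d : TreeNode T → Fin 3) (x : TreeNode T → Name n),
      ((univ.filter fun q : (TreeNode T → Bool) × (TreeNode T → Fin (2 ^ n)) =>
        ¬ Tame n (extend q.1) (extend q.2) h T
          (known (idealRun A (extend d) (extend x) T).queried)).card : ℝ) ≤
      ((2 * T : ℝ) / 2 ^ (h + 1) + (2 * T + 1 : ℝ) ^ 2 * ((2 ^ h + (2 * T + 1)) / 2 ^ n)) *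
        (Fintype.card ((TreeNode T → Bool) × (TreeNode T → Fin (2 ^ n))) : ℕ) := by
    intro d x
    refine (card_not_tame hh _ fun w hw => length_le_of_mem_known hw).trans ?_
    have hq := idealRun_card_le (A := A) (d := extend d) (x := extend x) T
    have h1 := card_erase_known_le (idealRun A (extend d) (extend x) T).queried
    have h2 := card_known_le (idealRun A (extend d) (extend x) T).queried
    have h1' : (((known (idealRun A (extend d) (extend x) T).queried).erase []).card : ℝ) ≤
        2 * T := by
      exact_mod_cast (show _ ≤ 2 * T by omega)
    have h2' : ((known (idealRun A (extend d) (extend x) T).queried).card : ℝ) ≤ 2 * T + 1 := by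
      exact_mod_cast (show _ ≤ 2 * T + 1 by omega)
    gcongr
  have h2 := fun d : TreeNode T → Fin 3 =>
    card_filter_prod_le (fun (x : TreeNode T → Name n)
      (q : (TreeNode T → Bool) × (TreeNode T → Fin (2 ^ n))) =>
        ¬ Tame n (extend q.1) (extend q.2) h T
          (known (idealRun A (extend d) (extend x) T).queried))
      ((2 * T : ℝ) / 2 ^ (h + 1) + (2 * T + 1 : ℝ) ^ 2 * ((2 ^ h + (2 * T + 1)) / 2 ^ n)) (h3 d)
  simp only [← Nat.cast_mul, ← Fintype.card_prod] at h2
  have h1 := card_filter_prod_le (fun (d : TreeNode T → Fin 3) (q : (TreeNode T → Name n) ×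
      (TreeNode T → Bool) × (TreeNode T → Fin (2 ^ n))) =>
        ¬ Tame n (extend q.2.1) (extend q.2.2) h T
          (known (idealRun A (extend d) (extend q.1) T).queried)) _ h2
  rw [← Nat.cast_mul, ← Fintype.card_prod] at h1
  exact h1

theorem card_not_good {T h : ℕ} (A : Algorithm n) (hh : h ≤ n) :
    ((univ.filter fun s : Seed n T => ¬ Good A h s).card : ℝ) ≤
      ((2 * T * (2 * T) : ℝ) / 2 ^ (2 * n) + ((2 * T : ℝ) / 2 ^ (h + 1) +
        (2 * T + 1 : ℝ) ^ 2 * ((2 ^ h + (2 * T + 1)) / 2 ^ n))) * (Fintype.card (Seed n T) : ℕ) := by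
  have hsub : (univ.filter fun s : Seed n T => ¬ Good A h s) ⊆
      (univ.filter fun s : Seed n T => ¬ Fresh (extend s.2.1) (seedRun A s)) ∪
      univ.filter fun s : Seed n T => ¬ Tame n (extend s.2.2.1) (extend s.2.2.2) h T
        (known (seedRun A s).queried) := by
    intro s hs
    rw [mem_union, mem_filter, mem_filter]
    have := (mem_filter.mp hs).2
    rw [Good, not_and_or] at this
    exact this.imp (fun h => ⟨mem_univ _, h⟩) fun h => ⟨mem_univ _, h⟩
  refine (Nat.cast_le (α := ℝ).mpr ((card_le_card hsub).trans (card_union_le _ _))).trans ?_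
  rw [Nat.cast_add, add_mul]
  exact add_le_add (card_not_fresh_seed A) (card_not_tame_seed A hh)

/-- A world fits the choices of the simulation. -/
structure Compat {T : ℕ} (A : Algorithm n) (s : Seed n T) (Z : LeafCycle n) (C : Coloring Z)
    (f : Naming n) : Prop where
  cycle : CycleOk (extend s.2.2.1) (extend s.2.2.2) (seedRun A s).queried Z
  label : ∀ v, LabelOk (extend s.1) (extend s.2.2.1) (extend s.2.2.2) (seedRun A s).queried v (C v)
  name : NameOk (extend s.2.1) (extend s.2.2.1) (extend s.2.2.2) (seedRun A s).queried
    (seedRun A s).guesses f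

/-- The number of values that the used choices could have taken. -/
noncomputable def weight {T : ℕ} (A : Algorithm n) (s : Seed n T) : ℕ :=
  (2 ^ n) ^ (leafWords n (extend s.2.2.1) (extend s.2.2.2) (seedRun A s).queried).card *
  (3 ^ (labelWords (seedRun A s).queried).card * 2 ^ (seedRun A s).queried.card *
  Fintype.card (Name n) ^ ((known (seedRun A s).queried).erase []).card)

theorem Good.goodWalk {T h : ℕ} {A : Algorithm n} {s : Seed n T} (hs : Good A h s)
    (hh : h + 1 ≤ n) (hT : T < 2 ^ n) :
    GoodWalk n (extend s.2.2.1) (extend s.2.2.2) h T (seedRun A s).queried where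
  height := hh
  small := hT
  length_le _ hw := length_le_of_mem_known hw
  suffix_closed _ hw _ hu := mem_known_of_suffix hw hu
  queried_known := idealRun_queried_subset_known T
  tame := hs.2

/-- The functions on words of length at most `T` agreeing with a given one on `U`. -/
theorem card_agree_words {T : ℕ} {α : Type*} [Fintype α] [Nonempty α] (U : Finset (List Bool))
    (hU : ∀ w ∈ U, w.length ≤ T) (g₀ : TreeNode T → α)
    [DecidablePred fun g : TreeNode T → α => ∀ w ∈ U, extend g w = extend g₀ w] :
    (univ.filter fun g : TreeNode T → α => ∀ w ∈ U, extend g w = extend g₀ w).card *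
      Fintype.card α ^ U.card = Fintype.card (TreeNode T → α) := by
  have hc : (U.subtype fun w => w.length ≤ T).card = U.card := by
    rw [card_subtype, filter_true_of_mem hU]
  rw [← card_agree (U.subtype fun w => w.length ≤ T) g₀, hc]
  congr 2
  ext g
  rw [mem_filter, mem_filter]
  refine and_congr_right fun _ => ?_
  constructor
  · rintro hg ⟨w, hw⟩ hm
    have := hg w (mem_subtype.mp hm)
    rwa [extend_apply g hw, extend_apply g₀ hw] at this
  · intro hg w hw
    rw [extend_apply g (hU w hw), extend_apply g₀ (hU w hw)]
    exact hg _ (mem_subtype.mpr hw)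

/-- A world fits few good choices. -/
theorem sum_weight_le {T h : ℕ} (A : Algorithm n) (hh : h + 1 ≤ n) (hT : T < 2 ^ n)
    {Z : LeafCycle n} (C : Coloring Z) (f : Naming n) :
    ∑ s : Seed n T with Good A h s ∧ Compat A s Z C f, weight A s ≤ Fintype.card (Seed n T) := by
  rcases (univ.filter fun s : Seed n T => Good A h s ∧ Compat A s Z C f).eq_empty_or_nonempty
    with h0 | ⟨s₀, hs₀⟩
  · rw [h0, sum_empty]
    exact Nat.zero_le _
  obtain ⟨g₀, c₀⟩ := (mem_filter.mp hs₀).2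
  set R := seedRun A s₀ with hR
  have hlen : ∀ w ∈ known R.queried, w.length ≤ T := fun w hw => length_le_of_mem_known hw
  have W₀ := g₀.goodWalk hh hT
  have key : ∀ s : Seed n T, Good A h s ∧ Compat A s Z C f →
      seedRun A s = R ∧ weight A s = weight A s₀ ∧
      (∀ w ∈ labelWords R.queried, extend s.1 w = extend s₀.1 w) ∧
      (∀ w ∈ (known R.queried).erase [], extend s.2.1 w = extend s₀.2.1 w) ∧
      (∀ w ∈ R.queried, extend s.2.2.1 w = extend s₀.2.2.1 w) ∧
      ∀ w ∈ leafWords n (extend s₀.2.2.1) (extend s₀.2.2.2) R.queried,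
        extend s.2.2.2 w = extend s₀.2.2.2 w := by
    rintro s ⟨g, c⟩
    obtain ⟨hrun, hq, hk⟩ := agree_of_compat W₀ (g.goodWalk hh hT) c₀.cycle c.cycle c₀.label
      c.label c₀.name c.name
    have hrun : R = seedRun A s := hrun
    refine ⟨hrun.symm, ?_, fun w hw => ?_, fun w hw => ?_, fun w hw => (hq w hw).2.symm,
      fun w hw => ?_⟩
    · unfold weight
      rw [← hrun, ← hR]
      congr 3
      refine filter_congr fun w hw => ?_
      rw [(hk w hw).word]
    · obtain ⟨hw, h0⟩ := mem_filter.mp hw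
      by_cases hw0 : w = []
      · exact (hq w (h0.resolve_left fun h => h hw0)).1.symm
      · exact ((hk w hw).label hw0).symm
    · obtain ⟨hne, hw⟩ := mem_erase.mp hw
      have := (hk w hw).name
      cases w with
      | nil => exact absurd rfl hne
      | cons c w => exact this.symm
    · obtain ⟨hw, hl⟩ := mem_filter.mp hw
      exact ((hk w hw).leaf hl).symm
  have hsub : (univ.filter fun s : Seed n T => Good A h s ∧ Compat A s Z C f) ⊆
      (univ.filter fun g => ∀ w ∈ labelWords R.queried, extend g w = extend s₀.1 w) ×ˢ
      (univ.filter fun g => ∀ w ∈ (known R.queried).erase [], extend g w = extend s₀.2.1 w) ×ˢ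
      (univ.filter fun g => ∀ w ∈ R.queried, extend g w = extend s₀.2.2.1 w) ×ˢ
      (univ.filter fun g => ∀ w ∈ leafWords n (extend s₀.2.2.1) (extend s₀.2.2.2) R.queried,
        extend g w = extend s₀.2.2.2 w) := by
    intro s hs
    obtain ⟨-, -, h1, h2, h3, h4⟩ := key s (mem_filter.mp hs).2
    simp only [mem_product, mem_filter, mem_univ, true_and]
    exact ⟨h1, h2, h3, h4⟩
  -- All summands are equal, and the seeds lie in a box whose used coordinates are fixed. The size
  -- of this box times the common weight is the number of all seeds.
  rw [sum_congr rfl fun s hs => (key s (mem_filter.mp hs).2).2.1, sum_const, smul_eq_mul]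
  refine (Nat.mul_le_mul_right _ (card_le_card hsub)).trans (le_of_eq ?_)
  have a1 := card_agree_words (labelWords R.queried)
    (fun w hw => hlen w (mem_filter.mp hw).1) s₀.1
  have a2 := card_agree_words ((known R.queried).erase [])
    (fun w hw => hlen w (mem_of_mem_erase hw)) s₀.2.1
  have a3 := card_agree_words R.queried (fun w hw => hlen w (W₀.queried_known hw)) s₀.2.2.1
  have a4 := card_agree_words (leafWords n (extend s₀.2.2.1) (extend s₀.2.2.2) R.queried)
    (fun w hw => hlen w (mem_filter.mp hw).1) s₀.2.2.2
  simp only [card_product]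
  rw [Fintype.card_prod, Fintype.card_prod, Fintype.card_prod, ← a1, ← a2, ← a3, ← a4,
    Fintype.card_fin, Fintype.card_fin, Fintype.card_bool, weight, ← hR]
  have hmul : ∀ a b c d a' b' c' d' : ℕ, a * (b * (c * d)) * (d' * (a' * c' * b')) =
      a * a' * (b * b' * (c * c' * (d * d'))) := by
    intros
    ring
  rw [hmul]
  congr!

/-- Markov-type step: a share of at least `c / r` on which `F ≥ ρ` forces a mean of at least `c ρ /
r`. Three uses chain the conditional shares of namings, colourings and cycles. -/
theorem le_expect_of_card {α : Type*} [Fintype α] [Nonempty α] {P : α → Prop} [DecidablePred P]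
    {F : α → ℝ}
    {c ρ r : ℝ} (hF : ∀ a, 0 ≤ F a) (hP : ∀ a, P a → ρ ≤ F a) (hρ : 0 ≤ ρ) (hr : 0 < r)
    (hc : c * Fintype.card α ≤ r * (univ.filter P).card) : c * ρ ≤ r * 𝔼 a, F a := by
  have hpos : (0 : ℝ) < Fintype.card α := by exact_mod_cast Fintype.card_pos
  have h1 : ρ * (univ.filter P).card ≤ ∑ a, F a := by
    rw [mul_comm, ← nsmul_eq_mul]
    refine (card_nsmul_le_sum _ _ _ fun a ha => hP a (mem_filter.mp ha).2).trans ?_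
    exact sum_le_sum_of_subset_of_nonneg (filter_subset _ _) fun a _ _ => hF a
  rw [Fintype.expect_eq_sum_div_card, ← mul_div_assoc, le_div_iff₀ hpos]
  calc c * ρ * Fintype.card α = ρ * (c * Fintype.card α) := by ring
    _ ≤ ρ * (r * (univ.filter P).card) := mul_le_mul_of_nonneg_left hc hρ
    _ = r * (ρ * (univ.filter P).card) := by ring
    _ ≤ _ := mul_le_mul_of_nonneg_left h1 hr.le

/-- Good choices fit many worlds. -/
theorem le_weight_mul_expect {T h : ℕ} {A : Algorithm n} (hn : 2 ≤ n) (hh : h + 1 ≤ n)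
    (hT : T < 2 ^ n) {s : Seed n T} (hs : Good A h s) {δ : ℝ} (hδ1 : δ ≤ 1)
    (hδ : ((seedRun A s).guesses.card * Fintype.card (Vertex n) : ℝ) ≤
      δ * (Fintype.card (Name n) - (known (seedRun A s).queried).card : ℕ))
    (hpos : (known (seedRun A s).queried).card < Fintype.card (Name n)) :
    1 - δ ≤ weight A s * 𝔼 Z : LeafCycle n, 𝔼 C : Coloring Z, 𝔼 f : Naming n,
      if Compat A s Z C f then (1 : ℝ) else 0 := by
  have : Nonempty (Naming n) := nonempty_naming hn
  have H := hs.goodWalk hh hT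
  set rZ : ℝ := (2 ^ n) ^ (leafWords n (extend s.2.2.1) (extend s.2.2.2)
    (seedRun A s).queried).card with hrZ
  set rC : ℝ := 3 ^ (labelWords (seedRun A s).queried).card * 2 ^ (seedRun A s).queried.card
    with hrC
  set rF : ℝ := (Fintype.card (Name n) : ℝ) ^ ((known (seedRun A s).queried).erase []).card
    with hrF
  have pC : 0 < rC := by positivity
  have pF : 0 < rF := by
    have : 0 < Fintype.card (Name n) := by omega
    positivity
  have hw : (weight A s : ℝ) = rZ * (rC * rF) := by
    rw [weight, hrZ, hrC, hrF]
    push_cast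
    rfl
  have nn : ∀ (p : Prop), (0 : ℝ) ≤ if p then 1 else 0 := fun p => by split_ifs <;> norm_num
  have hf : ∀ Z C, CycleOk (extend s.2.2.1) (extend s.2.2.2) (seedRun A s).queried Z →
      (∀ v, LabelOk (extend s.1) (extend s.2.2.1) (extend s.2.2.2) (seedRun A s).queried v (C v)) →
      (1 - δ) / rF ≤ 𝔼 f : Naming n, if Compat A s Z C f then (1 : ℝ) else 0 := by
    intro Z C hZ hC
    rw [div_le_iff₀' pF]
    have := le_expect_of_card (α := Naming n)
      (P := fun f => NameOk (extend s.2.1) (extend s.2.2.1) (extend s.2.2.2)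
        (seedRun A s).queried (seedRun A s).guesses f)
      (F := fun f => if Compat A s Z C f then (1 : ℝ) else 0) (c := 1 - δ) (ρ := 1) (r := rF)
      (fun _ => nn _) (fun f hf => by rw [if_pos ⟨hZ, hC, hf⟩]) zero_le_one pF
      (H.card_nameOk hs.1.inj hs.1.guess hδ hpos hδ1)
    rwa [mul_one] at this
  have hC : ∀ Z, CycleOk (extend s.2.2.1) (extend s.2.2.2) (seedRun A s).queried Z →
      (1 - δ) / rF / rC ≤ 𝔼 C : Coloring Z, 𝔼 f : Naming n,
        if Compat A s Z C f then (1 : ℝ) else 0 := by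
    intro Z hZ
    rw [div_le_iff₀' pC, ← one_mul ((1 - δ) / rF)]
    refine le_expect_of_card (P := fun C : Coloring Z => ∀ v, LabelOk (extend s.1)
      (extend s.2.2.1) (extend s.2.2.2) (seedRun A s).queried v (C v))
      (fun _ => expect_nonneg fun _ _ => nn _) (fun C hC => hf Z C hZ hC)
      (div_nonneg (by linarith) pF.le) pC ?_
    rw [one_mul, hrC]
    exact_mod_cast H.card_labelOk hZ (extend s.1)
  have hZ := le_expect_of_card (α := LeafCycle n)
    (P := fun Z => CycleOk (extend s.2.2.1) (extend s.2.2.2) (seedRun A s).queried Z)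
    (F := fun Z => 𝔼 C : Coloring Z, 𝔼 f : Naming n, if Compat A s Z C f then (1 : ℝ) else 0)
    (c := 1) (ρ := (1 - δ) / rF / rC) (r := rZ)
    (fun _ => expect_nonneg fun _ _ => expect_nonneg fun _ _ => nn _) hC
    (div_nonneg (div_nonneg (by linarith) pF.le) pC.le) (by positivity) (by
      rw [one_mul, hrZ]
      exact_mod_cast H.card_cycleOk)
  rw [hw]
  rw [one_mul, div_div, div_le_iff₀ (by positivity)] at hZ
  calc 1 - δ ≤ _ := hZ
    _ = _ := by ring

/-- The exit is found only if the simulation fails. -/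
theorem expect_wins_le {T h : ℕ} (A : Algorithm n) (hn : 2 ≤ n) (hh : h + 1 ≤ n)
    (hT : T < 2 ^ n) {δ : ℝ} (hδ0 : 0 ≤ δ) (hδ1 : δ ≤ 1)
    (hδ : ∀ s : Seed n T, ((seedRun A s).guesses.card * Fintype.card (Vertex n) : ℝ) ≤
      δ * (Fintype.card (Name n) - (known (seedRun A s).queried).card : ℕ))
    (hpos : ∀ s : Seed n T, (known (seedRun A s).queried).card < Fintype.card (Name n))
    (hlen : ∀ (Z : LeafCycle n) (C : Coloring Z) (f : Naming n) (k : ℕ),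
      (transcript A (oracle C f) k).length ≤ T) :
    (𝔼 Z : LeafCycle n, 𝔼 C : Coloring Z, 𝔼 f : Naming n, if Wins A C f then (1 : ℝ) else 0) ≤
      δ + ((2 * T * (2 * T) : ℝ) / 2 ^ (2 * n) + ((2 * T : ℝ) / 2 ^ (h + 1) +
        (2 * T + 1 : ℝ) ^ 2 * ((2 ^ h + (2 * T + 1)) / 2 ^ n))) := by
  have : Nonempty (Naming n) := nonempty_naming hn
  have hne : Nonempty (Name n) := ⟨fun _ => false⟩
  set S : ℝ := ((Fintype.card (Seed n T) : ℕ) : ℝ) with hS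
  have hSpos : 0 < S := by
    have : 0 < Fintype.card (Seed n T) := Fintype.card_pos
    rw [hS]
    exact_mod_cast this
  set B : ℝ := (2 * T * (2 * T) : ℝ) / 2 ^ (2 * n) + ((2 * T : ℝ) / 2 ^ (h + 1) +
        (2 * T + 1 : ℝ) ^ 2 * ((2 ^ h + (2 * T + 1)) / 2 ^ n))
  have hB : ((univ.filter fun s : Seed n T => ¬ Good A h s).card : ℝ) ≤ B * S :=
    card_not_good A (by omega)
  have hsplit : ((univ.filter fun s : Seed n T => Good A h s).card : ℝ) +
      (univ.filter fun s : Seed n T => ¬ Good A h s).card = S := by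
    rw [hS]
    exact_mod_cast card_filter_add_card_filter_not (s := (univ : Finset (Seed n T)))
      (fun s => Good A h s)
  have h1 : (1 - δ) * (univ.filter fun s : Seed n T => Good A h s).card ≤
      ∑ s : Seed n T with Good A h s, (weight A s : ℝ) * 𝔼 Z : LeafCycle n, 𝔼 C : Coloring Z,
        𝔼 f : Naming n, if Compat A s Z C f then (1 : ℝ) else 0 := by
    rw [mul_comm, ← nsmul_eq_mul]
    exact card_nsmul_le_sum _ _ _ fun s hs =>
      le_weight_mul_expect hn hh hT (mem_filter.mp hs).2 hδ1 (hδ s) (hpos s)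
  have h2 : ∑ s : Seed n T with Good A h s, (weight A s : ℝ) * (𝔼 Z : LeafCycle n,
      𝔼 C : Coloring Z, 𝔼 f : Naming n, if Compat A s Z C f then (1 : ℝ) else 0) =
      𝔼 Z : LeafCycle n, 𝔼 C : Coloring Z, 𝔼 f : Naming n, ∑ s : Seed n T with Good A h s,
        (weight A s : ℝ) * if Compat A s Z C f then (1 : ℝ) else 0 := by
    simp_rw [expect_sum_comm, mul_expect]
  have h3 : ∀ (Z : LeafCycle n) (C : Coloring Z) (f : Naming n),
      ∑ s : Seed n T with Good A h s, (weight A s : ℝ) * (if Compat A s Z C f then (1 : ℝ) else 0)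
        ≤ S * (1 - if Wins A C f then (1 : ℝ) else 0) := by
    intro Z C f
    have e1 : ∑ s : Seed n T with Good A h s,
        (weight A s : ℝ) * (if Compat A s Z C f then (1 : ℝ) else 0) =
        ∑ s : Seed n T with Good A h s ∧ Compat A s Z C f, (weight A s : ℝ) := by
      rw [← filter_filter, sum_filter (fun s => Compat A s Z C f)]
      refine sum_congr rfl fun s _ => ?_
      split_ifs <;> simp
    rw [e1]
    -- A world in which the algorithm wins has no good compatible seed; in any other world the
    -- weights sum to at most the number of seeds.
    by_cases hw : Wins A C f
    · have hempty : (univ.filter fun s : Seed n T => Good A h s ∧ Compat A s Z C f) = ∅ := by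
        rw [filter_eq_empty_iff]
        rintro s - ⟨g, c⟩
        exact (g.goodWalk hh hT).not_wins g.1 c.cycle c.label c.name (hlen Z C f) hw
      rw [hempty, if_pos hw]
      simp
    · rw [if_neg hw, sub_zero, mul_one, hS]
      exact_mod_cast sum_weight_le A hh hT C f
  have h4 : (𝔼 Z : LeafCycle n, 𝔼 C : Coloring Z, 𝔼 f : Naming n,
      ∑ s : Seed n T with Good A h s, (weight A s : ℝ) * if Compat A s Z C f then (1 : ℝ) else 0) ≤
      S * (1 - 𝔼 Z : LeafCycle n, 𝔼 C : Coloring Z, 𝔼 f : Naming n,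
        if Wins A C f then (1 : ℝ) else 0) := by
    refine (expect_le_expect fun Z _ => expect_le_expect fun C _ => expect_le_expect fun f _ =>
      h3 Z C f).trans (le_of_eq ?_)
    simp_rw [← mul_expect, expect_sub_distrib, Fintype.expect_const]
  set p := 𝔼 Z : LeafCycle n, 𝔼 C : Coloring Z, 𝔼 f : Naming n,
    if Wins A C f then (1 : ℝ) else 0
  have h5 : (1 - δ) * ((1 - B) * S) ≤ S * (1 - p) := by
    refine le_trans ?_ (h1.trans (h2.le.trans h4))
    exact mul_le_mul_of_nonneg_left (by linarith) (by linarith)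
  have h6 : (1 - δ) * (1 - B) ≤ 1 - p := by
    refine le_of_mul_le_mul_right ?_ hSpos
    linarith
  -- Expanding `(1 - δ) (1 - B)`, the product `δ * B` is nonnegative and can be dropped.
  have hB0 : 0 ≤ B := by positivity
  nlinarith

end Coupling

/-! ### Choice of parameters and the numerical bound. -/

section Estimate

open Finset Classical MeasureTheory

variable {n : ℕ}

theorem failure_bound_le {T h : ℕ} {u : ℝ} (hn : 13 ≤ n) (hu0 : 0 < u) (hu : u ^ 6 = 2 ^ n)
    (hT : (T : ℝ) ≤ u) (h1 : (2 : ℝ) ^ h ≤ u ^ 2) (h2 : u ^ 2 ≤ (2 : ℝ) ^ (h + 1)) :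
    8 * T / 2 ^ n + ((2 * T * (2 * T) : ℝ) / 2 ^ (2 * n) + ((2 * T : ℝ) / 2 ^ (h + 1) +
        (2 * T + 1 : ℝ) ^ 2 * ((2 ^ h + (2 * T + 1)) / 2 ^ n))) ≤ 4 / u := by
  -- A rational lower bound for `2 ^ (13 / 6)`, large enough for the polynomial inequality below.
  have hu4 : (4.48 : ℝ) ≤ u := by
    refine le_of_pow_le_pow_left₀ (n := 6) (by norm_num) hu0.le ?_
    rw [hu]
    calc (4.48 : ℝ) ^ 6 ≤ 2 ^ 13 := by norm_num
      _ ≤ 2 ^ n := pow_le_pow_right₀ (by norm_num) hn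
  have hT0 : (0 : ℝ) ≤ T := Nat.cast_nonneg T
  have p6 : 0 < u ^ 6 := by positivity
  rw [pow_mul', ← hu]
  have e1 : 8 * (T : ℝ) / u ^ 6 ≤ 8 * u / u ^ 6 := by gcongr
  have e2 : (2 * T * (2 * T) : ℝ) / (u ^ 6) ^ 2 ≤ 1 / u ^ 6 := by
    rw [div_le_div_iff₀ (by positivity) p6, one_mul, pow_two (u ^ 6)]
    refine mul_le_mul_of_nonneg_right ?_ p6.le
    calc (2 * T * (2 * T) : ℝ) ≤ 2 * u * (2 * u) := by gcongr
      _ = 4 * u ^ 2 := by ring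
      _ ≤ u ^ 4 * u ^ 2 := by
        gcongr
        calc (4 : ℝ) ≤ 4.48 ^ 4 := by norm_num
          _ ≤ u ^ 4 := by gcongr
      _ = u ^ 6 := by ring
  have e3 : (2 * T : ℝ) / 2 ^ (h + 1) ≤ 2 / u := by
    rw [div_le_div_iff₀ (by positivity) hu0]
    calc (2 * T * u : ℝ) ≤ 2 * u * u := by gcongr
      _ = 2 * u ^ 2 := by ring
      _ ≤ _ := by gcongr
  have e4 : (2 * T + 1 : ℝ) ^ 2 * ((2 ^ h + (2 * T + 1)) / u ^ 6) ≤
      (2 * u + 1) ^ 2 * ((u ^ 2 + (2 * u + 1)) / u ^ 6) := by gcongr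
  have e5 : 8 * u / u ^ 6 + 1 / u ^ 6 + (2 * u + 1) ^ 2 * ((u ^ 2 + (2 * u + 1)) / u ^ 6) ≤
      2 / u := by
    -- Horner scheme for `2 u ^ 5 - 4 u ^ 4 - 12 u ^ 3 - 13 u ^ 2 - 14 u - 2`, the difference of the
    -- numerators over `u ^ 6`.
    have q1 : 4.96 ≤ 2 * u - 4 := by linarith
    have q2 : 10 ≤ (2 * u - 4) * u - 12 := by nlinarith
    have q3 : 30 ≤ ((2 * u - 4) * u - 12) * u - 13 := by nlinarith
    have q4 : 100 ≤ (((2 * u - 4) * u - 12) * u - 13) * u - 14 := by nlinarith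
    have q5 : 0 ≤ ((((2 * u - 4) * u - 12) * u - 13) * u - 14) * u - 2 := by nlinarith
    have : (2 : ℝ) / u = 2 * u ^ 5 / u ^ 6 := by
      rw [div_eq_div_iff hu0.ne' p6.ne']
      ring
    rw [this, ← mul_div_assoc, ← add_div, ← add_div]
    refine div_le_div_of_nonneg_right ?_ p6.le
    linarith
  have e6 : (4 : ℝ) / u = 2 / u + 2 / u := by ring
  linarith

/-- The bound for a deterministic algorithm. -/
theorem expect_wins_le_four_div (A : Algorithm n) (hn : 13 ≤ n) {u : ℝ} (hu0 : 0 < u)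
    (hu : u ^ 6 = 2 ^ n)
    (hlen : ∀ (Z : LeafCycle n) (C : Coloring Z) (f : Naming n) (k : ℕ),
      ((transcript A (oracle C f) k).length : ℝ) ≤ u) :
    (𝔼 Z : LeafCycle n, 𝔼 C : Coloring Z, 𝔼 f : Naming n, if Wins A C f then (1 : ℝ) else 0) ≤
      4 / u := by
  set T := ⌊u⌋₊ with hTdef
  -- This puts `u ^ 2 = 2 ^ (n / 3)` between `2 ^ h` and `2 ^ (h + 1)`, balancing long climbs
  -- against large blocks.
  set h := (n - 1) / 3 with hh
  have hT : (T : ℝ) ≤ u := Nat.floor_le hu0.le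
  have hT0 : (0 : ℝ) ≤ T := Nat.cast_nonneg T
  have hu2 : (2 : ℝ) ≤ u := by
    refine le_of_pow_le_pow_left₀ (n := 6) (by norm_num) hu0.le ?_
    rw [hu]
    exact pow_le_pow_right₀ (by norm_num) (by omega)
  have h1 : (2 : ℝ) ^ h ≤ u ^ 2 := by
    refine le_of_pow_le_pow_left₀ (n := 3) (by norm_num) (by positivity) ?_
    rw [← pow_mul, ← pow_mul, hu]
    exact pow_le_pow_right₀ (by norm_num) (by omega)
  have h2 : u ^ 2 ≤ (2 : ℝ) ^ (h + 1) := by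
    refine le_of_pow_le_pow_left₀ (n := 3) (by norm_num) (by positivity) ?_
    rw [← pow_mul, ← pow_mul, hu]
    exact pow_le_pow_right₀ (by norm_num) (by omega)
  have hu8 : 8 * u ≤ u ^ 6 := by
    calc 8 * u ≤ 2 ^ 5 * u := by gcongr; norm_num
      _ ≤ u ^ 5 * u := by gcongr
      _ = u ^ 6 := by ring
  have hT8 : 8 * T ≤ 2 ^ n := by
    have : (8 * T : ℝ) ≤ 2 ^ n := by linarith
    exact_mod_cast this
  have hpow : 13 ≤ 2 ^ n := hn.trans Nat.lt_two_pow_self.le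
  have hname : Fintype.card (Name n) = 2 ^ n * 2 ^ n := by
    simp [← pow_add, two_mul]
  have hvert : Fintype.card (Vertex n) ≤ 4 * 2 ^ n := by
    have := card_treeNode n
    rw [pow_succ] at this
    rw [Fintype.card_sum]
    omega
  have hK : ∀ s : Seed n T, (known (seedRun A s).queried).card ≤ 2 * T + 1 ∧
      (seedRun A s).guesses.card ≤ T := by
    intro s
    have hq : (seedRun A s).queried.card + (seedRun A s).guesses.card ≤ T :=
      idealRun_card_le (A := A) (d := extend s.1) (x := extend s.2.1) T
    have := card_known_le (seedRun A s).queried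
    omega
  have hbig : 2 * (2 * T + 1) ≤ 2 ^ n * 2 ^ n := by nlinarith
  -- At most `T` guesses and `4 * 2 ^ n` vertices, against at least half of the `2 ^ n * 2 ^ n`
  -- names, give this `δ`.
  refine (expect_wins_le (T := T) (h := h) (δ := 8 * T / 2 ^ n) A (by omega) (by omega) (by omega)
    (by positivity) ?_ (fun s => ?_) (fun s => ?_) fun Z C f k => Nat.le_floor (hlen Z C f k)).trans
    (failure_bound_le hn hu0 hu hT h1 h2)
  · rw [div_le_one (by positivity)]
    exact_mod_cast hT8
  · obtain ⟨k1, k2⟩ := hK s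
    have hhalf : (2 ^ n * 2 ^ n : ℝ) ≤
        2 * (Fintype.card (Name n) - (known (seedRun A s).queried).card : ℕ) := by
      rw [hname]
      exact_mod_cast (show 2 ^ n * 2 ^ n ≤ 2 * (2 ^ n * 2 ^ n -
        (known (seedRun A s).queried).card) by omega)
    have hg : ((seedRun A s).guesses.card : ℝ) ≤ T := by exact_mod_cast k2
    have hv : (Fintype.card (Vertex n) : ℝ) ≤ 4 * 2 ^ n := by exact_mod_cast hvert
    calc ((seedRun A s).guesses.card * Fintype.card (Vertex n) : ℝ) ≤ T * (4 * 2 ^ n) := by gcongr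
      _ = 4 * T / 2 ^ n * (2 ^ n * 2 ^ n) := by field_simp
      _ ≤ 4 * T / 2 ^ n *
          (2 * (Fintype.card (Name n) - (known (seedRun A s).queried).card : ℕ)) := by gcongr
      _ = _ := by ring
  · have := (hK s).1
    rw [hname]
    omega

end Estimate

/-! ### Integrating over the coins of the algorithm. -/

section Coins

open Finset Classical MeasureTheory

variable {n : ℕ} {Ω : Type*} [MeasurableSpace Ω]

theorem measurableSet_transcript {A : Ω → Algorithm n}
    (hA : ∀ (h : List (Name n × Answer n)) (a : Name n), MeasurableSet {ω | A ω h = some a})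
    (O : Name n → Answer n) (k : ℕ) (l : List (Name n × Answer n)) :
    MeasurableSet {ω | transcript (A ω) O k = l} := by
  have hA' : ∀ (h : List (Name n × Answer n)) (o : Option (Name n)),
      MeasurableSet {ω | A ω h = o} := by
    intro h o
    cases o with
    | some a => exact hA h a
    | none =>
      have : {ω | A ω h = none} = (⋃ a, {ω | A ω h = some a})ᶜ := by
        ext ω
        simp [Option.eq_none_iff_forall_ne_some]
      rw [this]
      exact (MeasurableSet.iUnion fun a => hA h a).compl
  induction k generalizing l with
  | zero => exact MeasurableSet.const ([] = l)
  | succ k ih =>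
    -- Names and answers form finite types, so there are only countably many transcripts and the
    -- union is countable.
    have : {ω | transcript (A ω) O (k + 1) = l} = ⋃ (l' : List (Name n × Answer n)),
        ⋃ o : Option (Name n), {ω | transcript (A ω) O k = l'} ∩ ({ω | A ω l' = o} ∩
          {_ω | (match o with | none => l' | some a => l' ++ [(a, O a)]) = l}) := by
      ext ω
      simp only [Set.mem_iUnion, Set.mem_inter_iff, Set.mem_ofPred_eq]
      constructor
      · intro h
        exact ⟨_, _, rfl, rfl, h⟩
      · rintro ⟨_, _, rfl, rfl, h⟩
        exact h
    rw [this]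
    exact MeasurableSet.iUnion fun l' => MeasurableSet.iUnion fun o =>
      (ih l').inter ((hA' l' o).inter (MeasurableSet.const _))

theorem measurableSet_wins {A : Ω → Algorithm n}
    (hA : ∀ (h : List (Name n × Answer n)) (a : Name n), MeasurableSet {ω | A ω h = some a})
    {Z : LeafCycle n} (C : Coloring Z) (f : Naming n) :
    MeasurableSet {ω | Wins (A ω) C f} := by
  have : {ω | Wins (A ω) C f} = ⋃ (k : ℕ) (l : List (Name n × Answer n)),
      {ω | transcript (A ω) (oracle C f) k = l} ∩ {_ω | ∃ q ∈ l, q.1 = f.1 (exit n)} := by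
    ext ω
    simp only [Set.mem_iUnion, Set.mem_inter_iff, Set.mem_ofPred_eq, Wins]
    constructor
    · rintro ⟨k, h⟩
      exact ⟨k, _, rfl, h⟩
    · rintro ⟨k, _, rfl, h⟩
      exact ⟨k, h⟩
  rw [this]
  exact MeasurableSet.iUnion fun k => MeasurableSet.iUnion fun l =>
    (measurableSet_transcript hA _ k l).inter (MeasurableSet.const _)

theorem integrable_expect {α : Type*} [Fintype α] {μ : Measure Ω} {F : α → Ω → ℝ}
    (hF : ∀ a, Integrable (F a) μ) : Integrable (fun ω => 𝔼 a, F a ω) μ := by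
  simp_rw [Fintype.expect_eq_sum_div_card]
  exact (integrable_finsetSum _ fun a _ => hF a).div_const _

theorem expect_integral {α : Type*} [Fintype α] {μ : Measure Ω} {F : α → Ω → ℝ}
    (hF : ∀ a, Integrable (F a) μ) : 𝔼 a, ∫ ω, F a ω ∂μ = ∫ ω, 𝔼 a, F a ω ∂μ := by
  simp_rw [Fintype.expect_eq_sum_div_card]
  rw [integral_div, integral_finsetSum _ fun a _ => hF a]

/-- A bound for all values of the coins holds for the randomized algorithm. -/
theorem successProb_le {μ : Measure Ω} [IsProbabilityMeasure μ] {A : Ω → Algorithm n}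
    (hA : ∀ (h : List (Name n × Answer n)) (a : Name n), MeasurableSet {ω | A ω h = some a})
    {c : ℝ} (hc : ∀ ω, (𝔼 Z : LeafCycle n, 𝔼 C : Coloring Z, 𝔼 f : Naming n,
      if Wins (A ω) C f then (1 : ℝ) else 0) ≤ c) : successProb μ A ≤ c := by
  have hi : ∀ (Z : LeafCycle n) (C : Coloring Z) (f : Naming n),
      Integrable (fun ω => if Wins (A ω) C f then (1 : ℝ) else 0) μ := fun Z C f =>
    (integrable_const (1 : ℝ)).indicator (measurableSet_wins hA C f)
  have hμ : ∀ (Z : LeafCycle n) (C : Coloring Z) (f : Naming n),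
      μ.real {ω | Wins (A ω) C f} = ∫ ω, (if Wins (A ω) C f then (1 : ℝ) else 0) ∂μ := fun Z C f =>
    (integral_indicator_one (measurableSet_wins hA C f)).symm
  have he : successProb μ A = ∫ ω, (𝔼 Z : LeafCycle n, 𝔼 C : Coloring Z, 𝔼 f : Naming n,
      if Wins (A ω) C f then (1 : ℝ) else 0) ∂μ := by
    rw [successProb]
    simp_rw [hμ]
    rw [← expect_integral fun Z => integrable_expect fun C => integrable_expect (hi Z C)]
    refine expect_congr rfl fun Z _ => ?_
    rw [← expect_integral fun C => integrable_expect (hi Z C)]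
    exact expect_congr rfl fun C _ => expect_integral (hi Z C)
  rw [he]
  refine (integral_mono (integrable_expect fun Z => integrable_expect fun C =>
    integrable_expect (hi Z C)) (integrable_const c) hc).trans (le_of_eq ?_)
  simp

end Coins

end GluedTrees

theorem theorem2 (n : ℕ) (hn : 2 ≤ n) {Ω : Type*} [MeasurableSpace Ω]
    (μ : MeasureTheory.Measure Ω) [MeasureTheory.IsProbabilityMeasure μ]
    (A : Ω → GluedTrees.Algorithm n)
    (hA : ∀ (h : List (GluedTrees.Name n × GluedTrees.Answer n)) (a : GluedTrees.Name n),
      MeasurableSet {ω | A ω h = some a})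
    (hq : ∀ (ω : Ω) (Z : GluedTrees.LeafCycle n) (C : GluedTrees.Coloring Z)
      (f : GluedTrees.Naming n) (k : ℕ),
      ((GluedTrees.transcript (A ω) (GluedTrees.oracle C f) k).length : ℝ)
        ≤ (2 : ℝ) ^ ((n : ℝ) / 6)) :
    GluedTrees.successProb μ A ≤ 4 * (2 : ℝ) ^ (-((n : ℝ) / 6)) := by
  have hu0 : (0 : ℝ) < 2 ^ ((n : ℝ) / 6) := by positivity
  rw [Real.rpow_neg (by norm_num), ← div_eq_mul_inv]
  refine GluedTrees.successProb_le hA fun ω => ?_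
  -- For `n ≤ 12` the right-hand side is at least `4 / 2 ^ 2 = 1`, and any probability satisfies the
  -- bound.
  rcases Nat.lt_or_ge n 13 with h13 | h13
  · have : Nonempty (GluedTrees.Naming n) := GluedTrees.nonempty_naming hn
    refine le_trans (b := 1) ?_ ?_
    · refine Finset.expect_le Finset.univ_nonempty fun Z _ => ?_
      refine Finset.expect_le Finset.univ_nonempty fun C _ => ?_
      refine Finset.expect_le Finset.univ_nonempty fun f _ => ?_
      split_ifs <;> norm_num
    · rw [le_div_iff₀ hu0, one_mul]
      calc (2 : ℝ) ^ ((n : ℝ) / 6) ≤ 2 ^ (2 : ℝ) := by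
            refine Real.rpow_le_rpow_of_exponent_le (by norm_num) ?_
            have : (n : ℝ) ≤ 12 := by exact_mod_cast Nat.lt_succ_iff.mp h13
            linarith
        _ = 4 := by norm_num
  · refine GluedTrees.expect_wins_le_four_div (A ω) h13 hu0 ?_ (hq ω)
    rw [← Real.rpow_natCast, ← Real.rpow_mul (by norm_num), ← Real.rpow_natCast]
    congr 1
    push_cast
    ring
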